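/- Let $L=\mathbb Z^N$ be a positive definite even integral lattice of even rank $N$ with Gram matrix $S$, bilinear form $(x,y)=x^{t}Sy$ (extended bilinearly to $\mathbb Q^N$ and $\mathbb C^N$) and dual lattice $L^\vee=S^{-1}\mathbb Z^N$. Let $\mathcal H$ be the upper half plane and let $k,m\geq 1$ be integers with $k$ even and $k>N+2$. For $\phi:\mathcal H\times\mathbb C^N\to\mathbb C$ put $$(\phi|_{k,m}A)(\tau,z)=(c\tau+d)^{-k}e^{-\pi i m\frac{c(z,z)}{c\tau+d}}\,\phi\Big(\tfrac{a\tau+b}{c\tau+d},\tfrac{z}{c\tau+d}\Big),\quad A=\begin{pmatrix}a&b\\c&d\end{pmatrix}\in SL_2(\mathbb Z),$$ $$(\phi|_{m}[x,y])(\tau,z)=e^{\pi i m((x,x)\tau+2(x,z))}\phi(\tau,z+x\tau+y),\quad x,y\in L .$$ These define a right action of the Jacobi group $\Gamma^J=SL_2(\mathbb Z)\ltimes(L\times L)$, where $A[x,y]A^{-1}=[dx-cy,-bx+ay]$. Let $\Gamma^J_\infty=\{g\in\Gamma^J: 1|_{k,m}g=1\}$ and $$E_{k,m}=\sum_{g\in\Gamma^J_\infty\backslash\Gamma^J}1|_{k,m}g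 .$$ A holomorphic Jacobi form of weight $k$ and index $m$ is a holomorphic function $\phi$ on $\mathcal H\times\mathbb C^N$ with $\phi|_{k,m}g=\phi$ for all $g\in\Gamma^J$ that has an expansion $\phi(\tau,z)=\sum f(n,l)e^{2\pi i n\tau+2\pi i(l,z)}$ over $n\in\mathbb Z$, $l\in L^\vee$ with $2nm-(l,l)\ge 0$. Let $\Theta_{mS,0,0}(\tau,z)=\sum_{\lambda\in\mathbb Z^N}\exp\big(\pi i m((\lambda,\lambda)\tau+2(\lambda,z))\big)$, let $q(L)$ be the least integer $\mu\ge 1$ with $\mu(p,p)\in 2\mathbb Z$ for all $p\in L^\vee$, let $(\lambda+L,\lambda+L)=(\lambda,\lambda)+2\mathbb Z\in\mathbb Q/2\mathbb Z$ for $\lambda\in L^\vee$ be the discriminant form, and put $\Delta(n,\lambda)=nm-\frac12(\lambda,\lambda)$. Theorem. The series $E_{k,m}$ converges absolutely at every point of $\mathcal H\times\mathbb C^N$ and is a holomorphic Jacobi form of weight $k$ and index $m$. The series defining $\Theta_{mS,0,0}$ converges absolutely, and the Fourier expansion of $E_{k,m}$ is $$E_{k,m}(\tau,z)=\Theta_{mS,0,0}(\tau,z)+\sum_{n=1}^{\infty}\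 \sum_{\substack{\lambda\in S^{-1}\mathbb Z^N\\ nm>\frac12(\lambda,\lambda)}}\beta_{k,m}(n,\lambda)\,e^{2\pi i n\tau}e^{2\pi i(\lambda,z)},$$ with absolute convergence over the pairs $(n,\lambda)$, where $$\begin{aligned}\beta_{k,m}(n,\lambda)={}&\frac{(-2\pi i/q(L))^{k-N/2}}{(k-N/2-1)!}\cdot\frac{(\det S)^{-1/2}}{i^{N/2}}\,\big(q(L)\Delta(n,\lambda)\big)^{k-N/2-1}\\ &\times\sum_{c=1}^\infty\ \sum_{\substack{d'\bmod mc\\ (c,d')=1}}(mc)^{-k}\sum_{x\in L/cL}\exp\Big\{\frac{\pi i}{c}\big(ma(x,x)-2(\lambda,x)+2nd'\big)\Big\}\\ &\times\sum_{\nu\bmod q(L)}\exp(2\pi i nm\nu)\exp\big(\pi i\nu(\lambda+L,\lambda+L)\big)\exp\big(-\pi i\nu(\lambda,\lambda)\big).\end{aligned}$$ Here $a$ is an integer with $ad'\equiv 1\pmod c$, and the series over $c$ converges absolutely. -/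

import Mathlib

open scoped MatrixGroups UpperHalfPlane

noncomputable section

namespace JacobiEisenstein

/-- The bilinear form `(x, y)_T = xᵗ T y` of an integral matrix `T`, with coefficients in any
commutative ring (used over `ℤ`, `ℚ` and `ℂ`). -/
def bil {N : ℕ} {R : Type*} [CommRing R] (T : Matrix (Fin N) (Fin N) ℤ) (x y : Fin N → R) : R :=
  ∑ i, ∑ j, x i * (T i j : R) * y j

/-- A positive definite even integral lattice of rank `N`: the group `ℤ^N` together with the
bilinear form whose Gram matrix in the standard basis is `gram`. -/
structure EvenLattice (N : ℕ) where
  gram : Matrix (Fin N) (Fin N) ℤ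
  isSymm : gram.IsSymm
  even : ∀ x : Fin N → ℤ, Even (bil gram x x)
  posDef : (gram.map (Int.cast : ℤ → ℝ)).PosDef

section Form

variable {N : ℕ} {R : Type*} [CommRing R] (T : Matrix (Fin N) (Fin N) ℤ)

theorem bil_add_left (x x' y : Fin N → R) : bil T (x + x') y = bil T x y + bil T x' y := by
  simp only [bil, ← Finset.sum_add_distrib, Pi.add_apply, add_mul]

theorem bil_add_right (x y y' : Fin N → R) : bil T x (y + y') = bil T x y + bil T x y' := by
  simp only [bil, ← Finset.sum_add_distrib, Pi.add_apply, mul_add]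

theorem bil_smul_left (r : R) (x y : Fin N → R) : bil T (r • x) y = r * bil T x y := by
  simp only [bil, Finset.mul_sum, Pi.smul_apply, smul_eq_mul, mul_assoc]

theorem bil_smul_right (r : R) (x y : Fin N → R) : bil T x (r • y) = r * bil T x y := by
  simp only [bil, Finset.mul_sum, Pi.smul_apply, smul_eq_mul]
  refine Finset.sum_congr rfl fun i _ => Finset.sum_congr rfl fun j _ => by ring

theorem bil_comm {T : Matrix (Fin N) (Fin N) ℤ} (hT : T.IsSymm) (x y : Fin N → R) :
    bil T x y = bil T y x := by
  unfold bil
  rw [Finset.sum_comm]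
  refine Finset.sum_congr rfl fun i _ => Finset.sum_congr rfl fun j _ => ?_
  rw [hT.apply i j]
  ring

theorem bil_intCast (x y : Fin N → ℤ) :
    bil T (fun i => (x i : R)) (fun i => (y i : R)) = ((bil T x y : ℤ) : R) := by
  simp [bil]

end Form

/-! ### Dual lattice, level and discriminant form -/

/-- The lattice `L = ℤ^N` inside `L ⊗ ℚ = ℚ^N`. -/
def baseLattice (N : ℕ) : AddSubgroup (Fin N → ℚ) :=
  ((Int.castAddHom ℚ).compLeft (Fin N)).range

/-- The dual lattice `L^∨ = {λ ∈ L ⊗ ℚ | (λ, l) ∈ ℤ for all l ∈ L}`. -/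
def dualLattice {N : ℕ} (L : EvenLattice N) : AddSubgroup (Fin N → ℚ) where
  carrier := {lam | ∀ l : Fin N → ℤ, ∃ j : ℤ, bil L.gram lam (fun i => (l i : ℚ)) = j}
  zero_mem' := fun l => ⟨0, by simp [bil]⟩
  add_mem' := by
    intro a b ha hb l
    obtain ⟨i, hi⟩ := ha l
    obtain ⟨j, hj⟩ := hb l
    exact ⟨i + j, by rw [bil_add_left, hi, hj]; push_cast; rfl⟩
  neg_mem' := by
    intro a ha l
    obtain ⟨i, hi⟩ := ha l
    refine ⟨-i, ?_⟩
    have h := bil_smul_left L.gram (-1 : ℚ) a (fun i => (l i : ℚ))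
    rw [neg_one_smul] at h
    rw [h, hi]
    push_cast
    ring

/-- The dual lattice is `S⁻¹ ℤ^N`. -/
theorem mem_dualLattice_iff {N : ℕ} (L : EvenLattice N) (lam : Fin N → ℚ) :
    lam ∈ dualLattice L ↔ ∃ v : Fin N → ℤ,
      lam = (L.gram.map (Int.cast : ℤ → ℚ))⁻¹.mulVec (fun i => (v i : ℚ)) := by
  have hdet : IsUnit (L.gram.map (Int.cast : ℤ → ℚ)).det := by
    have h1 : (L.gram.map (Int.cast : ℤ → ℝ)).det ≠ 0 := L.posDef.det_pos.ne'
    have h2 : (L.gram.map (Int.cast : ℤ → ℝ)).det = ((L.gram.det : ℤ) : ℝ) :=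
      (Int.cast_det L.gram).symm
    have h3 : (L.gram.map (Int.cast : ℤ → ℚ)).det = ((L.gram.det : ℤ) : ℚ) :=
      (Int.cast_det L.gram).symm
    rw [h2] at h1
    rw [h3, isUnit_iff_ne_zero]
    exact_mod_cast h1
  have hform : ∀ y : Fin N → ℚ,
      bil L.gram lam y = ∑ i, (L.gram.map (Int.cast : ℤ → ℚ)).mulVec lam i * y i := by
    intro y
    rw [bil_comm L.isSymm]
    simp only [bil, Matrix.mulVec, dotProduct, Finset.sum_mul, Matrix.map_apply]
    refine Finset.sum_congr rfl fun i _ => Finset.sum_congr rfl fun j _ => by ring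
  constructor
  · intro h
    choose v hv using fun i : Fin N => h (Pi.single i 1)
    refine ⟨v, ?_⟩
    have : (fun i => (v i : ℚ)) = (L.gram.map (Int.cast : ℤ → ℚ)).mulVec lam := by
      funext i
      rw [← hv i, hform]
      rw [Finset.sum_eq_single i] <;> simp +contextual
    rw [this, Matrix.mulVec_mulVec, Matrix.nonsing_inv_mul _ hdet, Matrix.one_mulVec]
  · rintro ⟨v, rfl⟩ l
    refine ⟨∑ i, v i * l i, ?_⟩
    rw [hform, Matrix.mulVec_mulVec, Matrix.mul_nonsing_inv _ hdet, Matrix.one_mulVec]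
    push_cast
    rfl

/-- The level `q(L)`: the least positive integer `μ` such that `μ (p, p) ∈ 2ℤ` for all
`p ∈ L^∨`. -/
def level {N : ℕ} (L : EvenLattice N) : ℕ :=
  sInf {μ : ℕ | 0 < μ ∧ ∀ p ∈ dualLattice L, ∃ j : ℤ, (μ : ℚ) * bil L.gram p p = 2 * j}

/-- The discriminant group `L^∨ / L`. -/
abbrev DiscriminantGroup {N : ℕ} (L : EvenLattice N) : Type :=
  dualLattice L ⧸ (baseLattice N).addSubgroupOf (dualLattice L)

/-- The discriminant form `L^∨ / L → ℚ / 2ℤ`, `λ + L ↦ (λ, λ) + 2ℤ`. -/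
def discForm {N : ℕ} (L : EvenLattice N) : DiscriminantGroup L → AddCircle (2 : ℚ) :=
  Quotient.lift (fun lam : dualLattice L =>
      ((bil L.gram (lam : Fin N → ℚ) (lam : Fin N → ℚ) : ℚ) : AddCircle (2 : ℚ))) (by
    intro a b hab
    have hab' : -a + b ∈ (baseLattice N).addSubgroupOf (dualLattice L) :=
      QuotientAddGroup.leftRel_apply.mp hab
    obtain ⟨x, hx⟩ := AddSubgroup.mem_addSubgroupOf.mp hab'
    have hb : (b : Fin N → ℚ) = (a : Fin N → ℚ) + fun i => (x i : ℚ) := by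
      have : (fun i => (x i : ℚ)) = -(a : Fin N → ℚ) + (b : Fin N → ℚ) := by
        rw [← AddSubgroup.coe_neg, ← AddSubgroup.coe_add, ← hx]
        rfl
      rw [this]
      abel
    obtain ⟨j, hj⟩ := a.2 x
    obtain ⟨t, ht⟩ := L.even x
    have key : bil L.gram (b : Fin N → ℚ) (b : Fin N → ℚ) =
        bil L.gram (a : Fin N → ℚ) (a : Fin N → ℚ) + (j + t : ℤ) • (2 : ℚ) := by
      rw [hb, bil_add_left, bil_add_right, bil_add_right,
        bil_comm L.isSymm (fun i => (x i : ℚ)) (a : Fin N → ℚ), hj, bil_intCast, ht]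
      simp only [zsmul_eq_mul]
      push_cast
      ring
    change ((bil L.gram (a : Fin N → ℚ) (a : Fin N → ℚ) : ℚ) : AddCircle (2 : ℚ)) =
      ((bil L.gram (b : Fin N → ℚ) (b : Fin N → ℚ) : ℚ) : AddCircle (2 : ℚ))
    rw [key, AddCircle.coe_add, AddCircle.coe_zsmul, AddCircle.coe_period, smul_zero, add_zero])

/-- The character `r + 2ℤ ↦ exp(π i ν r)` of `ℚ / 2ℤ`, for an integer `ν`. -/
def expPi (ν : ℤ) : AddCircle (2 : ℚ) → ℂ :=
  Function.Periodic.lift (f := fun r : ℚ => Complex.exp (Real.pi * Complex.I * ν * (r : ℂ)))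
    (by
      intro r
      change Complex.exp _ = Complex.exp _
      rw [Complex.exp_eq_exp_iff_exists_int]
      exact ⟨ν, by push_cast; ring⟩)

/-! ### The Jacobi group and its action on functions -/

/-- The determinant relation `a d - b c = 1`. -/
theorem sl_det (A : SL(2, ℤ)) : A 0 0 * A 1 1 - A 0 1 * A 1 0 = 1 := by
  have h := A.det_coe
  rw [Matrix.det_fin_two] at h
  exact h

/-- The action `A.[x, y] = [d x - c y, -b x + a y]` of `SL(2, ℤ)` on `L × L`
(written multiplicatively), where `A = (a, b; c, d)`. -/
def slAction (N : ℕ) : SL(2, ℤ) →* MulAut (Multiplicative ((Fin N → ℤ) × (Fin N → ℤ))) where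
  toFun A :=
    { toFun := fun X => Multiplicative.ofAdd
        (A 1 1 • X.toAdd.1 - A 1 0 • X.toAdd.2, -A 0 1 • X.toAdd.1 + A 0 0 • X.toAdd.2)
      invFun := fun X => Multiplicative.ofAdd
        (A 0 0 • X.toAdd.1 + A 1 0 • X.toAdd.2, A 0 1 • X.toAdd.1 + A 1 1 • X.toAdd.2)
      left_inv := by
        intro X
        have h := sl_det A
        apply Multiplicative.toAdd.injective
        ext i <;> simp
        · linear_combination (X.toAdd.1 i) * h
        · linear_combination (X.toAdd.2 i) * h
      right_inv := by
        intro X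
        have h := sl_det A
        apply Multiplicative.toAdd.injective
        ext i <;> simp
        · linear_combination (X.toAdd.1 i) * h
        · linear_combination (X.toAdd.2 i) * h
      map_mul' := by
        intro X Y
        apply Multiplicative.toAdd.injective
        ext i <;> simp <;> ring }
  map_one' := by
    refine MulEquiv.ext fun X => ?_
    apply Multiplicative.toAdd.injective
    ext i <;> simp
  map_mul' A B := by
    refine MulEquiv.ext fun X => ?_
    apply Multiplicative.toAdd.injective
    ext i <;> simp [Matrix.mul_apply, Fin.sum_univ_two] <;> ring

/-- The Jacobi group `Γ^J = SL(2, ℤ) ⋉ (L × L)`. The element with components `left = [x, y]` and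
`right = A` is the product `{I, [x, y]} · {A, [0, 0]}`. -/
abbrev JacobiGroup (N : ℕ) : Type :=
  SemidirectProduct (Multiplicative ((Fin N → ℤ) × (Fin N → ℤ))) SL(2, ℤ) (slAction N)

/-- The factor `c τ + d`. -/
def autFactor (A : SL(2, ℤ)) (τ : ℍ) : ℂ := (A 1 0 : ℂ) * (τ : ℂ) + (A 1 1 : ℂ)

/-- `φ |_{k,m} A` for `A ∈ SL(2, ℤ)`. -/
def slashSL {N : ℕ} (L : EvenLattice N) (k m : ℕ) (φ : ℍ → (Fin N → ℂ) → ℂ) (A : SL(2, ℤ)) :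
    ℍ → (Fin N → ℂ) → ℂ := fun τ z =>
  autFactor A τ ^ (-(k : ℤ)) *
    Complex.exp (-(Real.pi * Complex.I * m * ((A 1 0 : ℂ) * bil L.gram z z / autFactor A τ))) *
    φ (A • τ) ((autFactor A τ)⁻¹ • z)

/-- `φ |_m [x, y]` for `x, y ∈ L`. -/
def slashLattice {N : ℕ} (L : EvenLattice N) (m : ℕ) (φ : ℍ → (Fin N → ℂ) → ℂ)
    (x y : Fin N → ℤ) : ℍ → (Fin N → ℂ) → ℂ := fun τ z =>
  Complex.exp (Real.pi * Complex.I * m *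
    (bil L.gram (fun i => (x i : ℂ)) (fun i => (x i : ℂ)) * (τ : ℂ) +
      2 * bil L.gram (fun i => (x i : ℂ)) z)) *
    φ τ (z + (τ : ℂ) • (fun i => (x i : ℂ)) + fun i => (y i : ℂ))

/-- The action `φ |_{k,m} g` of the Jacobi group: if `g = {I, [x, y]} · {A, [0, 0]}`, it is
`(φ |_m [x, y]) |_{k,m} A`. -/
def slash {N : ℕ} (L : EvenLattice N) (k m : ℕ) (φ : ℍ → (Fin N → ℂ) → ℂ) (g : JacobiGroup N) :
    ℍ → (Fin N → ℂ) → ℂ :=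
  slashSL L k m (slashLattice L m φ g.left.toAdd.1 g.left.toAdd.2) g.right

theorem autFactor_ne_zero (A : SL(2, ℤ)) (τ : ℍ) : autFactor A τ ≠ 0 := by
  have h := UpperHalfPlane.denom_ne_zero (A : GL (Fin 2) ℝ) τ
  rw [ModularGroup.denom_apply] at h
  exact h

theorem coe_sl_smul (A : SL(2, ℤ)) (τ : ℍ) :
    ((A • τ : ℍ) : ℂ) = ((A 0 0 : ℂ) * (τ : ℂ) + (A 0 1 : ℂ)) / autFactor A τ := by
  rw [UpperHalfPlane.coe_specialLinearGroup_apply]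
  simp [autFactor]

theorem autFactor_mul (A B : SL(2, ℤ)) (τ : ℍ) :
    autFactor (A * B) τ = autFactor A (B • τ) * autFactor B τ := by
  have h := autFactor_ne_zero B τ
  have e : autFactor A (B • τ) = (A 1 0 : ℂ) * ((B • τ : ℍ) : ℂ) + (A 1 1 : ℂ) := rfl
  rw [e, coe_sl_smul]
  field_simp
  simp only [autFactor, Matrix.SpecialLinearGroup.coe_mul, Matrix.mul_apply, Fin.sum_univ_two]
  push_cast
  ring

theorem slashLattice_zero {N : ℕ} (L : EvenLattice N) (m : ℕ) (φ : ℍ → (Fin N → ℂ) → ℂ) :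
    slashLattice L m φ 0 0 = φ := by
  funext τ z
  have h0 : (fun i : Fin N => (((0 : Fin N → ℤ) i : ℤ) : ℂ)) = 0 := by
    funext i
    simp
  simp only [slashLattice, h0]
  simp [bil]

theorem slashLattice_add {N : ℕ} (L : EvenLattice N) (m : ℕ) (φ : ℍ → (Fin N → ℂ) → ℂ)
    (x y x' y' : Fin N → ℤ) :
    slashLattice L m φ (x + x') (y + y') =
      slashLattice L m (slashLattice L m φ x y) x' y' := by
  funext τ z
  have hc : ∀ u v : Fin N → ℤ, (fun i => (((u + v) i : ℤ) : ℂ)) =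
      (fun i => (u i : ℂ)) + fun i => (v i : ℂ) := by
    intro u v
    funext i
    simp
  simp only [slashLattice, hc]
  rw [← mul_assoc, ← Complex.exp_add]
  congr 1
  · rw [Complex.exp_eq_exp_iff_exists_int]
    refine ⟨-(m * bil L.gram x y'), ?_⟩
    have h := bil_intCast (R := ℂ) L.gram x y'
    simp only [bil_add_left, bil_add_right, bil_smul_right]
    rw [bil_comm L.isSymm (fun i => (x' i : ℂ)) (fun i => (x i : ℂ)), h]
    push_cast
    ring
  · congr 1
    rw [smul_add]
    abel

theorem slashSL_one {N : ℕ} (L : EvenLattice N) (k m : ℕ) (φ : ℍ → (Fin N → ℂ) → ℂ) :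
    slashSL L k m φ 1 = φ := by
  funext τ z
  simp [slashSL, autFactor]

theorem slashSL_mul {N : ℕ} (L : EvenLattice N) (k m : ℕ) (φ : ℍ → (Fin N → ℂ) → ℂ)
    (A B : SL(2, ℤ)) :
    slashSL L k m φ (A * B) = slashSL L k m (slashSL L k m φ A) B := by
  funext τ z
  have hB := autFactor_ne_zero B τ
  have hA := autFactor_ne_zero A (B • τ)
  have hdet : (B 0 0 : ℂ) * B 1 1 - B 0 1 * B 1 0 = 1 := by exact_mod_cast sl_det B
  have hAB : ((A * B) 1 0 : ℤ) = A 1 0 * B 0 0 + A 1 1 * B 1 0 := by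
    simp [Matrix.mul_apply, Fin.sum_univ_two]
  have key : ((A * B) 1 0 : ℂ) = A 1 0 / autFactor B τ + B 1 0 * autFactor A (B • τ) := by
    have e : autFactor A (B • τ) = (A 1 0 : ℂ) * ((B • τ : ℍ) : ℂ) + (A 1 1 : ℂ) := rfl
    rw [hAB, e, coe_sl_smul]
    field_simp
    simp only [autFactor]
    push_cast
    linear_combination (A 1 0 : ℂ) * hdet
  simp only [slashSL]
  rw [autFactor_mul, mul_smul A B τ]
  have hz : (autFactor A (B • τ))⁻¹ • (autFactor B τ)⁻¹ • z =
      (autFactor A (B • τ) * autFactor B τ)⁻¹ • z := by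
    rw [smul_smul, mul_inv]
  rw [hz, mul_zpow, bil_smul_left, bil_smul_right, key]
  have hexp : Complex.exp (-(Real.pi * Complex.I * m *
      (((A 1 0 : ℂ) / autFactor B τ + B 1 0 * autFactor A (B • τ)) * bil L.gram z z /
        (autFactor A (B • τ) * autFactor B τ)))) =
      Complex.exp (-(Real.pi * Complex.I * m * ((B 1 0 : ℂ) * bil L.gram z z / autFactor B τ))) *
      Complex.exp (-(Real.pi * Complex.I * m * ((A 1 0 : ℂ) *
        ((autFactor B τ)⁻¹ * ((autFactor B τ)⁻¹ * bil L.gram z z)) / autFactor A (B • τ)))) := by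
    rw [← Complex.exp_add]
    congr 1
    field_simp
    ring
  rw [hexp]
  ring

theorem slashSL_slashLattice {N : ℕ} (L : EvenLattice N) (k m : ℕ) (φ : ℍ → (Fin N → ℂ) → ℂ)
    (A : SL(2, ℤ)) (x y : Fin N → ℤ) :
    slashSL L k m (slashLattice L m φ (A 1 1 • x - A 1 0 • y) (-A 0 1 • x + A 0 0 • y)) A =
      slashLattice L m (slashSL L k m φ A) x y := by
  funext τ z
  have hJ := autFactor_ne_zero A τ
  have hdet : (A 0 0 : ℂ) * A 1 1 - A 0 1 * A 1 0 = 1 := by exact_mod_cast sl_det A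
  have hu : (fun i => (((A 1 1 • x - A 1 0 • y) i : ℤ) : ℂ)) =
      (A 1 1 : ℂ) • (fun i => (x i : ℂ)) + (-(A 1 0 : ℂ)) • fun i => (y i : ℂ) := by
    funext i
    simp
    ring
  have hv : (fun i => (((-A 0 1 • x + A 0 0 • y) i : ℤ) : ℂ)) =
      (-(A 0 1 : ℂ)) • (fun i => (x i : ℂ)) + (A 0 0 : ℂ) • fun i => (y i : ℂ) := by
    funext i
    simp
  obtain ⟨s, hs⟩ := L.even x
  obtain ⟨t, ht⟩ := L.even y
  have hX := bil_intCast (R := ℂ) L.gram x x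
  have hY := bil_intCast (R := ℂ) L.gram y y
  have hP := bil_intCast (R := ℂ) L.gram x y
  rw [hs] at hX
  rw [ht] at hY
  simp only [slashSL, slashLattice, hu, hv, coe_sl_smul]
  have harg : (autFactor A τ)⁻¹ • z +
      (((A 0 0 : ℂ) * (τ : ℂ) + (A 0 1 : ℂ)) / autFactor A τ) •
        ((A 1 1 : ℂ) • (fun i => (x i : ℂ)) + (-(A 1 0 : ℂ)) • fun i => (y i : ℂ)) +
      ((-(A 0 1 : ℂ)) • (fun i => (x i : ℂ)) + (A 0 0 : ℂ) • fun i => (y i : ℂ)) =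
      (autFactor A τ)⁻¹ • (z + (τ : ℂ) • (fun i => (x i : ℂ)) + fun i => (y i : ℂ)) := by
    funext i
    simp only [Pi.add_apply, Pi.smul_apply, smul_eq_mul]
    field_simp
    simp only [autFactor]
    linear_combination ((τ : ℂ) * x i + y i) * hdet
  rw [harg]
  have hexp : Complex.exp (-(Real.pi * Complex.I * m *
        ((A 1 0 : ℂ) * bil L.gram z z / autFactor A τ))) *
      Complex.exp (Real.pi * Complex.I * m *
        (bil L.gram ((A 1 1 : ℂ) • (fun i => (x i : ℂ)) + (-(A 1 0 : ℂ)) • fun i => (y i : ℂ))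
            ((A 1 1 : ℂ) • (fun i => (x i : ℂ)) + (-(A 1 0 : ℂ)) • fun i => (y i : ℂ)) *
          (((A 0 0 : ℂ) * (τ : ℂ) + (A 0 1 : ℂ)) / autFactor A τ) +
        2 * bil L.gram
          ((A 1 1 : ℂ) • (fun i => (x i : ℂ)) + (-(A 1 0 : ℂ)) • fun i => (y i : ℂ))
          ((autFactor A τ)⁻¹ • z))) =
      Complex.exp (Real.pi * Complex.I * m *
        (bil L.gram (fun i => (x i : ℂ)) (fun i => (x i : ℂ)) * (τ : ℂ) +
          2 * bil L.gram (fun i => (x i : ℂ)) z)) *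
      Complex.exp (-(Real.pi * Complex.I * m * ((A 1 0 : ℂ) *
        bil L.gram (z + (τ : ℂ) • (fun i => (x i : ℂ)) + fun i => (y i : ℂ))
          (z + (τ : ℂ) • (fun i => (x i : ℂ)) + fun i => (y i : ℂ)) / autFactor A τ))) := by
    rw [← Complex.exp_add, ← Complex.exp_add, Complex.exp_eq_exp_iff_exists_int]
    refine ⟨m * (A 0 1 * A 1 1 * s - A 0 1 * A 1 0 * bil L.gram x y + A 0 0 * A 1 0 * t), ?_⟩
    simp only [bil_add_left, bil_add_right, bil_smul_left, bil_smul_right]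
    rw [bil_comm L.isSymm (fun i => (y i : ℂ)) (fun i => (x i : ℂ)),
      bil_comm L.isSymm z (fun i => (x i : ℂ)), bil_comm L.isSymm z (fun i => (y i : ℂ)),
      hX, hY, hP]
    generalize bil L.gram (fun i => (x i : ℂ)) z = xz
    generalize bil L.gram (fun i => (y i : ℂ)) z = yz
    generalize bil L.gram z z = zz
    generalize bil L.gram x y = P
    push_cast
    field_simp
    simp only [autFactor]
    linear_combination (m : ℂ) * ((s + s : ℂ) * A 1 1 * τ - 2 * A 1 0 * τ * P - (t + t) * A 1 0) * hdet
  rw [← mul_assoc, mul_assoc (autFactor A τ ^ (-(k : ℤ))), hexp]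
  ring

theorem slash_one {N : ℕ} (L : EvenLattice N) (k m : ℕ) (φ : ℍ → (Fin N → ℂ) → ℂ) :
    slash L k m φ 1 = φ := by
  change slashSL L k m (slashLattice L m φ 0 0) 1 = φ
  rw [slashLattice_zero, slashSL_one]

/-- The slash operation is a right action of the Jacobi group. -/
theorem slash_mul {N : ℕ} (L : EvenLattice N) (k m : ℕ) (φ : ℍ → (Fin N → ℂ) → ℂ)
    (g h : JacobiGroup N) :
    slash L k m φ (g * h) = slash L k m (slash L k m φ g) h := by
  change slashSL L k m (slashLattice L m φ
      (g.left.toAdd.1 + (g.right 1 1 • h.left.toAdd.1 - g.right 1 0 • h.left.toAdd.2))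
      (g.left.toAdd.2 + (-g.right 0 1 • h.left.toAdd.1 + g.right 0 0 • h.left.toAdd.2)))
      (g.right * h.right) = _
  rw [slashLattice_add, slashSL_mul, slashSL_slashLattice]
  rfl

/-! ### Jacobi forms and the Jacobi-Eisenstein series -/

/-- The constant function `1` on `ℍ × (L ⊗ ℂ)`. -/
def oneFun (N : ℕ) : ℍ → (Fin N → ℂ) → ℂ := fun _ _ => 1

/-- The subgroup `Γ_∞^J = {g ∈ Γ^J | 1 |_{k,m} g = 1}`. -/
def stabInfty {N : ℕ} (L : EvenLattice N) (k m : ℕ) : Subgroup (JacobiGroup N) where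
  carrier := {g | slash L k m (oneFun N) g = oneFun N}
  one_mem' := slash_one L k m _
  mul_mem' := by
    intro g h hg hh
    change slash L k m (oneFun N) (g * h) = oneFun N
    rw [slash_mul, hg, hh]
  inv_mem' := by
    intro g hg
    change slash L k m (oneFun N) g⁻¹ = oneFun N
    have h : slash L k m (oneFun N) g = oneFun N := hg
    conv_lhs => rw [← h]
    rw [← slash_mul, mul_inv_cancel, slash_one]

/-- The space `Γ_∞^J \ Γ^J` of right cosets `Γ_∞^J g`. -/
abbrev CosetSpace {N : ℕ} (L : EvenLattice N) (k m : ℕ) : Type :=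
  Quotient (QuotientGroup.rightRel (stabInfty L k m))

/-- The function `1 |_{k,m} g`, which depends only on the coset `Γ_∞^J g`. -/
def eisensteinTerm {N : ℕ} (L : EvenLattice N) (k m : ℕ) (q : CosetSpace L k m) :
    ℍ → (Fin N → ℂ) → ℂ :=
  Quotient.lift (fun g : JacobiGroup N => slash L k m (oneFun N) g) (by
    intro g h hgh
    have hm : h * g⁻¹ ∈ stabInfty L k m := QuotientGroup.rightRel_apply.mp hgh
    have hs : slash L k m (oneFun N) (h * g⁻¹) = oneFun N := hm
    change slash L k m (oneFun N) g = slash L k m (oneFun N) h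
    conv_lhs => rw [← hs]
    rw [← slash_mul, inv_mul_cancel_right]) q

/-- The Jacobi-Eisenstein series
`E_{k,m}(τ, z) = ∑_{g ∈ Γ_∞^J \ Γ^J} (1 |_{k,m} g)(τ, z)`. -/
def jacobiE {N : ℕ} (L : EvenLattice N) (k m : ℕ) (τ : ℍ) (z : Fin N → ℂ) : ℂ :=
  ∑' q : CosetSpace L k m, eisensteinTerm L k m q τ z

/-- The function `exp(2 π i n τ) exp(2 π i (λ, z))`. -/
def fourierMode {N : ℕ} (L : EvenLattice N) (n : ℤ) (lam : Fin N → ℚ) (τ : ℍ)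
    (z : Fin N → ℂ) : ℂ :=
  Complex.exp (2 * Real.pi * Complex.I * n * (τ : ℂ)) *
    Complex.exp (2 * Real.pi * Complex.I * bil L.gram (fun i => (lam i : ℂ)) z)

/-- Holomorphic Jacobi forms of weight `k` and index `m` for the lattice `L`. -/
structure IsJacobiForm {N : ℕ} (L : EvenLattice N) (k m : ℕ) (φ : ℍ → (Fin N → ℂ) → ℂ) :
    Prop where
  holomorphic : DifferentiableOn ℂ
    (fun p : ℂ × (Fin N → ℂ) => φ (UpperHalfPlane.ofComplex p.1) p.2) {p | 0 < p.1.im}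
  invariant : ∀ g : JacobiGroup N, slash L k m φ g = φ
  fourier : ∃ f : ℤ → dualLattice L → ℂ, ∀ (τ : ℍ) (z : Fin N → ℂ),
    HasSum (fun p : {p : ℤ × dualLattice L //
        0 ≤ 2 * (p.1 : ℚ) * m - bil L.gram (p.2 : Fin N → ℚ) (p.2 : Fin N → ℚ)} =>
      f p.1.1 p.1.2 * fourierMode L p.1.1 p.1.2 τ z) (φ τ z)

/-! ### Theta series and the Fourier coefficients -/

/-- The summand `exp(π i ((λ + a, λ + a)_T τ + 2 (λ + a, z + b)_T))` of the theta series. -/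
def thetaTerm {N : ℕ} (T : Matrix (Fin N) (Fin N) ℤ) (a b : Fin N → ℚ) (τ : ℍ) (z : Fin N → ℂ)
    (lam : Fin N → ℤ) : ℂ :=
  Complex.exp (Real.pi * Complex.I *
    (bil T (fun i => (lam i : ℂ) + (a i : ℂ)) (fun i => (lam i : ℂ) + (a i : ℂ)) * (τ : ℂ) +
      2 * bil T (fun i => (lam i : ℂ) + (a i : ℂ)) (fun i => z i + (b i : ℂ))))

/-- The theta series `Θ_{T,a,b}(τ, z)` of characteristic `T, a, b`. -/
def theta {N : ℕ} (T : Matrix (Fin N) (Fin N) ℤ) (a b : Fin N → ℚ) (τ : ℍ) (z : Fin N → ℂ) : ℂ :=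
  ∑' lam : Fin N → ℤ, thetaTerm T a b τ z lam

/-- The hyperbolic norm `Δ(n, λ) = n m - (λ, λ) / 2`. -/
def hypNorm {N : ℕ} (L : EvenLattice N) (m n : ℕ) (lam : Fin N → ℚ) : ℚ :=
  n * m - bil L.gram lam lam / 2

/-- An inverse `a` of `d` modulo `c`. -/
def invMod (c d : ℕ) : ℕ := ((d : ZMod c)⁻¹).val

theorem invMod_spec {c d : ℕ} (h : Nat.Coprime c d) : invMod c d * d ≡ 1 [MOD c] := by
  rcases Nat.eq_zero_or_pos c with rfl | hc
  · have hd : d = 1 := by simpa using h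
    subst hd
    simp [invMod]
  · have : NeZero c := ⟨hc.ne'⟩
    rw [← ZMod.natCast_eq_natCast_iff]
    simp only [invMod, Nat.cast_mul, ZMod.natCast_val, ZMod.cast_id', id_eq, Nat.cast_one]
    rw [mul_comm]
    exact ZMod.coe_mul_inv_eq_one d h.symm

/-- The sum over `x ∈ L` modulo `c` of `exp((π i / c) (m a (x, x) - 2 (λ, x) + 2 n d))`, where
`a d ≡ 1 mod c`. -/
def gaussSum {N : ℕ} (L : EvenLattice N) (m n : ℕ) (lam : Fin N → ℚ) (c : ℕ+) (d : ℕ) : ℂ :=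
  ∑ x : Fin N → Fin c,
    Complex.exp (Real.pi * Complex.I / (c : ℂ) *
      ((m * invMod c d * bil L.gram (fun i => ((x i : ℕ) : ℚ)) (fun i => ((x i : ℕ) : ℚ))
        - 2 * bil L.gram lam (fun i => ((x i : ℕ) : ℚ)) + 2 * n * d : ℚ) : ℂ))

/-- The contribution of `c` to the Dirichlet-type series in `β_{k,m}(n, λ)`: the sum over
`d mod m c` coprime to `c` of `(m c)^{-k}` times the exponential sum above. -/
def betaTerm {N : ℕ} (L : EvenLattice N) (k m n : ℕ) (lam : Fin N → ℚ) (c : ℕ+) : ℂ :=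
  ∑ d ∈ (Finset.range (m * c)).filter (fun d => Nat.Coprime c d),
    ((m : ℂ) * (c : ℂ)) ^ (-(k : ℤ)) * gaussSum L m n lam c d

/-- The sum over `ν` modulo `q(L)` of
`exp(2 π i n m ν) exp(π i ν (λ + L, λ + L)) exp(-π i ν (λ, λ))`. -/
def levelSum {N : ℕ} (L : EvenLattice N) (m n : ℕ) (lam : dualLattice L) : ℂ :=
  ∑ ν ∈ Finset.range (level L),
    Complex.exp (2 * Real.pi * Complex.I * n * m * ν) *
      expPi ν (discForm L (QuotientAddGroup.mk lam)) *
      Complex.exp (-(Real.pi * Complex.I * ν *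
        ((bil L.gram (lam : Fin N → ℚ) (lam : Fin N → ℚ) : ℚ) : ℂ)))

/-- The coefficient `β_{k,m}(n, λ)`, for even `N` and `k > N + 2`. -/
def beta {N : ℕ} (L : EvenLattice N) (k m n : ℕ) (lam : dualLattice L) : ℂ :=
  (-2 * Real.pi * Complex.I / (level L : ℂ)) ^ (k - N / 2) / ((k - N / 2 - 1).factorial : ℂ) *
    (((Real.sqrt (L.gram.det : ℝ))⁻¹ : ℝ) / Complex.I ^ (N / 2)) *
    ((level L : ℂ) * (hypNorm L m n lam : ℂ)) ^ (k - N / 2 - 1) *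
    (∑' c : ℕ+, betaTerm L k m n lam c) *
    levelSum L m n lam

end JacobiEisenstein

end

noncomputable section

namespace JacobiEisenstein

open MeasureTheory Set Filter Topology

/-! ### Sums over `ℤ^N` and series of holomorphic functions -/

/-! The cosets of `Γ_∞^J` are the triples `(c, d, x)` with `c, d` coprime and `x ∈ L`, up to a
common sign. Completing the square in `x` writes `|1 |_{k,m} g|` as `|cτ + d|^{-k}` times a constant
independent of the coset times a Gaussian in `x` of parameter `π m y / |cτ + d|²`, where `y = Im τ`.
Theta inversion bounds the sum of the Gaussian over `x` by a multiple of `|cτ + d|^N`, uniformly in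
its center. What remains is `∑ |cτ + d|^{-(k-N)}`, which converges since `k > N + 2`
(`summable_eisensteinTerm`).

The cosets with `c = 0` sum to the theta series. For `c > 0`, division with remainder `d + cj`, `x +
cl` and the identity `Aτ = a/c - 1/(c(cτ + d))` turn each class modulo `c` into a root of unity
times a sum over translates `(t + j)^{-k} exp(-π i m (w - l, w - l)/(t + j))` with `t = τ + d/c`, `w
= z - x/c` (`eisensteinTerm_bigCellRep`). Poisson summation over `l` is `theta_inversion`: it
replaces `l ∈ L` by `λ ∈ L^∨` and lowers the weight to `k - N/2`. Poisson summation over `j` is the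
Lipschitz formula shifted by `(λ, λ)/(2m)`, which leaves only the pairs with `n > (λ, λ)/(2m)`
(`hasSum_translateTerm`). Evaluating the modes at `t` and `w` produces the exponential sums of
`beta`; they are bounded uniformly in `(n, λ)`, so the sum over `c` can be moved inside
(`hasSum_jacobiE_sub_theta`).

In `beta` every summand of the sum over `ν` equals `1`, so that sum is `q(L)` and all powers of
`q(L)` cancel (`beta_eq`).

Invariance is right translation of the cosets in an absolutely convergent series. The theta terms
have hyperbolic norm `0` and the remaining terms positive norm, which gives the Fourier condition.
Holomorphy follows from the Fourier expansion alone: on a small box every mode is dominated by its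
values at finitely many points, where the expansion already converges absolutely. -/

theorem summable_pi_prod {ι κ : Type*} [Fintype ι] [DecidableEq ι] {f : κ → ℝ}
    (hf : Summable f) (h0 : ∀ j, 0 ≤ f j) : Summable fun n : ι → κ => ∏ i, f (n i) := by
  classical
  refine summable_of_sum_le (c := (∑' j, f j) ^ Fintype.card ι)
    (fun n => Finset.prod_nonneg fun i _ => h0 _) fun s => ?_
  -- A finite set of families lies in a box, over which the sum of products is the product of sums.
  let t : Finset κ := s.biUnion fun n => Finset.univ.image n
  have hst : s ⊆ Fintype.piFinset fun _ : ι => t := by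
    intro n hn
    rw [Fintype.mem_piFinset]
    intro i
    exact Finset.mem_biUnion.mpr ⟨n, hn, Finset.mem_image_of_mem _ (Finset.mem_univ i)⟩
  calc ∑ n ∈ s, ∏ i, f (n i)
      ≤ ∑ n ∈ Fintype.piFinset fun _ : ι => t, ∏ i, f (n i) :=
        Finset.sum_le_sum_of_subset_of_nonneg hst fun n _ _ => Finset.prod_nonneg fun i _ => h0 _
    _ = ∏ _i : ι, ∑ j ∈ t, f j := (Finset.prod_univ_sum (fun _ => t) fun _ j => f j).symm
    _ = (∑ j ∈ t, f j) ^ Fintype.card ι := by simp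
    _ ≤ (∑' j, f j) ^ Fintype.card ι :=
        pow_le_pow_left₀ (Finset.sum_nonneg fun j _ => h0 j) (hf.sum_le_tsum t fun j _ => h0 j) _

theorem summable_exp_neg_mul_int_sq {a : ℝ} (ha : 0 < a) :
    Summable fun n : ℤ => Real.exp (-a * (n : ℝ) ^ 2) := by
  have h : Summable fun n : ℕ => Real.exp (-a * (n : ℝ) ^ 2) := by
    refine (Real.summable_exp_nat_mul_of_ge (c := -a) (neg_lt_zero.mpr ha)
      (f := fun n => (n : ℝ) ^ 2) fun n => ?_).congr fun n => by simp
    exact_mod_cast Nat.le_self_pow two_ne_zero n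
  refine Summable.of_nat_of_neg (by simpa using h) (by simpa using h)

theorem summable_exp_neg_mul_sum_sq {N : ℕ} {a : ℝ} (ha : 0 < a) :
    Summable fun n : Fin N → ℤ => Real.exp (-a * ∑ i, (n i : ℝ) ^ 2) := by
  refine (summable_pi_prod (ι := Fin N) (summable_exp_neg_mul_int_sq ha)
    fun j => (Real.exp_pos _).le).congr fun n => ?_
  rw [← Real.exp_sum, Finset.mul_sum]

/-- Cauchy's estimate on each complex line through `x`, over the disc of radius `r / 2`, whose
closure stays inside the open ball; this accounts for the factor `2`. -/
theorem norm_fderiv_le_of_forall_mem_ball {E F : Type*} [NormedAddCommGroup E] [NormedSpace ℂ E]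
    [NormedAddCommGroup F] [NormedSpace ℂ F] {f : E → F} {x : E} {r C : ℝ} (hr : 0 < r)
    (hf : ∀ y ∈ Metric.ball x r, DifferentiableAt ℂ f y) (hC : ∀ y ∈ Metric.ball x r, ‖f y‖ ≤ C) :
    ‖fderiv ℂ f x‖ ≤ 2 * C / r := by
  have hC0 : 0 ≤ C := (norm_nonneg _).trans (hC x (Metric.mem_ball_self hr))
  refine ContinuousLinearMap.opNorm_le_of_unit_norm (𝕜 := ℂ) (by positivity) fun v hv => ?_
  have hmem : ∀ t : ℂ, ‖t‖ ≤ r / 2 → x + t • v ∈ Metric.ball x r := by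
    intro t ht
    rw [Metric.mem_ball, dist_self_add_left, norm_smul, hv]
    linarith
  have hg : ∀ t : ℂ, ‖t‖ ≤ r / 2 →
      HasDerivAt (fun t : ℂ => f (x + t • v)) (fderiv ℂ f (x + t • v) v) t := by
    intro t ht
    have h1 : HasDerivAt (fun t : ℂ => x + t • v) v t := by
      simpa using ((hasDerivAt_id t).smul_const v).const_add x
    exact (hf _ (hmem t ht)).hasFDerivAt.comp_hasDerivAt t h1
  have h0 := (hg 0 (by simp; positivity)).deriv
  rw [zero_smul, add_zero] at h0
  rw [← h0]
  have hle := Complex.norm_deriv_le_of_forall_mem_sphere_norm_le (c := 0) (R := r / 2) (C := C)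
    (f := fun t : ℂ => f (x + t • v)) (by positivity) ?_ fun t ht => hC _ (hmem t ?_)
  · calc _ ≤ C / (r / 2) := hle
      _ = 2 * C / r := by field_simp
  · refine DifferentiableOn.diffContOnCl fun t ht => ?_
    rw [closure_ball _ (by positivity), mem_closedBall_zero_iff] at ht
    exact (hg t ht).differentiableAt.differentiableWithinAt
  · exact (mem_sphere_zero_iff_norm.mp ht).le

/-- Weierstrass' theorem in several variables: Cauchy's estimate turns a local summable bound for
the functions into one for their derivatives on a ball of half the radius, and termwise
differentiation applies. -/
theorem differentiableOn_tsum_of_summable_bound {ι E F : Type*} [NormedAddCommGroup E]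
    [NormedSpace ℂ E] [NormedAddCommGroup F] [NormedSpace ℂ F] [CompleteSpace F]
    {f : ι → E → F} {U : Set E} (hU : IsOpen U)
    (hf : ∀ i, DifferentiableOn ℂ (f i) U)
    (hb : ∀ x ∈ U, ∃ V ∈ 𝓝 x, ∃ u : ι → ℝ, Summable u ∧ ∀ i, ∀ y ∈ V, ‖f i y‖ ≤ u i) :
    DifferentiableOn ℂ (fun y => ∑' i, f i y) U := by
  intro x hx
  obtain ⟨V, hV, u, hu, hle⟩ := hb x hx
  obtain ⟨r, hr, hsub⟩ := Metric.mem_nhds_iff.mp (Filter.inter_mem hV (hU.mem_nhds hx))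
  have hdiff : ∀ i, ∀ y ∈ Metric.ball x r, DifferentiableAt ℂ (f i) y := fun i y hy =>
    (hf i).differentiableAt (hU.mem_nhds (hsub hy).2)
  have key := hasFDerivAt_tsum_of_isPreconnected (𝕜 := ℂ) (f := f) (f' := fun i y => fderiv ℂ (f i) y)
    (u := fun i => 2 * u i / (r / 2)) (s := Metric.ball x (r / 2)) (x₀ := x) (x := x)
    ((hu.mul_left 2).div_const _) Metric.isOpen_ball
    (by
      let : NormedSpace ℝ E := NormedSpace.restrictScalars ℝ ℂ E
      exact (convex_ball x (r / 2)).isPreconnected)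
    (fun i y hy => (hdiff i y (Metric.ball_subset_ball (by linarith) hy)).hasFDerivAt)
    (fun i y hy => by
      have hs : Metric.ball y (r / 2) ⊆ Metric.ball x r := by
        intro w hw
        rw [Metric.mem_ball] at *
        linarith [dist_triangle w y x]
      exact norm_fderiv_le_of_forall_mem_ball (by positivity) (fun w hw => hdiff i w (hs hw))
        fun w hw => hle i w (hsub (hs hw)).1)
    (Metric.mem_ball_self (by positivity))
    (Summable.of_norm_bounded hu fun i => hle i x (hsub (Metric.mem_ball_self hr)).1)
    (Metric.mem_ball_self (by positivity))
  exact key.differentiableAt.differentiableWithinAt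

/-! ### Poisson summation in several variables -/

section Poisson

variable {N : ℕ}

theorem iUnion_unitCubes :
    ⋃ l : Fin N → ℤ, {x : Fin N → ℝ | ∀ i, x i ∈ Ioc (l i : ℝ) (l i + 1)} = univ := by
  refine eq_univ_of_forall fun x => mem_iUnion.mpr ⟨fun i => ⌈x i⌉ - 1, fun i => ?_⟩
  have h1 := Int.ceil_lt_add_one (x i)
  have h2 := Int.le_ceil (x i)
  push_cast
  exact ⟨by linarith, by linarith⟩

theorem measurableSet_unitCube (l : Fin N → ℤ) :
    MeasurableSet {x : Fin N → ℝ | ∀ i, x i ∈ Ioc (l i : ℝ) (l i + 1)} :=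
  MeasurableSet.univ_pi' fun _ => measurableSet_Ioc

theorem pairwise_disjoint_unitCubes :
    Pairwise (Function.onFun Disjoint
      fun l : Fin N → ℤ => {x : Fin N → ℝ | ∀ i, x i ∈ Ioc (l i : ℝ) (l i + 1)}) := by
  intro l l' hne
  refine disjoint_left.mpr fun x hx hx' => hne (funext fun i => ?_)
  obtain ⟨h1, h2⟩ := hx i
  obtain ⟨h3, h4⟩ := hx' i
  have e1 : l i < l' i + 1 := by exact_mod_cast h1.trans_le h4
  have e2 : l' i < l i + 1 := by exact_mod_cast h3.trans_le h2
  omega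

theorem setIntegral_unitCube_eq {E : Type*} [NormedAddCommGroup E] [NormedSpace ℝ E]
    (φ : (Fin N → ℝ) → E) (l : Fin N → ℤ) :
    ∫ x in {x : Fin N → ℝ | ∀ i, x i ∈ Ioc (l i : ℝ) (l i + 1)}, φ x =
      ∫ x in {x : Fin N → ℝ | ∀ i, x i ∈ Ioc (0 : ℝ) (0 + 1)}, φ (x + fun i => (l i : ℝ)) := by
  have h := (measurePreserving_add_right (volume : Measure (Fin N → ℝ))
    (fun i => (l i : ℝ))).setIntegral_preimage_emb
    (measurableEmbedding_addRight _) φ {x : Fin N → ℝ | ∀ i, x i ∈ Ioc (l i : ℝ) (l i + 1)}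
  rw [← h]
  congr 2
  ext x
  simp only [mem_preimage, mem_ofPred_eq, mem_Ioc, Pi.add_apply]
  refine forall_congr' fun i => ?_
  constructor <;> rintro ⟨h1, h2⟩ <;> constructor <;> linarith

/-- Unfolding of the integral of a periodization. -/
theorem setIntegral_tsum_translates {φ : (Fin N → ℝ) → ℂ} (hφ : Integrable φ) :
    ∫ x in {x : Fin N → ℝ | ∀ i, x i ∈ Ioc (0 : ℝ) (0 + 1)},
      ∑' l : Fin N → ℤ, φ (x + fun i => (l i : ℝ)) = ∫ x, φ x := by
  have h1 := hasSum_integral_iUnion (f := φ) (μ := volume) (measurableSet_unitCube (N := N))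
    pairwise_disjoint_unitCubes hφ.integrableOn
  have h2 := hasSum_integral_iUnion (f := fun x => ‖φ x‖) (μ := volume)
    (measurableSet_unitCube (N := N)) pairwise_disjoint_unitCubes hφ.norm.integrableOn
  rw [iUnion_unitCubes, setIntegral_univ] at h1 h2
  simp only [setIntegral_unitCube_eq] at h1 h2
  have h3 := hasSum_integral_of_summable_integral_norm
    (μ := volume.restrict {x : Fin N → ℝ | ∀ i, x i ∈ Ioc (0 : ℝ) (0 + 1)})
    (F := fun (l : Fin N → ℤ) x => φ (x + fun i => (l i : ℝ)))
    (fun l => (hφ.comp_add_right _).integrableOn) h2.summable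
  exact h3.unique h1

/-- Poisson summation on `ℝ^N` for a continuous integrable function with locally uniformly
summable translates and summable Fourier transform. -/
theorem hasSum_poisson {f : (Fin N → ℝ) → ℂ} (hc : Continuous f) (hi : Integrable f)
    (hb : ∀ R : ℝ, ∃ u : (Fin N → ℤ) → ℝ, Summable u ∧
      ∀ x : Fin N → ℝ, ‖x‖ ≤ R → ∀ l, ‖f (x + fun i => (l i : ℝ))‖ ≤ u l)
    {F : (Fin N → ℤ) → ℂ}
    (hF : ∀ n, F n = ∫ x : Fin N → ℝ,
      Complex.exp (-(2 * Real.pi * Complex.I * ∑ i, (n i : ℂ) * (x i : ℂ))) * f x)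
    (hs : Summable F) :
    HasSum F (∑' l : Fin N → ℤ, f (fun i => (l i : ℝ))) := by
  -- The periodization of `f`. It is continuous and periodic, so it descends to a continuous `G` on
  -- the torus; unfolding identifies the Fourier coefficients of `G` with `F`, and the Fourier
  -- series is evaluated at `0`.
  let P : (Fin N → ℝ) → ℂ := fun x => ∑' l : Fin N → ℤ, f (x + fun i => (l i : ℝ))
  have hPc : Continuous P := by
    refine continuous_iff_continuousAt.mpr fun x => ?_
    obtain ⟨u, hu, hle⟩ := hb (‖x‖ + 1)
    have hon : ContinuousOn P (Metric.ball x 1) := by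
      refine continuousOn_tsum (fun l => ?_) hu fun l y hy => hle y ?_ l
      · exact (hc.comp (continuous_id.add continuous_const)).continuousOn
      · have : ‖y - x‖ < 1 := by rwa [← dist_eq_norm]
        linarith [norm_le_norm_add_norm_sub x y, norm_sub_rev x y]
    exact hon.continuousAt (Metric.ball_mem_nhds x one_pos)
  have hPper : ∀ x (m : Fin N → ℤ), P (x + fun i => (m i : ℝ)) = P x := by
    intro x m
    refine Eq.trans ?_ ((Equiv.addLeft m).tsum_eq fun l => f (x + fun i => (l i : ℝ)))
    refine tsum_congr fun l => congrArg f ?_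
    funext i
    simp [add_assoc]
  let π : C(Fin N → ℝ, UnitAddTorus (Fin N)) :=
    ⟨Pi.map fun _ => ((↑) : ℝ → UnitAddCircle), by
      exact continuous_pi fun i => (AddCircle.continuous_mk' 1).comp (continuous_apply i)⟩
  have hπ : IsOpenQuotientMap π :=
    IsOpenQuotientMap.piMap fun _ => QuotientAddGroup.isOpenQuotientMap_mk
  have hfac : Function.FactorsThrough (⟨P, hPc⟩ : C(Fin N → ℝ, ℂ)) π := by
    intro a b hab
    have h : ∀ i, ∃ m : ℤ, b i = a i + m := by
      intro i
      have hi : ((a i : ℝ) : UnitAddCircle) = (b i : ℝ) := congrFun hab i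
      obtain ⟨m, hm⟩ := AddSubgroup.mem_zmultiples_iff.mp (QuotientAddGroup.eq.mp hi)
      refine ⟨m, ?_⟩
      rw [zsmul_eq_mul, mul_one] at hm
      linarith
    choose m hm using h
    change P a = P b
    rw [← hPper a m]
    exact congrArg P (funext fun i => (hm i).symm)
  let G : C(UnitAddTorus (Fin N), ℂ) := hπ.isQuotientMap.lift ⟨P, hPc⟩ hfac
  have hG : ∀ x : Fin N → ℝ, G (fun i => (x i : UnitAddCircle)) = P x := fun x =>
    congrFun (congrArg DFunLike.coe (hπ.isQuotientMap.lift_comp ⟨P, hPc⟩ hfac)) x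
  have hmF : ∀ (n : Fin N → ℤ) (x : Fin N → ℝ),
      UnitAddTorus.mFourier (-n) (fun i => (x i : UnitAddCircle)) =
        Complex.exp (-(2 * Real.pi * Complex.I * ∑ i, (n i : ℂ) * (x i : ℂ))) := by
    intro n x
    simp only [UnitAddTorus.mFourier, ContinuousMap.coe_mk, fourier_coe_apply]
    rw [← Complex.exp_sum, Finset.mul_sum, ← Finset.sum_neg_distrib]
    congr 1
    refine Finset.sum_congr rfl fun i _ => ?_
    push_cast [Pi.neg_apply]
    ring
  have hcoef : ∀ n, UnitAddTorus.mFourierCoeff G n = F n := by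
    intro n
    have hint : Integrable fun x : Fin N → ℝ =>
        Complex.exp (-(2 * Real.pi * Complex.I * ∑ i, (n i : ℂ) * (x i : ℂ))) * f x := by
      refine hi.bdd_mul (c := 1) (Continuous.aestronglyMeasurable (by fun_prop)) (ae_of_all _ fun x => ?_)
      have : -(2 * Real.pi * Complex.I * ∑ i, (n i : ℂ) * (x i : ℂ)) =
          ((-(2 * Real.pi * ∑ i, (n i : ℝ) * x i) : ℝ) : ℂ) * Complex.I := by
        push_cast
        ring
      rw [this, Complex.norm_exp_ofReal_mul_I]
    rw [UnitAddTorus.mFourierCoeff_eq_integral G n 0, hF, ← setIntegral_tsum_translates hint]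
    refine setIntegral_congr_fun (MeasurableSet.univ_pi' fun _ => measurableSet_Ioc) fun x _ => ?_
    rw [hmF, hG, smul_eq_mul, ← tsum_mul_left]
    refine tsum_congr fun l => ?_
    congr 1
    rw [Complex.exp_eq_exp_iff_exists_int]
    -- The character takes the value `1` on integral translates.
    refine ⟨∑ i, n i * l i, ?_⟩
    simp only [Pi.add_apply, Complex.ofReal_add, mul_add, Finset.sum_add_distrib]
    push_cast
    ring
  have h := UnitAddTorus.hasSum_mFourier_series_apply_of_summable (f := G)
    (by rwa [funext hcoef]) (fun i => (((0 : Fin N → ℝ) i : ℝ) : UnitAddCircle))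
  rw [hG] at h
  convert h using 1
  · funext n
    have h1 := hmF (-n) 0
    rw [neg_neg] at h1
    rw [hcoef, h1]
    simp
  · exact tsum_congr fun l => by rw [zero_add]

end Poisson

/-! ### The Lipschitz formula with a shift -/

section Lipschitz

theorem pow_mul_exp_neg_isBigO (n : ℕ) {a b : ℝ} (hab : b < a) :
    (fun u : ℝ => u ^ n * Real.exp (-a * u)) =O[atTop] fun u => Real.exp (-b * u) := by
  have h := (isLittleO_pow_exp_pos_mul_atTop n (sub_pos.mpr hab)).isBigO.mul
    (Asymptotics.isBigO_refl (fun u : ℝ => Real.exp (-a * u)) atTop)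
  refine h.congr_right fun u => ?_
  rw [← Real.exp_add]
  congr 1
  ring

theorem integrableOn_pow_mul_exp_neg (n : ℕ) {a : ℝ} (ha : 0 < a) :
    IntegrableOn (fun u : ℝ => u ^ n * Real.exp (-a * u)) (Ioi 0) :=
  integrable_of_isBigO_exp_neg (half_pos ha) (by fun_prop)
    (pow_mul_exp_neg_isBigO n (half_lt_self ha))

theorem norm_pow_mul_cexp_neg (n : ℕ) (w : ℂ) {u : ℝ} (hu : 0 ≤ u) :
    ‖(u : ℂ) ^ n * Complex.exp (-w * u)‖ = u ^ n * Real.exp (-w.re * u) := by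
  rw [norm_mul, norm_pow, Complex.norm_real, Real.norm_of_nonneg hu, Complex.norm_exp]
  simp

theorem integrableOn_pow_mul_cexp_neg (n : ℕ) {w : ℂ} (hw : 0 < w.re) :
    IntegrableOn (fun u : ℝ => (u : ℂ) ^ n * Complex.exp (-w * u)) (Ioi 0) := by
  refine (integrableOn_pow_mul_exp_neg n hw).mono'
    (Continuous.aestronglyMeasurable (by fun_prop)) ?_
  filter_upwards [self_mem_ae_restrict measurableSet_Ioi] with u hu
  exact (norm_pow_mul_cexp_neg n w (le_of_lt hu)).le

theorem tendsto_pow_mul_cexp_neg (n : ℕ) {w : ℂ} (hw : 0 < w.re) :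
    Tendsto (fun u : ℝ => (u : ℂ) ^ n * Complex.exp (-w * u)) atTop (𝓝 0) := by
  rw [tendsto_zero_iff_norm_tendsto_zero]
  have h := (pow_mul_exp_neg_isBigO n (half_lt_self hw)).trans_tendsto
    (g'' := fun u : ℝ => Real.exp (-(w.re / 2) * u)) (by
      refine Real.tendsto_exp_atBot.comp ?_
      exact tendsto_id.const_mul_atTop_of_neg (by linarith))
  refine h.congr' ?_
  filter_upwards [eventually_ge_atTop 0] with u hu
  exact (norm_pow_mul_cexp_neg n w hu).symm

/-- Euler's integral for complex `w`, by induction: the derivative of `u^(n+1) exp(-wu)` integrates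
to zero over the half line. -/
theorem integral_pow_mul_cexp_neg_Ioi (n : ℕ) {w : ℂ} (hw : 0 < w.re) :
    ∫ u : ℝ in Ioi 0, (u : ℂ) ^ n * Complex.exp (-w * u) = n.factorial / w ^ (n + 1) := by
  have hw0 : w ≠ 0 := fun h => by simp [h] at hw
  have hexp : ∀ u : ℝ, HasDerivAt (fun u : ℝ => Complex.exp (-w * u))
      (-w * Complex.exp (-w * u)) u := by
    intro u
    have h1 : HasDerivAt (fun u : ℝ => -w * (u : ℂ)) (-w) u := by
      simpa using (Complex.ofRealCLM.hasDerivAt (x := u)).const_mul (-w)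
    simpa [mul_comm] using h1.cexp
  induction n with
  | zero =>
    have h := integral_Ioi_of_hasDerivAt_of_tendsto
      (f := fun u : ℝ => Complex.exp (-w * u)) (f' := fun u : ℝ => -w * Complex.exp (-w * u))
      (a := 0) (m := 0) (by fun_prop) (fun u _ => hexp u)
      (by
        have h0 := (integrableOn_pow_mul_cexp_neg 0 hw).const_mul (-w)
        simp only [pow_zero, one_mul] at h0
        exact h0)
      (by simpa using tendsto_pow_mul_cexp_neg 0 hw)
    rw [integral_const_mul] at h
    simp only [pow_zero, one_mul, Nat.factorial_zero, Nat.cast_one, zero_add, pow_one]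
    field_simp
    simp at h
    linear_combination h
  | succ n ih =>
    have hpow : ∀ u : ℝ, HasDerivAt (fun u : ℝ => (u : ℂ) ^ (n + 1)) ((n + 1) * (u : ℂ) ^ n) u := by
      intro u
      have h := (hasDerivAt_pow (n + 1) (u : ℂ)).comp_ofReal
      simpa using h
    have h := integral_Ioi_of_hasDerivAt_of_tendsto
      (f := fun u : ℝ => (u : ℂ) ^ (n + 1) * Complex.exp (-w * u))
      (f' := fun u : ℝ => (n + 1) * ((u : ℂ) ^ n * Complex.exp (-w * u)) +
        (-w) * ((u : ℂ) ^ (n + 1) * Complex.exp (-w * u)))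
      (a := 0) (m := 0) (by fun_prop)
      (fun u _ => ((hpow u).mul (hexp u)).congr_deriv (by ring))
      (((integrableOn_pow_mul_cexp_neg n hw).const_mul _).add
        ((integrableOn_pow_mul_cexp_neg (n + 1) hw).const_mul _))
      (tendsto_pow_mul_cexp_neg (n + 1) hw)
    rw [integral_add ((integrableOn_pow_mul_cexp_neg n hw).const_mul _)
        ((integrableOn_pow_mul_cexp_neg (n + 1) hw).const_mul _), integral_const_mul,
      integral_const_mul, ih] at h
    simp only [Complex.ofReal_zero, ne_eq, Nat.add_eq_zero_iff, one_ne_zero, and_false,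
      not_false_eq_true, zero_pow, zero_mul, sub_zero] at h
    rw [Nat.factorial_succ, pow_succ w (n + 1)]
    push_cast
    field_simp at h ⊢
    linear_combination -h

/-- The function `u ↦ max(u, 0)^n exp(2 π i u t)`. -/
def lipschitzFun (n : ℕ) (t : ℂ) (u : ℝ) : ℂ :=
  ((max u 0 : ℝ) : ℂ) ^ n * Complex.exp (2 * Real.pi * Complex.I * u * t)

theorem norm_lipschitzFun (n : ℕ) (t : ℂ) (u : ℝ) :
    ‖lipschitzFun n t u‖ = (max u 0) ^ n * Real.exp (-(2 * Real.pi * t.im) * u) := by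
  rw [lipschitzFun, norm_mul, norm_pow, Complex.norm_real,
    Real.norm_of_nonneg (le_max_right _ _), Complex.norm_exp]
  congr 2
  simp
  ring

/-- Since `n ≠ 0`, the function vanishes on the negative half line, and what is left is Euler's
integral at `w = -2πi(t - ξ)`. For `n = 0` the convention `0 ^ 0 = 1` would destroy the cutoff. -/
theorem fourier_lipschitzFun {n : ℕ} (hn : n ≠ 0) {t : ℂ} (ht : 0 < t.im) (ξ : ℝ) :
    FourierTransform.fourier (lipschitzFun n t) ξ =
      n.factorial / (-2 * Real.pi * Complex.I * (t - ξ)) ^ (n + 1) := by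
  have hre : 0 < (-2 * Real.pi * Complex.I * (t - ξ)).re := by
    simp
    positivity
  rw [Real.fourier_real_eq_integral_exp_smul, ← integral_pow_mul_cexp_neg_Ioi n hre,
    ← setIntegral_eq_integral_of_forall_compl_eq_zero (s := Ioi 0)]
  · refine setIntegral_congr_fun measurableSet_Ioi fun u hu => ?_
    simp only [lipschitzFun, max_eq_left (le_of_lt (mem_Ioi.mp hu)), smul_eq_mul]
    rw [mul_left_comm, ← Complex.exp_add]
    congr 2
    push_cast
    ring
  · intro u hu
    rw [lipschitzFun, max_eq_right (not_lt.mp hu)]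
    simp [hn]

/-- The Lipschitz summation formula twisted by a real shift `r`. -/
theorem lipschitz_shift {n : ℕ} (hn : n ≠ 0) {t : ℂ} (ht : 0 < t.im) (r : ℝ) :
    ∑' j : ℤ, (t + j) ^ (-((n + 1 : ℕ) : ℤ)) *
        Complex.exp (2 * Real.pi * Complex.I * r * (t + j)) =
      (-2 * Real.pi * Complex.I) ^ (n + 1) / n.factorial *
        ∑' j : ℤ, (((max (j - r) 0 : ℝ) : ℂ) ^ n * Complex.exp (2 * Real.pi * Complex.I * j * t)) := by
  -- One-dimensional Poisson summation for `lipschitzFun`, evaluated at `-r`: the function is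
  -- continuous, vanishes on the left and decays exponentially on the right, and its transform
  -- decays like the power `n + 1 ≥ 2`.
  have hc : Continuous (lipschitzFun n t) := by
    unfold lipschitzFun
    fun_prop
  have hdec : lipschitzFun n t =O[cocompact ℝ] fun x : ℝ => |x| ^ (-2 : ℝ) := by
    rw [cocompact_eq_atBot_atTop, Asymptotics.isBigO_sup]
    constructor
    · refine Asymptotics.IsBigO.of_bound 1 ?_
      filter_upwards [eventually_le_atBot 0] with u hu
      rw [lipschitzFun, max_eq_right hu]
      simp [hn]
      positivity
    · have h1 := pow_mul_exp_neg_isBigO n (a := 2 * Real.pi * t.im) (b := Real.pi * t.im)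
        (by nlinarith [Real.pi_pos])
      have h2 := (isLittleO_exp_neg_mul_rpow_atTop (a := Real.pi * t.im) (by positivity)
        (-2)).isBigO
      rw [← Asymptotics.isBigO_norm_left]
      refine (h1.trans h2).congr' ?_ ?_
      · filter_upwards [eventually_ge_atTop 0] with u hu
        rw [norm_lipschitzFun, max_eq_left hu]
      · filter_upwards [eventually_ge_atTop 0] with u hu
        rw [abs_of_nonneg hu]
  have hsum : Summable fun j : ℤ => FourierTransform.fourier (lipschitzFun n t) (j : ℝ) := by
    simp_rw [fourier_lipschitzFun hn ht, mul_pow _ (t - _), div_mul_eq_div_div]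
    have h := EisensteinSeries.linear_right_summable t 1 (k := (n + 1 : ℕ)) (by omega)
    have h' := (h.comp_injective neg_injective).mul_left
      ((n.factorial : ℂ) / (-2 * Real.pi * Complex.I) ^ (n + 1))
    refine h'.congr fun j => ?_
    simp only [Function.comp_apply, zpow_natCast, div_eq_mul_inv, sub_eq_add_neg]
    push_cast
    rw [one_mul]
  have hP := Real.tsum_eq_tsum_fourier_of_rpow_decay_of_summable hc (by norm_num : (1 : ℝ) < 2)
    hdec hsum (-r)
  have hL : ∑' j : ℤ, (((max (j - r) 0 : ℝ) : ℂ) ^ n *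
      Complex.exp (2 * Real.pi * Complex.I * j * t)) =
      Complex.exp (2 * Real.pi * Complex.I * r * t) * ∑' j : ℤ, lipschitzFun n t (-r + j) := by
    rw [← tsum_mul_left]
    refine tsum_congr fun j => ?_
    rw [lipschitzFun, mul_left_comm, ← Complex.exp_add]
    congr 2
    · rw [neg_add_eq_sub]
    · push_cast
      ring
  -- The transform involves `t - j`, so the left side is reindexed by `j ↦ -j`.
  rw [hL, hP, ← tsum_mul_left, ← tsum_mul_left, ← (Equiv.neg ℤ).tsum_eq]
  refine tsum_congr fun j => ?_
  have h2 : (-2 * Real.pi * Complex.I : ℂ) ≠ 0 := by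
    simp [Real.pi_ne_zero]
  have h3 : (t - j : ℂ) ≠ 0 := fun h => by
    have := congrArg Complex.im h
    simp at this
    linarith
  have h4 : (n.factorial : ℂ) ≠ 0 := by exact_mod_cast n.factorial_ne_zero
  rw [fourier_lipschitzFun hn ht, fourier_coe_apply, zpow_neg, zpow_natCast]
  have e1 : (t + ((-j : ℤ) : ℂ)) = t - j := by push_cast; ring
  have e2 : Complex.exp (2 * Real.pi * Complex.I * r * (t - j)) =
      Complex.exp (2 * Real.pi * Complex.I * r * t) *
        Complex.exp (2 * Real.pi * Complex.I * j * (-r : ℝ) / (1 : ℝ)) := by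
    rw [← Complex.exp_add]
    congr 1
    push_cast
    ring
  have e3 : (((j : ℝ) : ℂ)) = j := by push_cast; rfl
  rw [Equiv.neg_apply, e1, e2, e3, mul_pow _ (t - j : ℂ)]
  field_simp

/-- A bound for the right side of the Lipschitz formula which is uniform in the shift. -/
theorem exists_lipschitz_bound {n : ℕ} (hn : n ≠ 0) {y : ℝ} (hy : 0 < y) :
    ∃ C : ℝ, ∀ r : ℝ,
      Summable (fun j : ℤ => (max (j - r) 0) ^ n * Real.exp (-(2 * Real.pi * y) * (j - r))) ∧
      ∑' j : ℤ, (max (j - r) 0) ^ n * Real.exp (-(2 * Real.pi * y) * (j - r)) ≤ C := by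
  have ha : 0 < Real.pi * y := by positivity
  have hs : Summable fun i : ℤ =>
      n.factorial / (Real.pi * y) ^ n * Real.exp (-(Real.pi * y) * |(i : ℝ)|) := by
    refine Summable.mul_left _ ?_
    have h : Summable fun i : ℕ => Real.exp (-(Real.pi * y) * |((i : ℤ) : ℝ)|) := by
      refine (Real.summable_exp_nat_mul_of_ge (c := -(Real.pi * y)) (neg_lt_zero.mpr ha)
        (f := fun i => |((i : ℤ) : ℝ)|) fun i => ?_)
      simp
    exact Summable.of_nat_of_neg h (by simpa using h)
  -- Shifting the index by `⌈r⌉` removes the dependence on `r`: as `0 ≤ ⌈r⌉ - r < 1`, the terms with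
  -- `i < 0` vanish, and for `i ≥ 0` the argument is at least `i`.
  have hle : ∀ (r : ℝ) (i : ℤ), (max (((i + ⌈r⌉ : ℤ) : ℝ) - r) 0) ^ n *
      Real.exp (-(2 * Real.pi * y) * (((i + ⌈r⌉ : ℤ) : ℝ) - r)) ≤
      n.factorial / (Real.pi * y) ^ n * Real.exp (-(Real.pi * y) * |(i : ℝ)|) := by
    intro r i
    have h1 := Int.ceil_lt_add_one r
    have h2 := Int.le_ceil r
    rcases lt_or_ge i 0 with hi | hi
    · have hi' : (i : ℝ) ≤ -1 := by exact_mod_cast Int.le_sub_one_of_lt hi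
      rw [max_eq_right (by push_cast; linarith), zero_pow hn, zero_mul]
      positivity
    · have hi' : (0 : ℝ) ≤ i := by exact_mod_cast hi
      have hu : (i : ℝ) ≤ ((i + ⌈r⌉ : ℤ) : ℝ) - r := by push_cast; linarith
      generalize ((i + ⌈r⌉ : ℤ) : ℝ) - r = u at hu
      have hu0 : 0 ≤ u := hi'.trans hu
      -- Half of the exponential decay absorbs the power of `u`.
      have h3 := Real.pow_div_factorial_le_exp (Real.pi * y * u) (by positivity) n
      have h4 : (0 : ℝ) < n.factorial := by exact_mod_cast n.factorial_pos
      rw [max_eq_left hu0, abs_of_nonneg hi']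
      calc u ^ n * Real.exp (-(2 * Real.pi * y) * u)
          = n.factorial / (Real.pi * y) ^ n * ((Real.pi * y * u) ^ n / n.factorial) *
              Real.exp (-(2 * Real.pi * y) * u) := by
            rw [mul_pow (Real.pi * y) u]
            field_simp
        _ ≤ n.factorial / (Real.pi * y) ^ n * Real.exp (Real.pi * y * u) *
              Real.exp (-(2 * Real.pi * y) * u) := by gcongr
        _ = n.factorial / (Real.pi * y) ^ n * Real.exp (-(Real.pi * y) * u) := by
            rw [mul_assoc, ← Real.exp_add]
            congr 2
            ring
        _ ≤ n.factorial / (Real.pi * y) ^ n * Real.exp (-(Real.pi * y) * i) := by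
            gcongr ?_ * Real.exp ?_
            nlinarith
  refine ⟨∑' i : ℤ, n.factorial / (Real.pi * y) ^ n * Real.exp (-(Real.pi * y) * |(i : ℝ)|),
    fun r => ?_⟩
  have h0 : ∀ i : ℤ, 0 ≤ (max (((i + ⌈r⌉ : ℤ) : ℝ) - r) 0) ^ n *
      Real.exp (-(2 * Real.pi * y) * (((i + ⌈r⌉ : ℤ) : ℝ) - r)) := fun i => by positivity
  have hsum := Summable.of_nonneg_of_le h0 (hle r) hs
  refine ⟨(Equiv.addRight ⌈r⌉).summable_iff.mp hsum, ?_⟩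
  rw [← (Equiv.addRight ⌈r⌉).tsum_eq]
  exact hsum.tsum_le_tsum (hle r) hs

end Lipschitz

/-! ### The quadratic form of the lattice -/

theorem summable_exp_neg_sum_sq_add_linear {N : ℕ} {a : ℝ} (ha : 0 < a) (c : Fin N → ℝ) :
    Summable fun n : Fin N → ℤ =>
      Real.exp (-a * ∑ i, (n i : ℝ) ^ 2 + ∑ i, c i * (n i : ℝ)) := by
  refine Summable.of_nonneg_of_le (fun n => (Real.exp_pos _).le) (fun n => ?_)
    ((summable_exp_neg_mul_sum_sq (N := N) (half_pos ha)).mul_left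
      (Real.exp (∑ i, c i ^ 2 / (2 * a))))
  rw [← Real.exp_add, Real.exp_le_exp, Finset.mul_sum, Finset.mul_sum, ← Finset.sum_add_distrib,
    ← Finset.sum_add_distrib]
  refine Finset.sum_le_sum fun i _ => ?_
  -- Completing the square: half of the quadratic term pays for the linear one, at the cost of `c² /
  -- (2a)`.
  have h : 0 ≤ (a * (n i : ℝ) - c i) ^ 2 / (2 * a) := by positivity
  have e : (a * (n i : ℝ) - c i) ^ 2 / (2 * a) =
      a / 2 * (n i : ℝ) ^ 2 - c i * n i + c i ^ 2 / (2 * a) := by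
    field_simp
    ring
  linarith

theorem sum_mulVec_sq_le {m n : Type*} [Fintype m] [Fintype n] (M : Matrix m n ℝ) (x : n → ℝ) :
    ∑ i, (M.mulVec x i) ^ 2 ≤ (∑ i, ∑ j, M i j ^ 2) * ∑ j, x j ^ 2 := by
  rw [Finset.sum_mul]
  exact Finset.sum_le_sum fun i _ => Finset.sum_mul_sq_le_sq_mul_sq _ _ _

theorem bil_map {N : ℕ} {R R' : Type*} [CommRing R] [CommRing R'] (φ : R →+* R')
    (T : Matrix (Fin N) (Fin N) ℤ) (x y : Fin N → R) :
    bil T (fun i => φ (x i)) (fun i => φ (y i)) = φ (bil T x y) := by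
  simp [bil]

theorem bil_ofReal {N : ℕ} (T : Matrix (Fin N) (Fin N) ℤ) (x y : Fin N → ℝ) :
    bil T (fun i => (x i : ℂ)) (fun i => (y i : ℂ)) = ((bil T x y : ℝ) : ℂ) :=
  bil_map Complex.ofRealHom T x y

theorem bil_ratCast {N : ℕ} {R : Type*} [Field R] [CharZero R] (T : Matrix (Fin N) (Fin N) ℤ)
    (x y : Fin N → ℚ) :
    bil T (fun i => (x i : R)) (fun i => (y i : R)) = ((bil T x y : ℚ) : R) :=
  bil_map (Rat.castHom R) T x y

section Lattice

variable {N : ℕ} (L : EvenLattice N)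

-- The positive square root of the Gram matrix is symmetric. It reduces the form to a sum of
-- squares, over `ℝ` and after complexification.
open scoped MatrixOrder in
theorem exists_sqrt_gram : ∃ B : Matrix (Fin N) (Fin N) ℝ,
    B.transpose * B = L.gram.map (Int.cast : ℤ → ℝ) := by
  have h := Matrix.nonneg_iff_posSemidef.mpr L.posDef.posSemidef
  refine ⟨CFC.sqrt (L.gram.map (Int.cast : ℤ → ℝ)), ?_⟩
  have h2 := Matrix.nonneg_iff_posSemidef.mp (CFC.sqrt_nonneg (L.gram.map (Int.cast : ℤ → ℝ)))
  have h3 : (CFC.sqrt (L.gram.map (Int.cast : ℤ → ℝ))).transpose =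
      CFC.sqrt (L.gram.map (Int.cast : ℤ → ℝ)) := by
    simpa [Matrix.IsHermitian, Matrix.conjTranspose_eq_transpose_of_trivial] using h2.isHermitian
  rw [h3]
  exact CFC.sqrt_mul_sqrt_self _ h

variable {L}

theorem bil_eq_sum_sqrt {B : Matrix (Fin N) (Fin N) ℝ}
    (hB : B.transpose * B = L.gram.map (Int.cast : ℤ → ℝ)) {R : Type*} [CommRing R] [Algebra ℝ R]
    (x y : Fin N → R) :
    bil L.gram x y = ∑ k, (B.map (algebraMap ℝ R)).mulVec x k *
      (B.map (algebraMap ℝ R)).mulVec y k := by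
  have h : ∀ i j, (L.gram i j : R) = ∑ k, algebraMap ℝ R (B k i) * algebraMap ℝ R (B k j) := by
    intro i j
    have := congrFun (congrFun hB i) j
    rw [Matrix.mul_apply] at this
    rw [← map_intCast (algebraMap ℝ R) (L.gram i j)]
    change algebraMap ℝ R (L.gram.map (Int.cast : ℤ → ℝ) i j) = _
    rw [← this]
    simp
  simp only [bil, h, Matrix.mulVec, dotProduct, Matrix.map_apply, Finset.sum_mul_sum]
  rw [Finset.sum_comm]
  conv_rhs => rw [Finset.sum_comm]
  conv_lhs => rw [Finset.sum_comm]
  refine Finset.sum_congr rfl fun i _ => ?_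
  conv_rhs => rw [Finset.sum_comm]
  refine Finset.sum_congr rfl fun j _ => ?_
  rw [Finset.mul_sum, Finset.sum_mul]
  exact Finset.sum_congr rfl fun k _ => by ring

theorem det_sqrt_gram_ne_zero {B : Matrix (Fin N) (Fin N) ℝ}
    (hB : B.transpose * B = L.gram.map (Int.cast : ℤ → ℝ)) : B.det ≠ 0 := by
  intro h
  have h1 := L.posDef.det_pos
  rw [← hB, Matrix.det_mul, h, mul_zero] at h1
  exact lt_irrefl _ h1

theorem abs_det_sqrt_gram {B : Matrix (Fin N) (Fin N) ℝ}
    (hB : B.transpose * B = L.gram.map (Int.cast : ℤ → ℝ)) :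
    |B.det| = Real.sqrt (L.gram.det : ℝ) := by
  rw [Int.cast_det, ← Real.sqrt_sq_eq_abs]
  change _ = Real.sqrt (L.gram.map (Int.cast : ℤ → ℝ)).det
  rw [← hB, Matrix.det_mul, Matrix.det_transpose, sq]

variable (L)

/-- From `x = B⁻¹(Bx)` and Cauchy-Schwarz, the Euclidean norm of `x` is controlled by that of `Bx`,
whose square is `(x, x)`. -/
theorem exists_bil_lower_bound :
    ∃ ε : ℝ, 0 < ε ∧ ∀ x : Fin N → ℝ, ε * ∑ i, x i ^ 2 ≤ bil L.gram x x := by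
  obtain ⟨B, hB⟩ := exists_sqrt_gram L
  have hdet := det_sqrt_gram_ne_zero hB
  set M := ∑ i, ∑ j, B⁻¹ i j ^ 2 with hM
  have hM0 : 0 ≤ M := Finset.sum_nonneg fun i _ => Finset.sum_nonneg fun j _ => sq_nonneg _
  -- `M` may vanish when `N = 0`, hence the `+ 1`.
  refine ⟨(M + 1)⁻¹, by positivity, fun x => ?_⟩
  have hx : x = B⁻¹.mulVec (B.mulVec x) := by
    rw [Matrix.mulVec_mulVec, Matrix.nonsing_inv_mul _ hdet.isUnit, Matrix.one_mulVec]
  have h := sum_mulVec_sq_le B⁻¹ (B.mulVec x)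
  rw [← hx] at h
  have hq : bil L.gram x x = ∑ k, B.mulVec x k ^ 2 := by
    rw [bil_eq_sum_sqrt hB]
    exact Finset.sum_congr rfl fun k _ => (sq _).symm
  rw [inv_mul_le_iff₀ (by positivity), hq]
  have h0 : 0 ≤ ∑ k, B.mulVec x k ^ 2 := Finset.sum_nonneg fun k _ => sq_nonneg _
  linarith

theorem bil_self_nonneg (x : Fin N → ℝ) : 0 ≤ bil L.gram x x := by
  obtain ⟨ε, hε, h⟩ := exists_bil_lower_bound L
  exact le_trans (mul_nonneg hε.le (Finset.sum_nonneg fun i _ => sq_nonneg _)) (h x)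

theorem eq_zero_of_bil_self_eq_zero {x : Fin N → ℝ} (hx : bil L.gram x x = 0) : x = 0 := by
  obtain ⟨ε, hε, h⟩ := exists_bil_lower_bound L
  have h1 := h x
  rw [hx] at h1
  have h2 : ∑ i, x i ^ 2 ≤ 0 := by
    by_contra hcon
    exact absurd h1 (not_le.mpr (mul_pos hε (not_le.mp hcon)))
  have h3 := (Finset.sum_eq_zero_iff_of_nonneg fun i _ => sq_nonneg (x i)).mp
    (le_antisymm h2 (Finset.sum_nonneg fun i _ => sq_nonneg _))
  funext i
  exact pow_eq_zero_iff two_ne_zero |>.mp (h3 i (Finset.mem_univ i))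

theorem bil_self_nonneg_rat (x : Fin N → ℚ) : 0 ≤ bil L.gram x x := by
  have h := bil_self_nonneg L fun i => (x i : ℝ)
  rw [bil_ratCast] at h
  exact_mod_cast h

theorem isUnit_det_gram_rat : IsUnit (L.gram.map (Int.cast : ℤ → ℚ)).det := by
  have h1 := L.posDef.det_pos.ne'
  have h2 : (L.gram.map (Int.cast : ℤ → ℝ)).det = ((L.gram.det : ℤ) : ℝ) :=
    (Int.cast_det L.gram).symm
  have h3 : (L.gram.map (Int.cast : ℤ → ℚ)).det = ((L.gram.det : ℤ) : ℚ) :=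
    (Int.cast_det L.gram).symm
  rw [h2] at h1
  rw [h3, isUnit_iff_ne_zero]
  exact_mod_cast h1

/-- The isomorphism `v ↦ S⁻¹ v` of `ℤ^N` with the dual lattice. -/
def dualEquiv : (Fin N → ℤ) ≃ dualLattice L :=
  Equiv.ofBijective
    (fun v => ⟨(L.gram.map (Int.cast : ℤ → ℚ))⁻¹.mulVec (fun i => (v i : ℚ)),
      (mem_dualLattice_iff L _).mpr ⟨v, rfl⟩⟩) (by
    constructor
    · intro v w h
      have h1 := congrArg (L.gram.map (Int.cast : ℤ → ℚ)).mulVec (congrArg Subtype.val h)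
      simp only [Matrix.mulVec_mulVec, Matrix.mul_nonsing_inv _ (isUnit_det_gram_rat L),
        Matrix.one_mulVec] at h1
      funext i
      exact_mod_cast congrFun h1 i
    · rintro ⟨lam, hlam⟩
      obtain ⟨v, hv⟩ := (mem_dualLattice_iff L lam).mp hlam
      exact ⟨v, Subtype.ext hv.symm⟩)

theorem mulVec_dualEquiv (v : Fin N → ℤ) :
    (L.gram.map (Int.cast : ℤ → ℚ)).mulVec (dualEquiv L v : Fin N → ℚ) = fun i => (v i : ℚ) := by
  change (L.gram.map (Int.cast : ℤ → ℚ)).mulVec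
    ((L.gram.map (Int.cast : ℤ → ℚ))⁻¹.mulVec (fun i => (v i : ℚ))) = _
  rw [Matrix.mulVec_mulVec, Matrix.mul_nonsing_inv _ (isUnit_det_gram_rat L), Matrix.one_mulVec]

theorem bil_dualEquiv {R : Type*} [Field R] [CharZero R] (v : Fin N → ℤ) (x : Fin N → R) :
    bil L.gram (fun i => ((dualEquiv L v : Fin N → ℚ) i : R)) x = ∑ i, (v i : R) * x i := by
  rw [bil_comm L.isSymm]
  unfold bil
  refine Finset.sum_congr rfl fun i _ => ?_
  have h := congrArg (Rat.cast : ℚ → R) (congrFun (mulVec_dualEquiv L v) i)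
  simp only [Matrix.mulVec, dotProduct, Matrix.map_apply] at h
  push_cast at h
  rw [← h, Finset.sum_mul]
  exact Finset.sum_congr rfl fun j _ => by ring

/-- For `λ = S⁻¹v` one has `v = Sλ`, so `|v|²` is at most a constant times `|λ|²`, which is at most
a constant times `(λ, λ)`. -/
theorem exists_bil_dual_lower_bound :
    ∃ ε : ℝ, 0 < ε ∧ ∀ v : Fin N → ℤ, ε * ∑ i, (v i : ℝ) ^ 2 ≤
      ((bil L.gram (dualEquiv L v : Fin N → ℚ) (dualEquiv L v : Fin N → ℚ) : ℚ) : ℝ) := by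
  obtain ⟨ε, hε, h⟩ := exists_bil_lower_bound L
  set M := ∑ i, ∑ j, (L.gram.map (Int.cast : ℤ → ℝ)) i j ^ 2 with hM
  have hM0 : 0 ≤ M := Finset.sum_nonneg fun i _ => Finset.sum_nonneg fun j _ => sq_nonneg _
  refine ⟨ε / (M + 1), by positivity, fun v => ?_⟩
  have h1 := h fun i => ((dualEquiv L v : Fin N → ℚ) i : ℝ)
  rw [bil_ratCast] at h1
  refine le_trans ?_ h1
  have h2 := sum_mulVec_sq_le (L.gram.map (Int.cast : ℤ → ℝ))
    fun i => ((dualEquiv L v : Fin N → ℚ) i : ℝ)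
  have h3 : (L.gram.map (Int.cast : ℤ → ℝ)).mulVec
      (fun i => ((dualEquiv L v : Fin N → ℚ) i : ℝ)) = fun i => (v i : ℝ) := by
    funext i
    have h := congrArg (Rat.cast : ℚ → ℝ) (congrFun (mulVec_dualEquiv L v) i)
    simp only [Matrix.mulVec, dotProduct, Matrix.map_apply] at h ⊢
    push_cast at h
    exact h
  rw [h3] at h2
  have h0 : 0 ≤ ∑ i, ((dualEquiv L v : Fin N → ℚ) i : ℝ) ^ 2 :=
    Finset.sum_nonneg fun i _ => sq_nonneg _
  rw [div_mul_eq_mul_div, div_le_iff₀ (by positivity), mul_assoc]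
  refine mul_le_mul_of_nonneg_left ?_ hε.le
  linarith

theorem det_gram_pos : 0 < L.gram.det := by
  have h1 := L.posDef.det_pos
  rw [show (L.gram.map (Int.cast : ℤ → ℝ)).det = ((L.gram.det : ℤ) : ℝ) from
    (Int.cast_det L.gram).symm] at h1
  exact_mod_cast h1

/-- The infimum defining the level is over a nonempty set because `2 det S` belongs to it: for `p =
S⁻¹v` the vector `(det S) p = adj(S) v` is integral, so `det S · (p, p)` is an integer. -/
theorem level_pos : 0 < level L := by
  refine (Nat.sInf_mem (s := {μ : ℕ | 0 < μ ∧ ∀ p ∈ dualLattice L, ∃ j : ℤ,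
    (μ : ℚ) * bil L.gram p p = 2 * j}) ⟨2 * L.gram.det.toNat, ?_, fun p hp => ?_⟩).1
  · have := det_gram_pos L
    omega
  · obtain ⟨v, rfl⟩ := (mem_dualLattice_iff L p).mp hp
    obtain ⟨j, hj⟩ := hp (L.gram.adjugate.mulVec v)
    have hdet : (L.gram.map (Int.cast : ℤ → ℚ)).det = ((L.gram.det : ℤ) : ℚ) :=
      (Int.cast_det L.gram).symm
    have hadj : (fun i => ((L.gram.adjugate.mulVec v i : ℤ) : ℚ)) =
        (L.gram.map (Int.cast : ℤ → ℚ)).det • (L.gram.map (Int.cast : ℤ → ℚ))⁻¹.mulVec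
          (fun i => (v i : ℚ)) := by
      rw [← Matrix.smul_mulVec, Matrix.inv_def, smul_smul,
        Ring.mul_inverse_cancel _ (isUnit_det_gram_rat L), one_smul]
      have h := (Int.castRingHom ℚ).map_adjugate L.gram
      funext i
      have h' : ((L.gram.map (Int.cast : ℤ → ℚ)).adjugate) =
        L.gram.adjugate.map (Int.cast : ℤ → ℚ) := h.symm
      rw [h']
      simp [Matrix.mulVec, dotProduct]
    rw [hadj, bil_smul_right, hdet] at hj
    have hnat : ((L.gram.det.toNat : ℕ) : ℚ) = ((L.gram.det : ℤ) : ℚ) := by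
      exact_mod_cast Int.toNat_of_nonneg (det_gram_pos L).le
    exact ⟨j, by rw [Nat.cast_mul, hnat, ← hj]; push_cast; ring⟩

/-- The first factor is `1` as `n m ν` is an integer, and the other two are inverse to each other.
-/
theorem levelSum_eq_level (m n : ℕ) (lam : dualLattice L) : levelSum L m n lam = level L := by
  have h : ∀ ν ∈ Finset.range (level L),
      Complex.exp (2 * Real.pi * Complex.I * n * m * ν) *
        expPi ν (discForm L (QuotientAddGroup.mk lam)) *
        Complex.exp (-(Real.pi * Complex.I * ν *
          ((bil L.gram (lam : Fin N → ℚ) (lam : Fin N → ℚ) : ℚ) : ℂ))) = 1 := by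
    intro ν _
    have h1 : Complex.exp (2 * Real.pi * Complex.I * n * m * ν) = 1 := by
      rw [Complex.exp_eq_one_iff]
      exact ⟨n * m * ν, by push_cast; ring⟩
    have h2 : expPi ν (discForm L (QuotientAddGroup.mk lam)) =
        Complex.exp (Real.pi * Complex.I * (ν : ℤ) *
          ((bil L.gram (lam : Fin N → ℚ) (lam : Fin N → ℚ) : ℚ) : ℂ)) := rfl
    rw [h1, h2, one_mul, ← Complex.exp_add, Complex.exp_eq_one_iff]
    exact ⟨0, by push_cast; ring⟩
  rw [levelSum, Finset.sum_congr rfl h]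
  simp

end Lattice

/-! ### Theta inversion -/

section ThetaInversion

variable {N : ℕ} (L : EvenLattice N)

theorem bil_add_I_mul (P q : Fin N → ℝ) :
    bil L.gram (fun i => (P i : ℂ) + Complex.I * q i) (fun i => (P i : ℂ) + Complex.I * q i) =
      ((bil L.gram P P - bil L.gram q q : ℝ) : ℂ) + ((2 * bil L.gram P q : ℝ) : ℂ) * Complex.I := by
  have h : (fun i => (P i : ℂ) + Complex.I * q i) =
      (fun i => (P i : ℂ)) + Complex.I • (fun i => (q i : ℂ)) := rfl
  rw [h, bil_add_left, bil_add_right, bil_add_right, bil_smul_left, bil_smul_left, bil_smul_right,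
    bil_smul_right, bil_comm L.isSymm (fun i => (q i : ℂ)) (fun i => (P i : ℂ)), bil_ofReal,
    bil_ofReal, bil_ofReal]
  push_cast
  linear_combination ((bil L.gram q q : ℝ) : ℂ) * Complex.I_mul_I

/-- Completion of the square in `Re (b (z + y, z + y))` for real `y`. -/
theorem re_mul_bil_add {b : ℂ} (hb : b.re ≠ 0) (z : Fin N → ℂ) (y : Fin N → ℝ) :
    (b * bil L.gram (fun i => z i + (y i : ℂ)) (fun i => z i + (y i : ℂ))).re =
      b.re * bil L.gram (fun i => y i + ((z i).re - b.im / b.re * (z i).im))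
        (fun i => y i + ((z i).re - b.im / b.re * (z i).im)) -
      (b.re + b.im ^ 2 / b.re) * bil L.gram (fun i => (z i).im) (fun i => (z i).im) := by
  set P : Fin N → ℝ := fun i => y i + (z i).re with hP
  set q : Fin N → ℝ := fun i => (z i).im with hq
  have h1 : (fun i => z i + (y i : ℂ)) = fun i => (P i : ℂ) + Complex.I * q i := by
    funext i
    apply Complex.ext <;> simp [hP, hq, add_comm]
  have h2 : (fun i => y i + ((z i).re - b.im / b.re * (z i).im)) = P + (-(b.im / b.re)) • q := by
    funext i
    simp only [hP, hq, Pi.add_apply, Pi.smul_apply, smul_eq_mul]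
    ring
  rw [h1, h2, bil_add_I_mul]
  simp only [bil_add_left, bil_add_right, bil_smul_left, bil_smul_right, bil_comm L.isSymm q P]
  simp
  field_simp
  ring

theorem norm_cexp_neg_mul_bil_add {b : ℂ} (hb : b.re ≠ 0) (z : Fin N → ℂ) (y : Fin N → ℝ) :
    ‖Complex.exp (-b * bil L.gram (fun i => z i + (y i : ℂ)) (fun i => z i + (y i : ℂ)))‖ =
      Real.exp ((b.re + b.im ^ 2 / b.re) * bil L.gram (fun i => (z i).im) (fun i => (z i).im)) *
      Real.exp (-b.re * bil L.gram (fun i => y i + ((z i).re - b.im / b.re * (z i).im))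
        (fun i => y i + ((z i).re - b.im / b.re * (z i).im))) := by
  rw [Complex.norm_exp, neg_mul, Complex.neg_re, re_mul_bil_add L hb, ← Real.exp_add]
  congr 1
  ring

theorem exists_gaussian_translate_bound {b : ℂ} (hb : 0 < b.re) (z : Fin N → ℂ) (R : ℝ) :
    ∃ u : (Fin N → ℤ) → ℝ, Summable u ∧ ∀ x : Fin N → ℝ, ‖x‖ ≤ R → ∀ l : Fin N → ℤ,
      ‖Complex.exp (-b * bil L.gram (fun i => z i + ((x i + l i : ℝ) : ℂ))
        (fun i => z i + ((x i + l i : ℝ) : ℂ)))‖ ≤ u l := by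
  obtain ⟨ε, hε, hle⟩ := exists_bil_lower_bound L
  set s : Fin N → ℝ := fun i => (z i).re - b.im / b.re * (z i).im with hs
  have hle' : ∀ x : Fin N → ℝ, ‖x‖ ≤ R → ∀ l : Fin N → ℤ,
      -b.re * bil L.gram (fun i => x i + l i + s i) (fun i => x i + l i + s i) ≤
      b.re * ε * ∑ i, (R + |s i|) ^ 2 + -(b.re * ε / 2) * ∑ i, (l i : ℝ) ^ 2 := by
    intro x hx l
    have h1 := hle fun i => x i + l i + s i
    -- From `(a + l)² = l²/2 - a² + (l + 2a)²/2`, a bound from below that is uniform for `a` in a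
    -- bounded set.
    have h2 : 1 / 2 * ∑ i, (l i : ℝ) ^ 2 - ∑ i, (R + |s i|) ^ 2 ≤
        ∑ i, (x i + l i + s i) ^ 2 := by
      rw [Finset.mul_sum, ← Finset.sum_sub_distrib]
      refine Finset.sum_le_sum fun i _ => ?_
      have hxi : |x i| ≤ R := (norm_le_pi_norm x i).trans hx
      have h3 : (x i + s i) ^ 2 ≤ (R + |s i|) ^ 2 := by
        rw [← sq_abs (x i + s i)]
        exact pow_le_pow_left₀ (abs_nonneg _) ((abs_add_le _ _).trans (by linarith)) 2
      have h4 : 0 ≤ ((l i : ℝ) + 2 * (x i + s i)) ^ 2 := sq_nonneg _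
      have h5 : (x i + l i + s i) ^ 2 = 1 / 2 * (l i : ℝ) ^ 2 - (x i + s i) ^ 2 +
          1 / 2 * ((l i : ℝ) + 2 * (x i + s i)) ^ 2 := by ring
      rw [h5]
      linarith
    have h4 := mul_le_mul_of_nonneg_left (h1.trans' (mul_le_mul_of_nonneg_left h2 hε.le)) hb.le
    linarith
  refine ⟨fun l => Real.exp ((b.re + b.im ^ 2 / b.re) *
      bil L.gram (fun i => (z i).im) (fun i => (z i).im)) *
      Real.exp (b.re * ε * ∑ i, (R + |s i|) ^ 2 + -(b.re * ε / 2) * ∑ i, (l i : ℝ) ^ 2),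
    ?_, fun x hx l => ?_⟩
  · simp_rw [Real.exp_add]
    exact ((summable_exp_neg_mul_sum_sq (by positivity)).mul_left _).mul_left _
  · rw [norm_cexp_neg_mul_bil_add L hb.ne' z fun i => x i + l i]
    exact mul_le_mul_of_nonneg_left (Real.exp_le_exp.mpr (hle' x hx l)) (Real.exp_pos _).le

/-- The Fourier transform of the Gaussian attached to the lattice. -/
theorem integral_gaussian_lattice (hN : Even N) {b : ℂ} (hb : 0 < b.re) (z : Fin N → ℂ)
    (v : Fin N → ℤ) :
    Integrable (fun x : Fin N → ℝ => Complex.exp (-b * bil L.gram (fun i => z i + (x i : ℂ))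
      (fun i => z i + (x i : ℂ)))) ∧
    ∫ x : Fin N → ℝ, Complex.exp (-(2 * Real.pi * Complex.I * ∑ i, (v i : ℂ) * (x i : ℂ))) *
      Complex.exp (-b * bil L.gram (fun i => z i + (x i : ℂ)) (fun i => z i + (x i : ℂ))) =
    (Real.pi / b) ^ (N / 2) * ((Real.sqrt (L.gram.det : ℝ))⁻¹ : ℝ) *
      Complex.exp (-(Real.pi ^ 2 / b) *
        ((bil L.gram (dualEquiv L v : Fin N → ℚ) (dualEquiv L v : Fin N → ℚ) : ℚ) : ℂ)) *
      Complex.exp (2 * Real.pi * Complex.I * ∑ i, (v i : ℂ) * z i) := by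
  obtain ⟨B, hB⟩ := exists_sqrt_gram L
  have hdet := det_sqrt_gram_ne_zero hB
  have hb0 : b ≠ 0 := fun h => by simp [h] at hb
  set BC : Matrix (Fin N) (Fin N) ℂ := B.map (algebraMap ℝ ℂ) with hBC
  set w : Fin N → ℂ := BC.mulVec z with hw
  set lam : Fin N → ℂ := fun i => ((dualEquiv L v : Fin N → ℚ) i : ℂ) with hlam
  set μ : Fin N → ℂ := BC.mulVec lam with hμ
  have hBx : ∀ (x : Fin N → ℝ) k, BC.mulVec (fun i => (x i : ℂ)) k = (B.mulVec x k : ℝ) := by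
    intro x k
    simp [hBC, Matrix.mulVec, dotProduct]
  have hform : ∀ x y : Fin N → ℂ, bil L.gram x y = ∑ k, BC.mulVec x k * BC.mulVec y k :=
    fun x y => bil_eq_sum_sqrt hB x y
  have hmap := Real.map_matrix_volume_pi_eq_smul_volume_pi hdet
  have hmeas : Measurable (Matrix.toLin' B) := (Matrix.toLin' B).continuous_of_finiteDimensional.measurable
  -- The change of variables `y = Bx`, with Jacobian `|det B| = √(det S)`.
  have hcv : ∀ g : (Fin N → ℝ) → ℂ, Continuous g → Integrable g →
      Integrable (fun x => g (B.mulVec x)) ∧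
      ∫ x, g (B.mulVec x) = ((|B.det|)⁻¹ : ℝ) * ∫ y, g y := by
    intro g hg hgi
    have h1 : Integrable g (Measure.map (Matrix.toLin' B) volume) := by
      rw [hmap]
      exact hgi.smul_measure ENNReal.ofReal_ne_top
    refine ⟨(integrable_map_measure hg.aestronglyMeasurable hmeas.aemeasurable).mp h1, ?_⟩
    have h2 := integral_map (μ := volume) hmeas.aemeasurable
      (f := g) hg.aestronglyMeasurable
    rw [hmap, integral_smul_measure, ENNReal.toReal_ofReal (abs_nonneg _), abs_inv] at h2
    rw [Complex.real_smul] at h2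
    exact h2.symm
  have hgauss : ∀ c : Fin N → ℂ, Continuous fun y : Fin N → ℝ =>
      Complex.exp (-b * ∑ i, (y i : ℂ) ^ 2 + ∑ i, c i * y i) := fun c => by fun_prop
  -- In the variable `Bx` the integrand is a standard Gaussian with a linear term. The choice `c =
  -- 0` gives integrability, `c = -2πi μ` the Fourier transform.
  have hexp : ∀ (x : Fin N → ℝ) (c : Fin N → ℂ),
      Complex.exp (∑ k, c k * (B.mulVec x k : ℂ)) *
      Complex.exp (-b * bil L.gram (fun i => z i + (x i : ℂ)) (fun i => z i + (x i : ℂ))) =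
      Complex.exp (-b * ∑ k, w k ^ 2) * Complex.exp (-b * ∑ k, ((B.mulVec x k : ℝ) : ℂ) ^ 2 +
        ∑ k, (-2 * b * w k + c k) * (B.mulVec x k : ℝ)) := by
    intro x c
    rw [← Complex.exp_add, ← Complex.exp_add]
    congr 1
    have h1 : (fun i => z i + (x i : ℂ)) = z + fun i => (x i : ℂ) := rfl
    rw [h1, hform]
    simp only [Matrix.mulVec_add, Pi.add_apply, hBx, ← hw, Finset.mul_sum,
      ← Finset.sum_add_distrib]
    exact Finset.sum_congr rfl fun k _ => by ring
  constructor
  · have h := (hcv _ (hgauss fun k => -2 * b * w k)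
      (GaussianFourier.integrable_cexp_neg_mul_sum_add hb _)).1.const_mul
        (Complex.exp (-b * ∑ k, w k ^ 2))
    refine h.congr (ae_of_all _ fun x => ?_)
    have := hexp x 0
    simpa using this.symm
  · have hlin : ∀ x : Fin N → ℝ, -(2 * Real.pi * Complex.I * ∑ i, (v i : ℂ) * (x i : ℂ)) =
        ∑ k, (-2 * Real.pi * Complex.I * μ k) * (B.mulVec x k : ℂ) := by
      intro x
      rw [← bil_dualEquiv L v (fun i => (x i : ℂ)), hform, Finset.mul_sum,
        ← Finset.sum_neg_distrib]
      refine Finset.sum_congr rfl fun k _ => ?_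
      rw [hBx]
      ring
    simp_rw [hlin, hexp]
    rw [integral_const_mul, (hcv _ (hgauss fun k => -2 * b * w k + -2 * Real.pi * Complex.I * μ k)
      (GaussianFourier.integrable_cexp_neg_mul_sum_add hb _)).2,
      GaussianFourier.integral_cexp_neg_mul_sum_add hb, abs_det_sqrt_gram hB, Fintype.card_fin]
    -- For even rank the complex power `N / 2` is an ordinary power, so no branch has to be chosen.
    have hpow : (Real.pi / b : ℂ) ^ ((N : ℂ) / 2) = (Real.pi / b) ^ (N / 2) := by
      obtain ⟨M, rfl⟩ := hN
      rw [show (M + M) / 2 = M by omega, ← Complex.cpow_natCast]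
      congr 1
      push_cast
      ring
    have hq : ((bil L.gram (dualEquiv L v : Fin N → ℚ) (dualEquiv L v : Fin N → ℚ) : ℚ) : ℂ) =
        ∑ k, μ k * μ k := by
      rw [← bil_ratCast, hform]
    have hz : ∑ i, (v i : ℂ) * z i = ∑ k, μ k * w k := by
      rw [← bil_dualEquiv L v z, hform]
    rw [hpow, hq, hz]
    have : Complex.exp (-b * ∑ k, w k ^ 2) * Complex.exp
        ((∑ k, (-2 * b * w k + -2 * Real.pi * Complex.I * μ k) ^ 2) / (4 * b)) =
        Complex.exp (-(Real.pi ^ 2 / b) * ∑ k, μ k * μ k) *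
          Complex.exp (2 * Real.pi * Complex.I * ∑ k, μ k * w k) := by
      rw [← Complex.exp_add, ← Complex.exp_add]
      congr 1
      simp only [Finset.mul_sum, Finset.sum_div, ← Finset.sum_add_distrib]
      refine Finset.sum_congr rfl fun k _ => ?_
      field_simp
      linear_combination (Real.pi ^ 2 * μ k ^ 2 * 4 : ℂ) * Complex.I_sq
    linear_combination ((Real.pi / b : ℂ) ^ (N / 2) * ((Real.sqrt (L.gram.det : ℝ))⁻¹ : ℝ)) * this

theorem summable_dual_gaussian {a : ℝ} (ha : 0 < a) (z : Fin N → ℂ) :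
    Summable fun v : Fin N → ℤ =>
      Real.exp (-a * ((bil L.gram (dualEquiv L v : Fin N → ℚ) (dualEquiv L v : Fin N → ℚ) : ℚ) : ℝ)) *
      ‖Complex.exp (2 * Real.pi * Complex.I * ∑ i, (v i : ℂ) * z i)‖ := by
  obtain ⟨ε, hε, hle⟩ := exists_bil_dual_lower_bound L
  refine Summable.of_nonneg_of_le (fun v => by positivity) (fun v => ?_)
    (summable_exp_neg_sum_sq_add_linear (a := a * ε) (by positivity)
      fun i : Fin N => -(2 * Real.pi * (z i).im))
  rw [Complex.norm_exp, ← Real.exp_add, Real.exp_le_exp]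
  have h1 : (2 * Real.pi * Complex.I * ∑ i, (v i : ℂ) * z i).re =
      ∑ i, -(2 * Real.pi * (z i).im) * (v i : ℝ) := by
    rw [Finset.mul_sum, Complex.re_sum]
    refine Finset.sum_congr rfl fun i _ => ?_
    simp
    ring
  rw [h1]
  have := mul_le_mul_of_nonneg_left (hle v) ha.le
  linarith

/-- The inversion formula for the theta series of the lattice. -/
theorem theta_inversion (hN : Even N) {b : ℂ} (hb : 0 < b.re) (z : Fin N → ℂ) :
    HasSum (fun v : Fin N → ℤ => (Real.pi / b) ^ (N / 2) * ((Real.sqrt (L.gram.det : ℝ))⁻¹ : ℝ) *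
      Complex.exp (-(Real.pi ^ 2 / b) *
        ((bil L.gram (dualEquiv L v : Fin N → ℚ) (dualEquiv L v : Fin N → ℚ) : ℚ) : ℂ)) *
      Complex.exp (2 * Real.pi * Complex.I * ∑ i, (v i : ℂ) * z i))
      (∑' l : Fin N → ℤ, Complex.exp (-b * bil L.gram (fun i => z i + (l i : ℂ))
        (fun i => z i + (l i : ℂ)))) := by
  have hb2 : 0 < (Real.pi ^ 2 / b : ℂ).re := by
    have h1 : (Real.pi ^ 2 / b : ℂ).re = Real.pi ^ 2 * b.re / Complex.normSq b := by
      rw [← Complex.ofReal_pow, Complex.div_re, Complex.ofReal_re, Complex.ofReal_im, zero_mul,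
        zero_div, add_zero]
    rw [h1]
    have h2 : b ≠ 0 := fun h => by simp [h] at hb
    have := Complex.normSq_pos.mpr h2
    positivity
  have h := hasSum_poisson (N := N)
    (f := fun x => Complex.exp (-b * bil L.gram (fun i => z i + (x i : ℂ))
      (fun i => z i + (x i : ℂ)))) (by unfold bil; fun_prop)
    (integral_gaussian_lattice L hN hb z 0).1 (exists_gaussian_translate_bound L hb z)
    (F := fun v => (Real.pi / b) ^ (N / 2) * ((Real.sqrt (L.gram.det : ℝ))⁻¹ : ℝ) *
      Complex.exp (-(Real.pi ^ 2 / b) *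
        ((bil L.gram (dualEquiv L v : Fin N → ℚ) (dualEquiv L v : Fin N → ℚ) : ℚ) : ℂ)) *
      Complex.exp (2 * Real.pi * Complex.I * ∑ i, (v i : ℂ) * z i))
    (fun v => (integral_gaussian_lattice L hN hb z v).2.symm) ?_
  · simpa using h
  · refine Summable.of_norm ?_
    simp_rw [mul_assoc ((Real.pi / b : ℂ) ^ (N / 2) * _), norm_mul _ (_ * _), norm_mul (Complex.exp _)]
    refine ((summable_dual_gaussian L hb2 z).mul_left
      ‖(Real.pi / b : ℂ) ^ (N / 2) * ((Real.sqrt (L.gram.det : ℝ))⁻¹ : ℝ)‖).congr fun v => ?_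
    congr 2
    rw [Complex.norm_exp, ← Complex.ofReal_ratCast, Complex.re_mul_ofReal, Complex.neg_re]

end ThetaInversion

/-! ### Fourier expansion of the sum over translates -/

section Translates

variable {N : ℕ} (L : EvenLattice N)

/-- The real number `(λ, λ)` for `λ = S⁻¹ v`. -/
def dualNorm (v : Fin N → ℤ) : ℝ :=
  ((bil L.gram (dualEquiv L v : Fin N → ℚ) (dualEquiv L v : Fin N → ℚ) : ℚ) : ℝ)

theorem dualNorm_nonneg (v : Fin N → ℤ) : 0 ≤ dualNorm L v := by
  exact Rat.cast_nonneg.mpr (bil_self_nonneg_rat L _)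

/-- The character `w ↦ exp(2 π i v ⬝ w)`. -/
def dualChar (v : Fin N → ℤ) (w : Fin N → ℂ) : ℂ :=
  Complex.exp (2 * Real.pi * Complex.I * ∑ i, (v i : ℂ) * w i)

theorem dualChar_eq (v : Fin N → ℤ) (w : Fin N → ℂ) :
    dualChar v w = Complex.exp (2 * Real.pi * Complex.I *
      bil L.gram (fun i => ((dualEquiv L v : Fin N → ℚ) i : ℂ)) w) := by
  rw [bil_dualEquiv]
  rfl

/-- The summand `(t + j)^{-k} exp(-π i m (w - l, w - l) / (t + j))`. -/
def translateTerm (k m : ℕ) (t : ℂ) (w : Fin N → ℂ) (p : ℤ × (Fin N → ℤ)) : ℂ :=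
  (t + p.1) ^ (-(k : ℤ)) * Complex.exp (-(Real.pi * Complex.I * m *
    (bil L.gram (fun i => w i - p.2 i) (fun i => w i - p.2 i) / (t + p.1))))

/-- The pairs `(n, λ)` with `n ≥ 1` and `n m > (λ, λ) / 2`. -/
abbrev PositivePairs (m : ℕ) : Type :=
  {p : ℕ × dualLattice L // 1 ≤ p.1 ∧
    bil L.gram (p.2 : Fin N → ℚ) (p.2 : Fin N → ℚ) / 2 < p.1 * m}

/-- The Fourier coefficient of the sum over translates. -/
def translateCoeff (k m n : ℕ) (lam : Fin N → ℚ) : ℂ :=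
  (-2 * Real.pi * Complex.I) ^ (k - N / 2) / ((k - N / 2 - 1).factorial : ℂ) *
    (((Real.sqrt (L.gram.det : ℝ))⁻¹ : ℝ) / Complex.I ^ (N / 2)) * ((m : ℂ) ^ (k - 1))⁻¹ *
    (hypNorm L m n lam : ℂ) ^ (k - N / 2 - 1)

variable {L}

theorem add_intCast_ne_zero {t : ℂ} (ht : 0 < t.im) (j : ℤ) : t + j ≠ 0 := fun h => by
  have := congrArg Complex.im h
  simp at this
  linarith

/-- Theta inversion with `b = π i m / (t + j)`, whose real part is positive since `t` lies in the
upper half plane. The factor `(π/b)^(N/2)` is a power of `(t + j)/(im)`, which lowers the weight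
from `k` to `k - N/2`. -/
theorem tsum_translateTerm_snd (hN : Even N) {k m : ℕ} (hm : 0 < m) (hk : N / 2 ≤ k) {t : ℂ}
    (ht : 0 < t.im) (w : Fin N → ℂ) (j : ℤ) :
    ∑' l : Fin N → ℤ, translateTerm L k m t w (j, l) =
      ((Real.sqrt (L.gram.det : ℝ))⁻¹ : ℝ) / (Complex.I * m) ^ (N / 2) *
      ∑' v : Fin N → ℤ, (t + j) ^ (-((k - N / 2 : ℕ) : ℤ)) *
        Complex.exp (2 * Real.pi * Complex.I * ((dualNorm L v / (2 * m) : ℝ) : ℂ) * (t + j)) *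
        dualChar v w := by
  have h0 := add_intCast_ne_zero ht j
  have hm0 : (m : ℂ) ≠ 0 := by exact_mod_cast hm.ne'
  set b : ℂ := Real.pi * Complex.I * m / (t + j) with hb
  have hb0 : 0 < b.re := by
    have h1 : b.re = Real.pi * m * t.im / Complex.normSq (t + j) := by
      rw [hb, Complex.div_re]
      simp
    have := Complex.normSq_pos.mpr h0
    rw [h1]
    positivity
  have h := (theta_inversion L hN hb0 w).tsum_eq
  have h1 : ∑' l : Fin N → ℤ, translateTerm L k m t w (j, l) = (t + j) ^ (-(k : ℤ)) *
      ∑' l : Fin N → ℤ, Complex.exp (-b * bil L.gram (fun i => w i + (l i : ℂ))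
        (fun i => w i + (l i : ℂ))) := by
    rw [← tsum_mul_left, ← (Equiv.neg (Fin N → ℤ)).tsum_eq]
    refine tsum_congr fun l => ?_
    simp only [translateTerm, Equiv.neg_apply, Pi.neg_apply, Int.cast_neg, sub_neg_eq_add]
    congr 2
    rw [hb]
    ring
  have hpib : (Real.pi / b : ℂ) = (t + j) / (Complex.I * m) := by
    have : (Real.pi : ℂ) ≠ 0 := by exact_mod_cast Real.pi_ne_zero
    rw [hb]
    field_simp
  rw [h1, ← h, ← tsum_mul_left, ← tsum_mul_left]
  refine tsum_congr fun v => ?_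
  have hpow : (t + j : ℂ) ^ (-(k : ℤ)) * (t + j) ^ (N / 2) =
      (t + j) ^ (-((k - N / 2 : ℕ) : ℤ)) := by
    rw [← zpow_natCast (t + j : ℂ) (N / 2), ← zpow_add₀ h0]
    congr 1
    omega
  have hexp : -(Real.pi ^ 2 / b) *
      ((bil L.gram (dualEquiv L v : Fin N → ℚ) (dualEquiv L v : Fin N → ℚ) : ℚ) : ℂ) =
      2 * Real.pi * Complex.I * ((dualNorm L v / (2 * m) : ℝ) : ℂ) * (t + j) := by
    have e : (Real.pi ^ 2 / b : ℂ) = Real.pi * (Real.pi / b) := by ring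
    rw [e, hpib, dualNorm]
    push_cast
    field_simp
    rw [Complex.I_sq]
    ring
  rw [hpib, hexp, div_pow, ← hpow]
  simp only [dualChar]
  ring

theorem norm_cexp_two_pi_I_mul (r : ℝ) (t : ℂ) :
    ‖Complex.exp (2 * Real.pi * Complex.I * r * t)‖ = Real.exp (-(2 * Real.pi * t.im) * r) := by
  rw [Complex.norm_exp]
  congr 1
  simp
  ring

theorem summable_dualChar_mul_exp {a : ℝ} (ha : 0 < a) (w : Fin N → ℂ) :
    Summable fun v : Fin N → ℤ => Real.exp (-a * dualNorm L v) * ‖dualChar v w‖ :=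
  summable_dual_gaussian L ha w

/-- After theta inversion the two sums are interchanged, and the Lipschitz formula with shift `(λ,
λ)/(2m)` is applied for each `λ`. -/
theorem tsum_tsum_translateTerm (hN : Even N) {k m : ℕ} (hm : 0 < m) (hk : N / 2 + 2 ≤ k) {t : ℂ}
    (ht : 0 < t.im) (w : Fin N → ℂ) :
    ∑' (j : ℤ) (l : Fin N → ℤ), translateTerm L k m t w (j, l) =
      ((Real.sqrt (L.gram.det : ℝ))⁻¹ : ℝ) / (Complex.I * m) ^ (N / 2) *
      ((-2 * Real.pi * Complex.I) ^ (k - N / 2) / (k - N / 2 - 1).factorial) *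
      ∑' (v : Fin N → ℤ) (n : ℤ), dualChar v w *
        (((max (n - dualNorm L v / (2 * m)) 0 : ℝ) : ℂ) ^ (k - N / 2 - 1) *
          Complex.exp (2 * Real.pi * Complex.I * n * t)) := by
  obtain ⟨n, hn⟩ : ∃ n, k - N / 2 = n + 1 := ⟨k - N / 2 - 1, by omega⟩
  have hn0 : n ≠ 0 := by omega
  have hm0 : (0 : ℝ) < m := by exact_mod_cast hm
  simp_rw [tsum_translateTerm_snd (L := L) hN hm (by omega : N / 2 ≤ k) ht w]
  rw [tsum_mul_left]
  refine Eq.trans ?_ (mul_assoc _ _ _).symm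
  congr 1
  rw [hn, Nat.add_sub_cancel]
  -- The modulus of `exp(2πi r(t + j))` does not depend on `j`, so the majorant is a product of two
  -- convergent series; the one in `j` has exponent `n + 1 ≥ 2`.
  have hsum : Summable (Function.uncurry fun (j : ℤ) (v : Fin N → ℤ) =>
      (t + j) ^ (-((n + 1 : ℕ) : ℤ)) *
        Complex.exp (2 * Real.pi * Complex.I * ((dualNorm L v / (2 * m) : ℝ) : ℂ) * (t + j)) *
        dualChar v w) := by
    have h1 := (EisensteinSeries.linear_right_summable t 1 (k := (n + 1 : ℕ)) (by omega)).norm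
    have h2 := summable_dualChar_mul_exp (L := L) (a := 2 * Real.pi * t.im / (2 * m))
      (by positivity) w
    refine Summable.of_norm ((h1.mul_of_nonneg h2 (fun j => norm_nonneg _)
      fun v => by positivity).congr fun p => ?_)
    simp only [Function.uncurry]
    rw [norm_mul, norm_mul, norm_cexp_two_pi_I_mul]
    refine Eq.trans ?_ (mul_assoc _ _ _).symm
    congr 1
    · rw [zpow_neg]
      simp
    · congr 2
      simp
      ring
  rw [← hsum.tsum_comm, ← tsum_mul_left]
  refine tsum_congr fun v => ?_
  rw [tsum_mul_right, lipschitz_shift hn0 ht, tsum_mul_left]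
  ring

/-- Splitting `exp(-2π n Im t)` at the shift `r = (λ, λ)/(2m)` gives a Gaussian in `λ` times a
series in `n` bounded uniformly in `r`. -/
theorem summable_dualChar_mul_lipschitz {m n : ℕ} (hm : 0 < m) (hn : n ≠ 0) {t : ℂ}
    (ht : 0 < t.im) (w : Fin N → ℂ) :
    Summable fun p : (Fin N → ℤ) × ℤ => dualChar p.1 w *
        (((max (p.2 - dualNorm L p.1 / (2 * m)) 0 : ℝ) : ℂ) ^ n *
          Complex.exp (2 * Real.pi * Complex.I * p.2 * t)) := by
  have hm0 : (0 : ℝ) < m := by exact_mod_cast hm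
  obtain ⟨C, hC⟩ := exists_lipschitz_bound hn ht
  have h2 := summable_dualChar_mul_exp (L := L) (a := 2 * Real.pi * t.im / (2 * m))
      (by positivity) w
  have hnorm : ∀ (v : Fin N → ℤ) (j : ℤ), ‖dualChar v w *
        (((max (j - dualNorm L v / (2 * m)) 0 : ℝ) : ℂ) ^ n *
          Complex.exp (2 * Real.pi * Complex.I * j * t))‖ =
      (Real.exp (-(2 * Real.pi * t.im / (2 * m)) * dualNorm L v) * ‖dualChar v w‖) *
      ((max (j - dualNorm L v / (2 * m)) 0) ^ n *
        Real.exp (-(2 * Real.pi * t.im) * (j - dualNorm L v / (2 * m)))) := by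
    intro v j
    have e : (j : ℂ) = ((j : ℝ) : ℂ) := by push_cast; rfl
    rw [norm_mul, norm_mul, norm_pow, Complex.norm_real, Real.norm_of_nonneg (le_max_right _ _),
      e, norm_cexp_two_pi_I_mul]
    have : Real.exp (-(2 * Real.pi * t.im) * j) =
        Real.exp (-(2 * Real.pi * t.im / (2 * m)) * dualNorm L v) *
          Real.exp (-(2 * Real.pi * t.im) * (j - dualNorm L v / (2 * m))) := by
      rw [← Real.exp_add]
      congr 1
      ring
    rw [this]
    ring
  refine Summable.of_norm ?_
  rw [summable_prod_of_nonneg fun p => norm_nonneg _]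
  simp only [hnorm]
  refine ⟨fun v => ((hC _).1.mul_left _), ?_⟩
  simp only [tsum_mul_left]
  refine Summable.of_nonneg_of_le (fun v => ?_) (fun v => ?_) (h2.mul_right C)
  · exact mul_nonneg (by positivity) (tsum_nonneg fun j => by positivity)
  · exact mul_le_mul_of_nonneg_left (hC _).2 (by positivity)

/-- Fourier expansion of the sum over translates by `ℤ × ℤ^N`. -/
theorem hasSum_translateTerm (hN : Even N) {k m : ℕ} (hm : 0 < m) (hk : N / 2 + 2 ≤ k) {t : ℂ}
    (ht : 0 < t.im) (w : Fin N → ℂ) :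
    HasSum (fun p : PositivePairs L m => translateCoeff L k m p.1.1 p.1.2 *
        (Complex.exp (2 * Real.pi * Complex.I * p.1.1 * t) *
          Complex.exp (2 * Real.pi * Complex.I * bil L.gram
            (fun i => ((p.1.2 : Fin N → ℚ) i : ℂ)) w)))
      (∑' (j : ℤ) (l : Fin N → ℤ), translateTerm L k m t w (j, l)) := by
  have hm0 : (0 : ℝ) < m := by exact_mod_cast hm
  have hmC : (m : ℂ) ≠ 0 := by exact_mod_cast hm.ne'
  have hn : k - N / 2 - 1 ≠ 0 := by omega
  have hsum := summable_dualChar_mul_lipschitz (L := L) hm hn ht w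
  rw [tsum_tsum_translateTerm hN hm hk ht w, ← hsum.tsum_prod]
  have hinj : Function.Injective fun p : PositivePairs L m =>
      ((dualEquiv L).symm p.1.2, (p.1.1 : ℤ)) := by
    rintro ⟨⟨n, lam⟩, hp⟩ ⟨⟨n', lam'⟩, hp'⟩ h
    simp only [Prod.mk.injEq, EmbeddingLike.apply_eq_iff_eq, Nat.cast_inj] at h
    obtain ⟨rfl, rfl⟩ := h
    rfl
  have h := (hinj.hasSum_iff (fun q hq => ?_)).mpr hsum.hasSum
  · refine (h.mul_left _).congr_fun fun p => ?_
    obtain ⟨⟨n, lam⟩, hp1, hp2⟩ := p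
    obtain ⟨v, rfl⟩ := (dualEquiv L).surjective lam
    simp only [Function.comp_apply, Equiv.symm_apply_apply]
    -- The shifted index is `Δ(n, λ)/m`; its power of `m` combines with the `m^(N/2)` of theta
    -- inversion to `m^(k-1)`.
    have hΔ : (n : ℝ) - dualNorm L v / (2 * m) =
        (hypNorm L m n (dualEquiv L v : Fin N → ℚ) : ℝ) / m := by
      rw [hypNorm, dualNorm]
      push_cast
      field_simp
    have hΔ0 : 0 ≤ (n : ℝ) - dualNorm L v / (2 * m) := by
      rw [hΔ]
      have : 0 ≤ hypNorm L m n (dualEquiv L v : Fin N → ℚ) := sub_nonneg.mpr hp2.le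
      have : (0 : ℝ) ≤ hypNorm L m n (dualEquiv L v : Fin N → ℚ) := by exact_mod_cast this
      positivity
    rw [← dualChar_eq, translateCoeff, Int.cast_natCast, max_eq_left hΔ0, hΔ, mul_pow Complex.I (m : ℂ)]
    have hpow : (m : ℂ) ^ (k - 1) = m ^ (N / 2) * m ^ (k - N / 2 - 1) := by
      rw [← pow_add]
      congr 1
      omega
    rw [hpow]
    push_cast
    rw [div_pow]
    field_simp
  -- Outside the positive pairs the truncated power vanishes: a nonzero term has `j > (λ, λ)/(2m) ≥
  -- 0`.
  · obtain ⟨v, j⟩ := q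
    by_contra hne
    have hpos : 0 < (j : ℝ) - dualNorm L v / (2 * m) := by
      by_contra hcon
      rw [max_eq_right (not_lt.mp hcon)] at hne
      simp [hn] at hne
    have hr : 0 ≤ dualNorm L v / (2 * m) := div_nonneg (dualNorm_nonneg L v) (by positivity)
    have hj : 0 < j := by
      have : (0 : ℝ) < j := by linarith
      exact_mod_cast this
    refine hq ⟨⟨(j.toNat, dualEquiv L v), by omega, ?_⟩, ?_⟩
    · have h1 : ((j.toNat : ℕ) : ℝ) = j := by exact_mod_cast Int.toNat_of_nonneg hj.le
      have h2 : dualNorm L v / 2 < (j.toNat : ℝ) * m := by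
        rw [h1]
        have h3 : dualNorm L v / 2 = dualNorm L v / (2 * m) * m := by field_simp
        rw [h3]
        exact mul_lt_mul_of_pos_right (by linarith) hm0
      rw [dualNorm] at h2
      exact_mod_cast h2
    · simp [Int.toNat_of_nonneg hj.le]

end Translates

/-! ### Cosets and absolute convergence of the Eisenstein series -/

section Cosets

variable {N : ℕ} (L : EvenLattice N)

theorem slash_oneFun_apply (k m : ℕ) (g : JacobiGroup N) (τ : ℍ) (z : Fin N → ℂ) :
    slash L k m (oneFun N) g τ z = autFactor g.right τ ^ (-(k : ℤ)) *
      Complex.exp (Real.pi * Complex.I * m *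
        (((bil L.gram g.left.toAdd.1 g.left.toAdd.1 : ℤ) : ℂ) * ((g.right • τ : ℍ) : ℂ) +
          2 * ((autFactor g.right τ)⁻¹ * bil L.gram (fun i => (g.left.toAdd.1 i : ℂ)) z) -
          (g.right 1 0 : ℂ) * bil L.gram z z / autFactor g.right τ)) := by
  simp only [slash, slashSL, slashLattice, oneFun, mul_one]
  rw [mul_assoc, ← Complex.exp_add, bil_intCast, bil_smul_right]
  congr 2
  ring

/-- Completing the square in `x`: the exponent is a form in `x + Im(z/J)/Im(Aτ)`, where `J = cτ +
d`, with coefficient `π m Im(Aτ) = π m Im τ/|J|²`. The remainder depends on `τ` and `z` only, which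
is what makes the sum over cosets manageable. -/
theorem norm_slash_oneFun (k m : ℕ) (g : JacobiGroup N) (τ : ℍ) (z : Fin N → ℂ) :
    ‖slash L k m (oneFun N) g τ z‖ = (‖autFactor g.right τ‖ ^ k)⁻¹ *
      (Real.exp (Real.pi * m / τ.im * bil L.gram (fun i => (z i).im) (fun i => (z i).im)) *
      Real.exp (-(Real.pi * m * τ.im / ‖autFactor g.right τ‖ ^ 2) *
        bil L.gram (fun i => ((autFactor g.right τ).re * (z i).im -
            (autFactor g.right τ).im * (z i).re) / τ.im + (g.left.toAdd.1 i : ℝ))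
          (fun i => ((autFactor g.right τ).re * (z i).im -
            (autFactor g.right τ).im * (z i).re) / τ.im + (g.left.toAdd.1 i : ℝ)))) := by
  have hJ := autFactor_ne_zero g.right τ
  have hy := τ.im_pos
  rw [slash_oneFun_apply, norm_mul, zpow_neg, zpow_natCast, norm_inv, norm_pow, ← Real.exp_add,
    Complex.norm_exp]
  congr 2
  set J := autFactor g.right τ with hJdef
  set P : Fin N → ℝ := fun i => (z i).re with hP
  set q : Fin N → ℝ := fun i => (z i).im with hq
  set x : Fin N → ℝ := fun i => (g.left.toAdd.1 i : ℝ) with hx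
  have hz : z = fun i => (P i : ℂ) + Complex.I * q i := by
    funext i
    apply Complex.ext <;> simp [hP, hq]
  have hzz : bil L.gram z z = ((bil L.gram P P - bil L.gram q q : ℝ) : ℂ) +
      ((2 * bil L.gram P q : ℝ) : ℂ) * Complex.I := by
    rw [hz, bil_add_I_mul]
  have hxz : bil L.gram (fun i => (g.left.toAdd.1 i : ℂ)) z =
      ((bil L.gram x P : ℝ) : ℂ) + ((bil L.gram x q : ℝ) : ℂ) * Complex.I := by
    have h1 : (fun i => (P i : ℂ) + Complex.I * q i) =
      (fun i => (P i : ℂ)) + Complex.I • (fun i => (q i : ℂ)) := rfl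
    have h2 : (fun i => (g.left.toAdd.1 i : ℂ)) = fun i => (x i : ℂ) := by
      funext i
      simp [hx]
    rw [hz, h1, h2, bil_add_right, bil_smul_right, bil_ofReal, bil_ofReal, mul_comm Complex.I]
  have hxx : ((bil L.gram g.left.toAdd.1 g.left.toAdd.1 : ℤ) : ℂ) = ((bil L.gram x x : ℝ) : ℂ) := by
    rw [hx, bil_intCast]
    push_cast
    rfl
  have him : ((g.right • τ : ℍ) : ℂ).im = τ.im / Complex.normSq J := by
    have h := ModularGroup.im_smul_eq_div_normSq g.right τ
    rw [ModularGroup.denom_apply] at h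
    exact h
  have hu : (fun i => (J.re * (z i).im - J.im * (z i).re) / τ.im + (g.left.toAdd.1 i : ℝ)) =
      (J.re / τ.im) • q + (-(J.im / τ.im)) • P + x := by
    funext i
    simp only [hP, hq, hx, Pi.add_apply, Pi.smul_apply, smul_eq_mul]
    ring
  have hJim : J.im = g.right 1 0 * τ.im := by
    simp [hJdef, autFactor]
  have hn : Complex.normSq J ≠ 0 := (Complex.normSq_pos.mpr hJ).ne'
  have hn' : Complex.normSq J = J.re ^ 2 + J.im ^ 2 := by
    rw [Complex.normSq_apply]
    ring
  rw [hu, hzz, hxz, hxx, Complex.sq_norm]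
  simp only [bil_add_left, bil_add_right, bil_smul_left, bil_smul_right, bil_comm L.isSymm q P,
    bil_comm L.isSymm q x, bil_comm L.isSymm P x]
  generalize bil L.gram P P = PP
  generalize bil L.gram P q = Pq
  generalize bil L.gram q q = qq
  generalize bil L.gram x x = xx
  generalize bil L.gram x P = xP
  generalize bil L.gram x q = xq
  have hw : ∀ w : ℂ, (Real.pi * Complex.I * m * w).re = -(Real.pi * m * w.im) := by
    intro w
    simp
  have hw2 : ((xx : ℂ) * ((g.right • τ : ℍ) : ℂ) +
      2 * (J⁻¹ * ((xP : ℂ) + (xq : ℂ) * Complex.I)) -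
      (g.right 1 0 : ℂ) * (((PP - qq : ℝ) : ℂ) + ((2 * Pq : ℝ) : ℂ) * Complex.I) / J).im =
      xx * (τ.im / Complex.normSq J) + 2 * ((xq * J.re - xP * J.im) / Complex.normSq J) -
        g.right 1 0 * ((2 * Pq * J.re - (PP - qq) * J.im) / Complex.normSq J) := by
    rw [Complex.sub_im, Complex.add_im, Complex.im_ofReal_mul, him, div_eq_mul_inv _ J]
    simp
    ring
  rw [hw, hw2]
  have hτ : τ.im ≠ 0 := hy.ne'
  field_simp
  rw [hn', hJim]
  ring

variable {L}

theorem mem_stabInfty_iff {k m : ℕ} (hm : 0 < m) (hk : Even k) (hk0 : k ≠ 0) (g : JacobiGroup N) :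
    g ∈ stabInfty L k m ↔ g.right 1 0 = 0 ∧ g.left.toAdd.1 = 0 := by
  have hdet := sl_det g.right
  constructor
  · intro hg
    have hg' : slash L k m (oneFun N) g = oneFun N := hg
    -- At `τ = 2i`, `z = 0` the condition reads `|J|^k = exp(-(positive) (x, x)) ≤ 1` with `|J|² =
    -- 4c² + d²`, which forces `c = 0`. The point `i` would not exclude `c = ±1`, `d = 0` at this
    -- stage.
    let τ : ℍ := ⟨2 * Complex.I, by simp⟩
    have hτ : τ.im = 2 := by
      change (2 * Complex.I).im = 2
      simp
    have h1 := norm_slash_oneFun L k m g τ 0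
    rw [hg'] at h1
    have hJ : ‖autFactor g.right τ‖ ^ 2 = 4 * (g.right 1 0 : ℝ) ^ 2 + (g.right 1 1 : ℝ) ^ 2 := by
      rw [Complex.sq_norm, Complex.normSq_apply, autFactor]
      change (_ * (2 * Complex.I) + _ : ℂ).re * (_ * (2 * Complex.I) + _ : ℂ).re +
        (_ * (2 * Complex.I) + _ : ℂ).im * (_ * (2 * Complex.I) + _ : ℂ).im = _
      simp
      ring
    have hz : (fun i : Fin N => ((0 : Fin N → ℂ) i).im) = 0 := rfl
    simp only [oneFun, norm_one, Pi.zero_apply, Complex.zero_im, Complex.zero_re, mul_zero, sub_zero,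
      zero_div, zero_add] at h1
    have hb0 : bil L.gram (fun _ : Fin N => (0 : ℝ)) (fun _ => 0) = 0 := by simp [bil]
    have hx := bil_self_nonneg L fun i => (g.left.toAdd.1 i : ℝ)
    set Q := bil L.gram (fun i => (g.left.toAdd.1 i : ℝ)) (fun i => (g.left.toAdd.1 i : ℝ)) with hQ
    rw [hb0, mul_zero, Real.exp_zero, one_mul] at h1
    set n := ‖autFactor g.right τ‖ with hn
    have hn0 : 0 < n := norm_pos_iff.mpr (autFactor_ne_zero _ _)
    have hpi := Real.pi_pos
    have hm0 : (0 : ℝ) < m := by exact_mod_cast hm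
    have he : Real.exp (-(Real.pi * m * τ.im / n ^ 2) * Q) ≤ 1 := by
      rw [Real.exp_le_one_iff, hτ]
      have : 0 ≤ Real.pi * m * 2 / n ^ 2 * Q := by positivity
      linarith
    have hnk : n ^ k = Real.exp (-(Real.pi * m * τ.im / n ^ 2) * Q) := by
      exact (inv_mul_eq_one₀ (by positivity)).mp h1.symm
    have hn1 : n ≤ 1 := by
      by_contra hcon
      have := one_lt_pow₀ (not_le.mp hcon) hk0
      linarith
    have hc : g.right 1 0 = 0 := by
      by_contra hcon
      have h2 : (1 : ℝ) ≤ (g.right 1 0 : ℝ) ^ 2 := by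
        have : 1 ≤ (g.right 1 0) ^ 2 := Int.one_le_abs hcon |> fun h => by nlinarith [sq_abs (g.right 1 0), abs_nonneg (g.right 1 0)]
        exact_mod_cast this
      nlinarith [sq_nonneg (g.right 1 1 : ℝ)]
    refine ⟨hc, ?_⟩
    rw [hc, mul_zero, sub_zero] at hdet
    have hd : (g.right 1 1 : ℝ) ^ 2 = 1 := by
      have h3 : IsUnit (g.right 1 1) := IsUnit.of_mul_eq_one_right _ hdet
      rcases Int.isUnit_iff.mp h3 with h | h <;> rw [h] <;> norm_num
    rw [hc, hd] at hJ
    have hn2 : n = 1 := by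
      have h5 : n ^ 2 = 1 := by rw [hJ]; norm_num
      nlinarith
    -- Now `|J| = 1`, so the exponential equals `1` and definiteness gives `x = 0`.
    rw [hn2, one_pow, eq_comm, Real.exp_eq_one_iff, hτ] at hnk
    have hQ0 : Q = 0 := by
      have : Real.pi * m * 2 / 1 ^ 2 ≠ 0 := by positivity
      exact (mul_eq_zero.mp hnk).resolve_left (neg_ne_zero.mpr this)
    have hz := eq_zero_of_bil_self_eq_zero L hQ0
    funext i
    have hi := congrFun hz i
    simp only [Pi.zero_apply, Int.cast_eq_zero] at hi
    exact hi
  · rintro ⟨hc, hx⟩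
    change slash L k m (oneFun N) g = oneFun N
    rw [hc, mul_zero, sub_zero] at hdet
    have h3 : IsUnit (g.right 1 1) := IsUnit.of_mul_eq_one_right _ hdet
    funext τ z
    rw [slash_oneFun_apply, hx, hc]
    have hJ : autFactor g.right τ = (g.right 1 1 : ℂ) := by
      rw [autFactor, hc]
      simp
    have h1 : ((g.right 1 1 : ℤ) : ℂ) ^ (-(k : ℤ)) = 1 := by
      rw [zpow_neg, zpow_natCast, inv_eq_one]
      rcases Int.isUnit_iff.mp h3 with h | h <;> rw [h]
      · simp
      · simpa using hk.neg_one_pow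
    rw [hJ, h1]
    simp [bil, oneFun]

theorem sl_mul_inv_apply (A B : SL(2, ℤ)) :
    (A * B⁻¹) 1 0 = A 1 0 * B 1 1 - A 1 1 * B 1 0 := by
  rw [Matrix.SpecialLinearGroup.coe_mul, Matrix.mul_apply, Fin.sum_univ_two,
    Matrix.SpecialLinearGroup.coe_inv, Matrix.adjugate_fin_two]
  simp
  ring

/-- Two elements of the Jacobi group lie in the same coset if and only if their data
`(c, d, x)` agree up to a common sign. -/
theorem coset_eq_iff {k m : ℕ} (hm : 0 < m) (hk : Even k) (hk0 : k ≠ 0) (g h : JacobiGroup N) :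
    (Quotient.mk (QuotientGroup.rightRel (stabInfty L k m)) g = Quotient.mk _ h) ↔
      ∃ s : ℤ, (s = 1 ∨ s = -1) ∧ h.right 1 0 = s * g.right 1 0 ∧ h.right 1 1 = s * g.right 1 1 ∧
        h.left.toAdd.1 = s • g.left.toAdd.1 := by
  rw [Quotient.eq, QuotientGroup.rightRel_apply, mem_stabInfty_iff hm hk hk0]
  have hg := sl_det g.right
  have hh := sl_det h.right
  have e1 : (h * g⁻¹).right 1 0 = h.right 1 0 * g.right 1 1 - h.right 1 1 * g.right 1 0 :=
    sl_mul_inv_apply h.right g.right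
  have e2 : (h * g⁻¹).left.toAdd.1 = h.left.toAdd.1 -
      ((h.right 1 1 * g.right 0 0 - h.right 1 0 * g.right 0 1) • g.left.toAdd.1 -
        (h.right 1 0 * g.right 1 1 - h.right 1 1 * g.right 1 0) • g.left.toAdd.2) := by
    funext i
    simp [slAction, Matrix.SpecialLinearGroup.SL2_inv_expl]
    ring
  rw [e1, e2]
  constructor
  · rintro ⟨h1, h2⟩
    rw [h1, zero_smul, sub_zero, sub_eq_zero] at h2
    have hc : h.right 1 0 = (h.right 1 1 * g.right 0 0 - h.right 1 0 * g.right 0 1) *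
        g.right 1 0 := by
      linear_combination -(h.right 1 0) * hg + (g.right 0 0) * h1
    have hd : h.right 1 1 = (h.right 1 1 * g.right 0 0 - h.right 1 0 * g.right 0 1) *
        g.right 1 1 := by
      linear_combination -(h.right 1 1) * hg + (g.right 0 1) * h1
    -- The sign is the lower right entry of `h g⁻¹`. That matrix is upper triangular of determinant
    -- `1`, so its upper left entry is the inverse.
    refine ⟨_, Int.isUnit_iff.mp ?_, hc, hd, h2⟩
    refine IsUnit.of_mul_eq_one (h.right 0 0 * g.right 1 1 - h.right 0 1 * g.right 1 0) ?_
    linear_combination hh - (h.right 0 0) * hd + (h.right 0 1) * hc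
  · rintro ⟨s, hs, h1, h2, h3⟩
    have hC : h.right 1 0 * g.right 1 1 - h.right 1 1 * g.right 1 0 = 0 := by
      rw [h1, h2]
      ring
    have hD : h.right 1 1 * g.right 0 0 - h.right 1 0 * g.right 0 1 = s := by
      rw [h1, h2]
      linear_combination s * hg
    rw [hC, hD, h3]
    simp

end Cosets

/-! ### Absolute convergence of the Eisenstein series -/

section Convergence

variable {N : ℕ} (L : EvenLattice N)

theorem cexp_ofReal_gaussian (a : ℝ) (u : Fin N → ℝ) (l : Fin N → ℤ) :
    Complex.exp (-(a : ℂ) * bil L.gram (fun i => (u i : ℂ) + (l i : ℂ))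
      (fun i => (u i : ℂ) + (l i : ℂ))) =
    ((Real.exp (-a * bil L.gram (fun i => u i + (l i : ℝ)) (fun i => u i + (l i : ℝ))) : ℝ) : ℂ) := by
  have h : (fun i => (u i : ℂ) + (l i : ℂ)) = fun i => ((u i + (l i : ℝ) : ℝ) : ℂ) := by
    funext i
    push_cast
    rfl
  rw [h, bil_ofReal]
  push_cast
  rfl

/-- Theta inversion produces the factor `a^(-N/2)` and a dual series. The real shift `u` enters the
latter only through characters of modulus `1`, and `a ≤ A` bounds its Gaussian by the one for `A`;
hence uniformity in both `a` and `u`. -/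
theorem exists_gaussian_sum_bound (hN : Even N) {A : ℝ} (hA : 0 < A) :
    ∃ C : ℝ, 0 ≤ C ∧ ∀ a : ℝ, 0 < a → a ≤ A → ∀ u : Fin N → ℝ,
      Summable (fun l : Fin N → ℤ =>
        Real.exp (-a * bil L.gram (fun i => u i + (l i : ℝ)) (fun i => u i + (l i : ℝ)))) ∧
      ∑' l : Fin N → ℤ,
        Real.exp (-a * bil L.gram (fun i => u i + (l i : ℝ)) (fun i => u i + (l i : ℝ))) ≤
        C * a⁻¹ ^ (N / 2) := by
  have hpi := Real.pi_pos
  have hsum : Summable fun v : Fin N → ℤ => Real.exp (-(Real.pi ^ 2 / A) * dualNorm L v) := by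
    simpa [dualChar] using summable_dualChar_mul_exp (L := L) (a := Real.pi ^ 2 / A)
      (by positivity) 0
  refine ⟨Real.pi ^ (N / 2) * (Real.sqrt (L.gram.det : ℝ))⁻¹ *
    ∑' v : Fin N → ℤ, Real.exp (-(Real.pi ^ 2 / A) * dualNorm L v),
    mul_nonneg (by positivity) (tsum_nonneg fun v => (Real.exp_pos _).le), fun a ha haA u => ⟨?_, ?_⟩⟩
  · obtain ⟨w, hw, hle⟩ := exists_gaussian_translate_bound L (b := (a : ℂ)) (by simpa using ha)
      (fun i => (u i : ℂ)) 0
    refine Summable.of_nonneg_of_le (fun l => (Real.exp_pos _).le) (fun l => ?_) hw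
    have h := hle 0 (by simp) l
    have e := cexp_ofReal_gaussian L a u l
    simp only [Pi.zero_apply, zero_add, Complex.ofReal_intCast] at h
    rw [e, Complex.norm_real] at h
    exact (Real.le_norm_self _).trans h
  · have h := theta_inversion L hN (b := (a : ℂ)) (by simpa using ha) (fun i => (u i : ℂ))
    simp_rw [cexp_ofReal_gaussian] at h
    rw [← Complex.ofReal_tsum] at h
    have hle : ∀ v : Fin N → ℤ, ‖(Real.pi / (a : ℂ)) ^ (N / 2) *
        ((Real.sqrt (L.gram.det : ℝ))⁻¹ : ℝ) * Complex.exp (-(Real.pi ^ 2 / (a : ℂ)) *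
        ((bil L.gram (dualEquiv L v : Fin N → ℚ) (dualEquiv L v : Fin N → ℚ) : ℚ) : ℂ)) *
        Complex.exp (2 * Real.pi * Complex.I * ∑ i, (v i : ℂ) * (u i : ℂ))‖ ≤
        (Real.pi / a) ^ (N / 2) * (Real.sqrt (L.gram.det : ℝ))⁻¹ *
          Real.exp (-(Real.pi ^ 2 / A) * dualNorm L v) := by
      intro v
      have e1 : ‖Complex.exp (2 * Real.pi * Complex.I * ∑ i, (v i : ℂ) * (u i : ℂ))‖ = 1 := by
        have : 2 * Real.pi * Complex.I * ∑ i, (v i : ℂ) * (u i : ℂ) =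
            ((2 * Real.pi * ∑ i, (v i : ℝ) * u i : ℝ) : ℂ) * Complex.I := by
          push_cast
          ring
        rw [this, Complex.norm_exp_ofReal_mul_I]
      have e2 : -(Real.pi ^ 2 / (a : ℂ)) *
          ((bil L.gram (dualEquiv L v : Fin N → ℚ) (dualEquiv L v : Fin N → ℚ) : ℚ) : ℂ) =
          ((-(Real.pi ^ 2 / a) * dualNorm L v : ℝ) : ℂ) := by
        rw [dualNorm]
        push_cast
        rfl
      have e3 : (Real.pi / (a : ℂ)) = ((Real.pi / a : ℝ) : ℂ) := by push_cast; rfl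
      rw [norm_mul, norm_mul, norm_mul, e1, e2, mul_one, Complex.norm_exp, Complex.ofReal_re,
        norm_pow, e3, Complex.norm_real, Complex.norm_real, Real.norm_of_nonneg (by positivity),
        Real.norm_of_nonneg (by positivity)]
      refine mul_le_mul_of_nonneg_left (Real.exp_le_exp.mpr ?_) (by positivity)
      have := dualNorm_nonneg L v
      have h4 : Real.pi ^ 2 / A ≤ Real.pi ^ 2 / a := by gcongr
      nlinarith
    have h2 := tsum_of_norm_bounded (hsum.mul_left _).hasSum hle
    rw [h.tsum_eq, Complex.norm_real, tsum_mul_left, div_pow] at h2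
    refine (Real.le_norm_self _).trans (h2.trans (le_of_eq ?_))
    rw [inv_pow]
    ring

/-- The data `(c, d, x)` of a representative of a coset. -/
def cosetData {k m : ℕ} (q : CosetSpace L k m) : {p : Fin 2 → ℤ // p ≠ 0} × (Fin N → ℤ) :=
  (⟨![q.out.right 1 0, q.out.right 1 1], fun h => by
    have h0 := congrFun h 0
    have h1 := congrFun h 1
    have hdet := sl_det q.out.right
    simp only [Matrix.cons_val_zero, Matrix.cons_val_one, Pi.zero_apply] at h0 h1
    rw [h0, h1] at hdet
    simp at hdet⟩, q.out.left.toAdd.1)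

variable {L}

theorem cosetData_injective {k m : ℕ} (hm : 0 < m) (hk : Even k) (hk0 : k ≠ 0) :
    Function.Injective (cosetData L (k := k) (m := m)) := by
  intro q q' h
  rw [cosetData, cosetData, Prod.mk.injEq, Subtype.mk.injEq] at h
  rw [← q.out_eq, ← q'.out_eq]
  refine (coset_eq_iff hm hk hk0 _ _).mpr ⟨1, Or.inl rfl, ?_, ?_, ?_⟩
  · simpa using (congrFun h.1 0).symm
  · simpa using (congrFun h.1 1).symm
  · rw [one_smul, h.2]

theorem summable_inv_norm_pow {n : ℕ} (hn : 2 < n) (τ : ℍ) :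
    Summable fun p : Fin 2 → ℤ => (‖(p 0 : ℂ) * τ + p 1‖ ^ n)⁻¹ := by
  have h1 := (EisensteinSeries.summable_one_div_norm_rpow (k := (n : ℝ))
    (by exact_mod_cast hn)).mul_left (EisensteinSeries.r τ ^ (-(n : ℝ)))
  refine Summable.of_nonneg_of_le (fun p => by positivity) (fun p => ?_) h1
  have h2 := EisensteinSeries.summand_bound τ (k := (n : ℝ)) (Nat.cast_nonneg n) p
  rwa [Real.rpow_neg (norm_nonneg _), Real.rpow_natCast] at h2

theorem r_le_norm {p : Fin 2 → ℤ} (hp : p ≠ 0) (τ : ℍ) :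
    EisensteinSeries.r τ ≤ ‖(p 0 : ℂ) * τ + p 1‖ := by
  refine le_trans ?_ (EisensteinSeries.r_mul_max_le τ hp)
  have h1 : 1 ≤ ‖p‖ := by
    rw [EisensteinSeries.norm_eq_max_natAbs]
    have : 1 ≤ max (p 0).natAbs (p 1).natAbs := by
      by_contra hcon
      refine hp (funext fun i => ?_)
      fin_cases i <;> simp <;> omega
    exact_mod_cast this
  exact le_mul_of_one_le_right (EisensteinSeries.r_pos τ).le h1

theorem summable_prod_of_tsum_le {α β : Type*} {w M : α → ℝ} {g : α → β → ℝ}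
    (hw : ∀ a, 0 ≤ w a) (hg : ∀ a b, 0 ≤ g a b) (hs : ∀ a, Summable (g a))
    (hle : ∀ a, ∑' b, g a b ≤ M a) (hM : Summable fun a => w a * M a) :
    Summable fun p : α × β => w p.1 * g p.1 p.2 := by
  have h0 : (0 : α × β → ℝ) ≤ fun p => w p.1 * g p.1 p.2 := fun p =>
    mul_nonneg (hw p.1) (hg p.1 p.2)
  rw [summable_prod_of_nonneg h0]
  simp only [tsum_mul_left]
  refine ⟨fun a => (hs a).mul_left (w a), ?_⟩
  exact Summable.of_nonneg_of_le (fun a => mul_nonneg (hw a) (tsum_nonneg (hg a)))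
    (fun a => mul_le_mul_of_nonneg_left (hle a) (hw a)) hM

/-- Summability of a majorant of the Eisenstein series. -/
theorem summable_eisenstein_majorant (hN : Even N) {k : ℕ} (hkN : N + 2 < k) (τ : ℍ) {B : ℝ}
    (hB : 0 < B) (u : (Fin 2 → ℤ) → Fin N → ℝ) :
    Summable fun p : {p : Fin 2 → ℤ // p ≠ 0} × (Fin N → ℤ) =>
      (‖(p.1.1 0 : ℂ) * τ + p.1.1 1‖ ^ k)⁻¹ *
      Real.exp (-(B / ‖(p.1.1 0 : ℂ) * τ + p.1.1 1‖ ^ 2) *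
        bil L.gram (fun i => u p.1.1 i + (p.2 i : ℝ)) (fun i => u p.1.1 i + (p.2 i : ℝ))) := by
  have hr := EisensteinSeries.r_pos τ
  -- Every nonzero `(c, d)` satisfies `|cτ + d| ≥ r(τ)`, so the Gaussian parameters `B/|cτ + d|²`
  -- are bounded above.
  obtain ⟨C, hC0, hC⟩ := exists_gaussian_sum_bound L hN (A := B / EisensteinSeries.r τ ^ 2)
    (by positivity)
  have hJ0 : ∀ p : {p : Fin 2 → ℤ // p ≠ 0}, 0 < ‖(p.1 0 : ℂ) * τ + p.1 1‖ := fun p =>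
    hr.trans_le (r_le_norm p.2 τ)
  have ha : ∀ p : {p : Fin 2 → ℤ // p ≠ 0}, 0 < B / ‖(p.1 0 : ℂ) * τ + p.1 1‖ ^ 2 := fun p =>
    div_pos hB (pow_pos (hJ0 p) 2)
  have hA : ∀ p : {p : Fin 2 → ℤ // p ≠ 0},
      B / ‖(p.1 0 : ℂ) * τ + p.1 1‖ ^ 2 ≤ B / EisensteinSeries.r τ ^ 2 := fun p =>
    div_le_div_of_nonneg_left hB.le (by positivity)
      (pow_le_pow_left₀ hr.le (r_le_norm p.2 τ) 2)
  refine summable_prod_of_tsum_le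
    (w := fun p : {p : Fin 2 → ℤ // p ≠ 0} => (‖(p.1 0 : ℂ) * τ + p.1 1‖ ^ k)⁻¹)
    (g := fun (p : {p : Fin 2 → ℤ // p ≠ 0}) (l : Fin N → ℤ) =>
      Real.exp (-(B / ‖(p.1 0 : ℂ) * τ + p.1 1‖ ^ 2) *
        bil L.gram (fun i => u p.1 i + (l i : ℝ)) (fun i => u p.1 i + (l i : ℝ))))
    (M := fun p => C * (B / ‖(p.1 0 : ℂ) * τ + p.1 1‖ ^ 2)⁻¹ ^ (N / 2))
    (fun p => inv_nonneg.mpr (pow_nonneg (norm_nonneg _) _)) (fun p l => (Real.exp_pos _).le)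
    (fun p => (hC _ (ha p) (hA p) (u p.1)).1) (fun p => (hC _ (ha p) (hA p) (u p.1)).2) ?_
  -- The sum over `x` costs a factor `|cτ + d|^N`, and the remaining exponent `k - N` exceeds `2`.
  have hs : Summable fun p : {p : Fin 2 → ℤ // p ≠ 0} =>
      (‖(p.1 0 : ℂ) * τ + p.1 1‖ ^ (k - N))⁻¹ :=
    (summable_inv_norm_pow (by omega : 2 < k - N) τ).subtype _
  refine (hs.mul_left (C * B⁻¹ ^ (N / 2))).congr fun p => ?_
  have hn := hJ0 p
  generalize ‖(p.1 0 : ℂ) * τ + p.1 1‖ = n at hn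
  have h2 : (B / n ^ 2)⁻¹ ^ (N / 2) = B⁻¹ ^ (N / 2) * n ^ N := by
    obtain ⟨M, rfl⟩ := hN
    rw [show (M + M) / 2 = M by omega, ← two_mul, pow_mul, ← mul_pow]
    congr 1
    rw [inv_div, div_eq_mul_inv, mul_comm]
  have h3 : (n ^ (k - N))⁻¹ = (n ^ k)⁻¹ * n ^ N := by
    rw [eq_comm, inv_mul_eq_iff_eq_mul₀ (by positivity), eq_mul_inv_iff_mul_eq₀ (by positivity),
      ← pow_add]
    congr 1
    omega
  rw [h2, h3]
  ring

/-- The series defining `E_{k,m}` converges absolutely. -/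
theorem summable_eisensteinTerm (hN : Even N) {k m : ℕ} (hm : 0 < m) (hk : Even k)
    (hkN : N + 2 < k) (τ : ℍ) (z : Fin N → ℂ) :
    Summable fun q : CosetSpace L k m => eisensteinTerm L k m q τ z := by
  have hm0 : (0 : ℝ) < m := by exact_mod_cast hm
  have hy := τ.im_pos
  have h := ((summable_eisenstein_majorant (L := L) hN hkN τ (B := Real.pi * m * τ.im)
    (by positivity) (fun p i => (((p 0 : ℂ) * τ + p 1).re * (z i).im -
      ((p 0 : ℂ) * τ + p 1).im * (z i).re) / τ.im)).mul_left
    (Real.exp (Real.pi * m / τ.im * bil L.gram (fun i => (z i).im) (fun i => (z i).im)))).comp_injective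
    (cosetData_injective (L := L) hm hk (by omega : k ≠ 0))
  refine Summable.of_norm (h.congr fun q => ?_)
  have e : eisensteinTerm L k m q = slash L k m (oneFun N) q.out := by
    conv_lhs => rw [← q.out_eq]
    rfl
  rw [e, norm_slash_oneFun]
  simp only [Function.comp_apply, cosetData, autFactor, Matrix.cons_val_zero, Matrix.cons_val_one]
  ring

end Convergence

/-! ### Representatives of the cosets -/

section Representatives

variable {N : ℕ} {L : EvenLattice N}

theorem exists_invMod_eq {c d : ℕ} (h : Nat.Coprime c d) (j : ℤ) :
    ∃ b : ℤ, (invMod c d : ℤ) * (d + c * j) - b * c = 1 := by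
  have h1 : (c : ℤ) ∣ 1 - (invMod c d * d : ℕ) := by
    have := Nat.modEq_iff_dvd.mp (invMod_spec h)
    exact_mod_cast this
  obtain ⟨b, hb⟩ := h1
  refine ⟨-b + invMod c d * j, ?_⟩
  push_cast at hb
  linear_combination -hb

/-- A matrix of determinant `1` with lower row `(c, d + c j)` and upper left entry `invMod c d`. -/
def cuspMatrix {c d : ℕ} (h : Nat.Coprime c d) (j : ℤ) : SL(2, ℤ) :=
  ⟨!![(invMod c d : ℤ), (exists_invMod_eq h j).choose; (c : ℤ), d + c * j], by
    rw [Matrix.det_fin_two_of]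
    exact (exists_invMod_eq h j).choose_spec⟩

/-- The indices `(c, d, x₀, j, l)` of the cosets with `c > 0`. -/
abbrev BigCellIndex (N : ℕ) : Type :=
  Σ c : ℕ+, ({d : Fin c // Nat.Coprime c d} × (Fin N → Fin c)) × (ℤ × (Fin N → ℤ))

/-- The element of the Jacobi group attached to an index. -/
def bigCellRep (p : BigCellIndex N) : JacobiGroup N :=
  ⟨Multiplicative.ofAdd (fun i => ((p.2.1.2 i : ℕ) : ℤ) + (p.1 : ℕ) * p.2.2.2 i, 0),
    cuspMatrix p.2.1.1.2 p.2.2.1⟩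

/-- The element `[x, 0]` of the Jacobi group. -/
def translationRep (x : Fin N → ℤ) : JacobiGroup N :=
  ⟨Multiplicative.ofAdd (x, 0), 1⟩

theorem fin_add_mul_inj {c : ℕ} {d d' : Fin c} {j j' : ℤ}
    (h : ((d : ℕ) : ℤ) + c * j = ((d' : ℕ) : ℤ) + c * j') : d = d' ∧ j = j' := by
  have hc : 0 < c := d.pos
  have h1 := congrArg (· % (c : ℤ)) h
  simp only [Int.add_mul_emod_self_left] at h1
  rw [Int.emod_eq_of_lt (by omega) (by exact_mod_cast d.2),
    Int.emod_eq_of_lt (by omega) (by exact_mod_cast d'.2)] at h1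
  have hd : d = d' := Fin.ext (by exact_mod_cast h1)
  subst hd
  refine ⟨rfl, ?_⟩
  have hc' : (c : ℤ) ≠ 0 := by exact_mod_cast hc.ne'
  exact mul_left_cancel₀ hc' (add_left_cancel h)

theorem exists_fin_add_mul {c : ℕ} (hc : 0 < c) (D : ℤ) :
    ∃ (d : Fin c) (j : ℤ), D = ((d : ℕ) : ℤ) + c * j := by
  have hc' : (0 : ℤ) < c := by exact_mod_cast hc
  have h1 := Int.emod_nonneg D hc'.ne'
  have h2 := Int.emod_lt_of_pos D hc'
  refine ⟨⟨(D % c).toNat, by omega⟩, D / c, ?_⟩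
  simp only [Int.toNat_of_nonneg h1]
  exact (Int.emod_add_mul_ediv D c).symm

/-- The parametrization of the cosets. -/
def cosetOfIndex (L : EvenLattice N) (k m : ℕ) : (Fin N → ℤ) ⊕ BigCellIndex N → CosetSpace L k m :=
  Sum.elim (fun x => Quotient.mk _ (translationRep x)) (fun p => Quotient.mk _ (bigCellRep p))

theorem cosetOfIndex_injective {k m : ℕ} (hm : 0 < m) (hk : Even k) (hk0 : k ≠ 0) :
    Function.Injective (cosetOfIndex L k m) := by
  have hcM : ∀ p : BigCellIndex N, (bigCellRep p).right 1 0 = ((p.1 : ℕ) : ℤ) := fun p => rfl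
  have hdM : ∀ p : BigCellIndex N, (bigCellRep p).right 1 1 =
    ((p.2.1.1.1 : ℕ) : ℤ) + (p.1 : ℕ) * p.2.2.1 := fun p => rfl
  have hxM : ∀ p : BigCellIndex N, (bigCellRep p).left.toAdd.1 =
    fun i => ((p.2.1.2 i : ℕ) : ℤ) + (p.1 : ℕ) * p.2.2.2 i := fun p => rfl
  have hcT : ∀ x : Fin N → ℤ, (translationRep x).right 1 0 = 0 := fun x => rfl
  have hdT : ∀ x : Fin N → ℤ, (translationRep x).right 1 1 = 1 := fun x => rfl
  have hxT : ∀ x : Fin N → ℤ, (translationRep x).left.toAdd.1 = x := fun x => rfl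
  rintro (x | p) (x' | p') h
  · obtain ⟨s, hs, h1, h2, h3⟩ := (coset_eq_iff hm hk hk0 _ _).mp h
    rw [hdT, hdT, mul_one] at h2
    rw [hxT, hxT, ← h2, one_smul] at h3
    rw [h3]
  · obtain ⟨s, hs, h1, h2, h3⟩ := (coset_eq_iff hm hk hk0 _ _).mp h
    rw [hcT, hcM, mul_zero] at h1
    have := p'.1.pos
    omega
  · obtain ⟨s, hs, h1, h2, h3⟩ := (coset_eq_iff hm hk hk0 _ _).mp h
    rw [hcT, hcM] at h1
    have := p.1.pos
    rcases hs with rfl | rfl <;> omega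
  · obtain ⟨s, hs, h1, h2, h3⟩ := (coset_eq_iff hm hk hk0 _ _).mp h
    obtain ⟨c, ⟨d, x⟩, j, l⟩ := p
    obtain ⟨c', ⟨d', x'⟩, j', l'⟩ := p'
    rw [hcM, hcM] at h1
    have hc := c.pos
    have hc' := c'.pos
    -- Both lower left entries are positive, which rules out the sign `-1`.
    have hs1 : s = 1 := by
      rcases hs with rfl | rfl
      · rfl
      · simp only at h1
        omega
    subst hs1
    rw [one_mul] at h1
    have hcc : c' = c := PNat.coe_injective (by exact_mod_cast h1)
    subst hcc
    rw [hdM, hdM, one_mul] at h2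
    rw [hxM, hxM, one_smul] at h3
    obtain ⟨e1, e2⟩ := fin_add_mul_inj h2
    have e3 : ∀ i, x' i = x i ∧ l' i = l i := fun i => fin_add_mul_inj (congrFun h3 i)
    have e4 : x' = x := funext fun i => (e3 i).1
    have e5 : l' = l := funext fun i => (e3 i).2
    have e6 : d' = d := Subtype.ext e1
    simp only at e2
    rw [e4, e5, e6, e2]

theorem cosetOfIndex_surjective {k m : ℕ} (hm : 0 < m) (hk : Even k) (hk0 : k ≠ 0) :
    Function.Surjective (cosetOfIndex L k m) := by
  intro q
  obtain ⟨g, rfl⟩ := Quotient.exists_rep q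
  have hdet := sl_det g.right
  rcases eq_or_ne (g.right 1 0) 0 with hc | hc
  · rw [hc, mul_zero, sub_zero] at hdet
    have hu := Int.isUnit_iff.mp (IsUnit.of_mul_eq_one_right _ hdet)
    -- Here `d = ±1`, and multiplying `(0, d, x)` by the sign `d` normalizes it to `(0, 1, dx)`.
    refine ⟨Sum.inl (g.right 1 1 • g.left.toAdd.1), (coset_eq_iff hm hk hk0 _ _).mpr
      ⟨g.right 1 1, hu, ?_, ?_, ?_⟩⟩
    · rw [hc]
      exact (mul_zero _).symm
    · exact (mul_one _).symm
    · change _ = _ • (g.right 1 1 • g.left.toAdd.1)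
      rw [smul_smul]
      rcases hu with h | h <;> rw [h] <;> simp
  · obtain ⟨s, hs, hpos⟩ : ∃ s : ℤ, (s = 1 ∨ s = -1) ∧ 0 < s * g.right 1 0 := by
      rcases lt_or_gt_of_ne hc with h | h
      · exact ⟨-1, Or.inr rfl, by linarith⟩
      · exact ⟨1, Or.inl rfl, by linarith⟩
    have hss : s * s = 1 := by rcases hs with rfl | rfl <;> rfl
    obtain ⟨c, hcc⟩ : ∃ c : ℕ, (c : ℤ) = s * g.right 1 0 :=
      ⟨_, Int.toNat_of_nonneg hpos.le⟩
    have hc0 : 0 < c := by omega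
    obtain ⟨d, j, hd⟩ := exists_fin_add_mul hc0 (s * g.right 1 1)
    choose x l hx using fun i => exists_fin_add_mul hc0 (s * g.left.toAdd.1 i)
    have hcop : Nat.Coprime c d := by
      rw [← Nat.isCoprime_iff_coprime]
      -- Bézout coefficients, from the determinant relation after reducing the lower right entry
      -- modulo `c`.
      refine ⟨j * (s * g.right 0 0) - s * g.right 0 1, s * g.right 0 0, ?_⟩
      linear_combination hdet + (g.right 0 0 * g.right 1 1 - g.right 0 1 * g.right 1 0) * (hss) - (s * g.right 0 0) * hd - s * g.right 0 1 * hcc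
    refine ⟨Sum.inr ⟨⟨c, hc0⟩, (⟨d, hcop⟩, x), (j, l)⟩, (coset_eq_iff hm hk hk0 _ _).mpr
      ⟨s, hs, ?_, ?_, ?_⟩⟩
    · change g.right 1 0 = s * (c : ℤ)
      rw [hcc]
      linear_combination -(g.right 1 0) * hss
    · change g.right 1 1 = s * (((d : ℕ) : ℤ) + (c : ℤ) * j)
      rw [← hd]
      linear_combination -(g.right 1 1) * hss
    · funext i
      change g.left.toAdd.1 i = s * (((x i : ℕ) : ℤ) + (c : ℤ) * l i)
      rw [← hx i]
      linear_combination -(g.left.toAdd.1 i) * hss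

theorem thetaTerm_smul_gram (L : EvenLattice N) (m : ℕ) (x : Fin N → ℤ) (τ : ℍ)
    (z : Fin N → ℂ) : thetaTerm ((m : ℤ) • L.gram) 0 0 τ z x =
      Complex.exp (Real.pi * Complex.I * m * (((bil L.gram x x : ℤ) : ℂ) * (τ : ℂ) +
        2 * bil L.gram (fun i => (x i : ℂ)) z)) := by
  have h : ∀ u v : Fin N → ℂ, bil ((m : ℤ) • L.gram) u v = m * bil L.gram u v := by
    intro u v
    simp only [bil, Finset.mul_sum]
    refine Finset.sum_congr rfl fun i _ => Finset.sum_congr rfl fun j _ => ?_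
    simp
    ring
  have h4 : (fun i => (x i : ℂ) + (((0 : Fin N → ℚ) i : ℚ) : ℂ)) = fun i => (x i : ℂ) := by
    simp
  have h5 : (fun i => z i + (((0 : Fin N → ℚ) i : ℚ) : ℂ)) = z := by
    simp
  rw [thetaTerm, h4, h5, h, h, bil_intCast]
  congr 1
  ring

theorem eisensteinTerm_translationRep (k m : ℕ) (x : Fin N → ℤ) (τ : ℍ) (z : Fin N → ℂ) :
    eisensteinTerm L k m (Quotient.mk _ (translationRep x)) τ z =
      thetaTerm ((m : ℤ) • L.gram) 0 0 τ z x := by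
  change slash L k m (oneFun N) (translationRep x) τ z = _
  rw [slash_oneFun_apply]
  have h1 : autFactor (translationRep x).right τ = 1 := by
    change autFactor 1 τ = 1
    simp [autFactor]
  have h2 : (translationRep x).right = 1 := rfl
  rw [h1, h2, thetaTerm_smul_gram]
  change _ * Complex.exp (Real.pi * Complex.I * m * (((bil L.gram x x : ℤ) : ℂ) * _ +
    2 * (1⁻¹ * bil L.gram (fun i => (x i : ℂ)) z) - _)) = _
  simp

/-- With `Aτ = a/c - 1/(cJ)`, `J = cτ + d + cj`, completing the square for `X = x + cl` gives `-(z -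
X/c, z - X/c)/(J/c) + (a/c)(X, X)`. The entry `a` does not depend on `j`, so the last term splits
off as a root of unity depending on the residues only. -/
theorem eisensteinTerm_bigCellRep (k m : ℕ) (p : BigCellIndex N) (τ : ℍ) (z : Fin N → ℂ) :
    eisensteinTerm L k m (Quotient.mk _ (bigCellRep p)) τ z =
      ((p.1 : ℕ) : ℂ) ^ (-(k : ℤ)) *
      Complex.exp (Real.pi * Complex.I / ((p.1 : ℕ) : ℂ) * (m * invMod p.1 p.2.1.1.1 *
        bil L.gram (fun i => ((p.2.1.2 i : ℕ) : ℂ)) (fun i => ((p.2.1.2 i : ℕ) : ℂ)))) *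
      translateTerm L k m (τ + ((p.2.1.1.1 : ℕ) : ℂ) / ((p.1 : ℕ) : ℂ))
        (fun i => z i - ((p.2.1.2 i : ℕ) : ℂ) / ((p.1 : ℕ) : ℂ)) p.2.2 := by
  obtain ⟨c, ⟨⟨d, hd⟩, x⟩, j, l⟩ := p
  have hc0 : ((c : ℕ) : ℂ) ≠ 0 := by exact_mod_cast c.ne_zero
  set X : Fin N → ℤ := fun i => ((x i : ℕ) : ℤ) with hX
  set A : SL(2, ℤ) := cuspMatrix hd j with hA
  have hdet := sl_det A
  have h00 : A 0 0 = invMod c d := rfl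
  have h10 : A 1 0 = ((c : ℕ) : ℤ) := rfl
  have h11 : A 1 1 = ((d : ℕ) : ℤ) + ((c : ℕ) : ℤ) * j := rfl
  have hJ := autFactor_ne_zero A τ
  have hJc : ((τ : ℂ) + ((d : ℕ) : ℂ) / ((c : ℕ) : ℂ) + j) = autFactor A τ / ((c : ℕ) : ℂ) := by
    rw [autFactor, h10, h11]
    field_simp
    push_cast
    ring
  have hAτ : ((A • τ : ℍ) : ℂ) = (invMod c d : ℂ) / ((c : ℕ) : ℂ) -
      (((c : ℕ) : ℂ) * autFactor A τ)⁻¹ := by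
    have hdet' : (A 0 0 : ℂ) * A 1 1 - A 0 1 * A 1 0 = 1 := by exact_mod_cast hdet
    rw [coe_sl_smul]
    have e : (A 0 0 : ℂ) = (invMod c d : ℂ) := by rw [h00]; push_cast; rfl
    have e2 : (A 1 0 : ℂ) = ((c : ℕ) : ℂ) := by rw [h10]; push_cast; rfl
    rw [e, e2] at hdet'
    rw [e]
    field_simp
    rw [autFactor, e2]
    linear_combination -hdet'
  have hXl : (fun i => (((fun i => ((x i : ℕ) : ℤ) + ((c : ℕ) : ℤ) * l i) i : ℤ) : ℂ)) =
      (fun i => (X i : ℂ)) + ((c : ℕ) : ℂ) • fun i => (l i : ℂ) := by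
    funext i
    simp [hX]
  have hw : (fun i => z i - ((x i : ℕ) : ℂ) / ((c : ℕ) : ℂ) - (l i : ℂ)) =
      z + (-((c : ℕ) : ℂ)⁻¹) • (fun i => (X i : ℂ)) + (-1 : ℂ) • fun i => (l i : ℂ) := by
    funext i
    simp [hX]
    ring
  have hx : (fun i => ((x i : ℕ) : ℂ)) = fun i => (X i : ℂ) := by
    funext i
    simp [hX]
  obtain ⟨s, hs⟩ := L.even l
  have hl := bil_intCast (R := ℂ) L.gram l l
  have hP := bil_intCast (R := ℂ) L.gram X l
  rw [hs] at hl
  change slash L k m (oneFun N) (bigCellRep ⟨c, (⟨d, hd⟩, x), (j, l)⟩) τ z = _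
  rw [slash_oneFun_apply, ← bil_intCast (R := ℂ)]
  change autFactor A τ ^ (-(k : ℤ)) * Complex.exp (Real.pi * Complex.I * m *
    (bil L.gram (fun i => (((fun i => ((x i : ℕ) : ℤ) + ((c : ℕ) : ℤ) * l i) i : ℤ) : ℂ))
      (fun i => (((fun i => ((x i : ℕ) : ℤ) + ((c : ℕ) : ℤ) * l i) i : ℤ) : ℂ)) *
      ((A • τ : ℍ) : ℂ) + 2 * ((autFactor A τ)⁻¹ *
      bil L.gram (fun i => (((fun i => ((x i : ℕ) : ℤ) + ((c : ℕ) : ℤ) * l i) i : ℤ) : ℂ)) z) -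
      (((c : ℕ) : ℤ) : ℂ) * bil L.gram z z / autFactor A τ)) = _
  simp only [translateTerm]
  rw [hXl, hw, hJc, hAτ, hx]
  simp only [bil_add_left, bil_add_right, bil_smul_left, bil_smul_right]
  rw [bil_comm L.isSymm z fun i => (X i : ℂ), bil_comm L.isSymm z fun i => (l i : ℂ),
    bil_comm L.isSymm (fun i => (l i : ℂ)) fun i => (X i : ℂ), hl, hP]
  generalize bil L.gram z z = zz
  generalize bil L.gram (fun i => (X i : ℂ)) z = Xz
  generalize bil L.gram (fun i => (l i : ℂ)) z = lz
  generalize bil L.gram (fun i => (X i : ℂ)) (fun i => (X i : ℂ)) = XX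
  have hmul : ∀ (u v e f : ℂ), u ≠ 0 → u * e * (v / u * f) = v * (e * f) := by
    intro u v e f hu
    field_simp
  rw [div_zpow, hmul _ _ _ _ (zpow_ne_zero _ hc0), ← Complex.exp_add]
  congr 1
  rw [Complex.exp_eq_exp_iff_exists_int]
  -- Expanding the form at `x + cl`, where `(l, l) = 2s` by evenness: replacing it by its value at
  -- `x` changes the exponent by a multiple of `2πi`.
  refine ⟨m * invMod c d * (bil L.gram X l + (c : ℕ) * s), ?_⟩
  push_cast
  field_simp
  ring

end Representatives

/-! ### The Dirichlet-type series of exponential sums -/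

section ExponentialSums

variable {N : ℕ} {L : EvenLattice N}

theorem sum_range_mul_of_periodic {M : Type*} [AddCommMonoid M] {f : ℕ → M} {c : ℕ}
    (hf : ∀ d, f (d + c) = f d) (m : ℕ) :
    ∑ d ∈ Finset.range (m * c), f d = m • ∑ d ∈ Finset.range c, f d := by
  induction m with
  | zero => simp
  | succ m ih =>
    have h : ∀ d, f (m * c + d) = f d := by
      intro d
      rw [add_comm]
      exact (show Function.Periodic f c from hf).nat_mul m d
    rw [add_mul, one_mul, Finset.sum_range_add, ih, succ_nsmul]
    simp_rw [h]

theorem gaussSum_add (L : EvenLattice N) (m n : ℕ) (lam : Fin N → ℚ) (c : ℕ+) (d : ℕ) :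
    gaussSum L m n lam c (d + c) = gaussSum L m n lam c d := by
  have h1 : invMod c (d + c) = invMod c d := by simp [invMod]
  have hc0 : ((c : ℕ) : ℂ) ≠ 0 := by exact_mod_cast c.ne_zero
  rw [gaussSum, gaussSum, h1]
  refine Finset.sum_congr rfl fun x _ => ?_
  rw [Complex.exp_eq_exp_iff_exists_int]
  refine ⟨n, ?_⟩
  push_cast
  field_simp
  ring

/-- The sum over `d` modulo `c` coprime to `c` of `c^{-k}` times the exponential sum. -/
def cuspTerm (L : EvenLattice N) (k m n : ℕ) (lam : Fin N → ℚ) (c : ℕ+) : ℂ :=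
  ((c : ℕ) : ℂ) ^ (-(k : ℤ)) *
    ∑ d : {d : Fin c // Nat.Coprime c d}, gaussSum L m n lam c (d.1 : ℕ)

/-- The exponential sum depends only on `d` modulo `c`, so summing over `d` modulo `mc` counts each
class `m` times, and `m · m^(-k) = m^(-(k-1))`. -/
theorem betaTerm_eq (L : EvenLattice N) {k m : ℕ} (hm : 0 < m) (hk : 0 < k) (n : ℕ)
    (lam : Fin N → ℚ) (c : ℕ+) :
    betaTerm L k m n lam c = ((m : ℂ) ^ (k - 1))⁻¹ * cuspTerm L k m n lam c := by
  have hm0 : (m : ℂ) ≠ 0 := by exact_mod_cast hm.ne'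
  have hper : ∀ d, (if Nat.Coprime c (d + c) then gaussSum L m n lam c (d + c) else 0) =
      if Nat.Coprime c d then gaussSum L m n lam c d else 0 := by
    intro d
    simp only [gaussSum_add, Nat.coprime_add_self_right]
  have hsum : ∑ d : {d : Fin c // Nat.Coprime c d}, gaussSum L m n lam c (d.1 : ℕ) =
      ∑ d ∈ Finset.range c, if Nat.Coprime c d then gaussSum L m n lam c d else 0 := by
    rw [Finset.sum_range, ← Finset.sum_filter]
    exact (Finset.sum_subtype (Finset.univ.filter fun d : Fin c => Nat.Coprime c d)
      (by simp) (fun d : Fin c => gaussSum L m n lam c (d : ℕ))).symm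
  obtain ⟨k, rfl⟩ : ∃ j, k = j + 1 := ⟨k - 1, by omega⟩
  rw [betaTerm, cuspTerm, ← Finset.mul_sum, Finset.sum_filter,
    sum_range_mul_of_periodic (f := fun d => if Nat.Coprime c d then gaussSum L m n lam c d else 0)
      hper, hsum, mul_zpow, zpow_neg, zpow_natCast, nsmul_eq_mul, Nat.add_sub_cancel, pow_succ]
  field_simp

theorem norm_gaussSum_le (L : EvenLattice N) (m n : ℕ) (lam : Fin N → ℚ) (c : ℕ+) (d : ℕ) :
    ‖gaussSum L m n lam c d‖ ≤ (c : ℝ) ^ N := by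
  refine (norm_sum_le _ _).trans ?_
  have h : ∀ r : ℚ, ‖Complex.exp (Real.pi * Complex.I / (c : ℂ) * (r : ℂ))‖ = 1 := by
    intro r
    have : Real.pi * Complex.I / (c : ℂ) * (r : ℂ) =
        ((Real.pi / (c : ℝ) * r : ℝ) : ℂ) * Complex.I := by
      push_cast
      ring
    rw [this, Complex.norm_exp_ofReal_mul_I]
  refine (Finset.sum_le_sum fun x _ => (h _).le).trans ?_
  simp

/-- Trivial bound: at most `c` classes `d` and `c^N` classes `x`. It is independent of `(n, λ)`,
which later permits the interchange of sums. -/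
theorem norm_cuspTerm_le (L : EvenLattice N) {k : ℕ} (m n : ℕ) (lam : Fin N → ℚ) (c : ℕ+) :
    ‖cuspTerm L k m n lam c‖ ≤ ((c : ℝ) ^ k)⁻¹ * (c : ℝ) ^ (N + 1) := by
  rw [cuspTerm, norm_mul, zpow_neg, zpow_natCast, norm_inv, norm_pow, Complex.norm_natCast]
  refine mul_le_mul_of_nonneg_left ?_ (by positivity)
  refine (norm_sum_le _ _).trans
    ((Finset.sum_le_sum fun d _ => norm_gaussSum_le L m n lam c _).trans ?_)
  rw [Finset.sum_const, nsmul_eq_mul, Finset.card_univ, pow_succ, mul_comm]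
  refine mul_le_mul_of_nonneg_left ?_ (by positivity)
  have := Fintype.card_subtype_le fun d : Fin c => Nat.Coprime c d
  rw [Fintype.card_fin] at this
  exact_mod_cast this

theorem summable_pnat_inv_pow_mul {k N : ℕ} (hkN : N + 2 < k) :
    Summable fun c : ℕ+ => ((c : ℝ) ^ k)⁻¹ * (c : ℝ) ^ (N + 1) := by
  have h := (Real.summable_nat_pow_inv (p := 2)).mpr (by norm_num)
  refine Summable.of_nonneg_of_le (fun c => by positivity) (fun c => ?_)
    (h.comp_injective PNat.coe_injective)
  have hc : (1 : ℝ) ≤ c := by exact_mod_cast c.pos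
  obtain ⟨j, rfl⟩ := Nat.exists_eq_add_of_lt hkN
  have : (c : ℝ) ^ (N + 1) * (c : ℝ) ^ 2 ≤ (c : ℝ) ^ (N + 2 + j + 1) := by
    rw [← pow_add]
    exact pow_le_pow_right₀ hc (by omega)
  simp only [Function.comp_apply]
  rw [inv_mul_le_iff₀ (by positivity), ← div_eq_mul_inv, le_div_iff₀ (by positivity)]
  exact this

theorem summable_cuspTerm (L : EvenLattice N) {k : ℕ} (hkN : N + 2 < k) (m n : ℕ)
    (lam : Fin N → ℚ) : Summable (cuspTerm L k m n lam) :=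
  Summable.of_norm_bounded (summable_pnat_inv_pow_mul hkN) fun c => norm_cuspTerm_le L m n lam c

theorem summable_betaTerm (L : EvenLattice N) {k m : ℕ} (hm : 0 < m) (hkN : N + 2 < k) (n : ℕ)
    (lam : Fin N → ℚ) : Summable (betaTerm L k m n lam) := by
  rw [funext (betaTerm_eq L hm (by omega : 0 < k) n lam)]
  exact (summable_cuspTerm L hkN m n lam).mul_left _

/-- The level enters as `q^(-(k-N/2))`, `q^(k-N/2-1)` and the sum over `ν`, which is `q`; the
product is `1`. The factor `m^(-(k-1))` comes from the Dirichlet-type series. -/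
theorem beta_eq (L : EvenLattice N) {k m : ℕ} (hm : 0 < m) (hkN : N + 2 < k) (n : ℕ)
    (lam : dualLattice L) :
    beta L k m n lam = translateCoeff L k m n lam * ∑' c : ℕ+, cuspTerm L k m n lam c := by
  have hq : (level L : ℂ) ≠ 0 := by exact_mod_cast (level_pos L).ne'
  rw [beta, funext (betaTerm_eq L hm (by omega : 0 < k) n (lam : Fin N → ℚ)), tsum_mul_left,
    levelSum_eq_level, translateCoeff]
  obtain ⟨j, hj⟩ : ∃ j, k - N / 2 = j + 1 := ⟨k - N / 2 - 1, by omega⟩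
  rw [hj, Nat.add_sub_cancel, div_pow, mul_pow (level L : ℂ), pow_succ (level L : ℂ)]
  field_simp

end ExponentialSums

/-! ### The Fourier expansion of the Eisenstein series -/

section Expansion

variable {N : ℕ} {L : EvenLattice N}

theorem summable_eisensteinTerm_cosetOfIndex (hN : Even N) {k m : ℕ} (hm : 0 < m) (hk : Even k)
    (hkN : N + 2 < k) (τ : ℍ) (z : Fin N → ℂ) :
    Summable fun i => eisensteinTerm L k m (cosetOfIndex L k m i) τ z :=
  (summable_eisensteinTerm hN hm hk hkN τ z).comp_injective
    (cosetOfIndex_injective hm hk (by omega))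

theorem summable_thetaTerm (hN : Even N) {k m : ℕ} (hm : 0 < m) (hk : Even k)
    (hkN : N + 2 < k) (τ : ℍ) (z : Fin N → ℂ) :
    Summable (thetaTerm ((m : ℤ) • L.gram) 0 0 τ z) := by
  refine ((summable_eisensteinTerm_cosetOfIndex (L := L) hN hm hk hkN τ z).comp_injective
    Sum.inl_injective).congr fun x => ?_
  exact (eisensteinTerm_translationRep k m x τ z)

/-- The contribution to the Eisenstein series of the cosets with given lower left entry `c > 0`. -/
def cellSum (L : EvenLattice N) (k m : ℕ) (τ : ℍ) (z : Fin N → ℂ) (c : ℕ+) : ℂ :=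
  ∑ q : {d : Fin c // Nat.Coprime c d} × (Fin N → Fin c),
    ((c : ℕ) : ℂ) ^ (-(k : ℤ)) *
      Complex.exp (Real.pi * Complex.I / ((c : ℕ) : ℂ) * (m * invMod c q.1.1 *
        bil L.gram (fun i => ((q.2 i : ℕ) : ℂ)) (fun i => ((q.2 i : ℕ) : ℂ)))) *
      ∑' (j : ℤ) (l : Fin N → ℤ), translateTerm L k m (τ + ((q.1.1 : ℕ) : ℂ) / ((c : ℕ) : ℂ))
        (fun i => z i - ((q.2 i : ℕ) : ℂ) / ((c : ℕ) : ℂ)) (j, l)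

theorem jacobiE_sub_theta (hN : Even N) {k m : ℕ} (hm : 0 < m) (hk : Even k)
    (hkN : N + 2 < k) (τ : ℍ) (z : Fin N → ℂ) :
    jacobiE L k m τ z - theta ((m : ℤ) • L.gram) 0 0 τ z = ∑' c : ℕ+, cellSum L k m τ z c := by
  have hs := summable_eisensteinTerm_cosetOfIndex (L := L) hN hm hk hkN τ z
  have hbij : Function.Bijective (cosetOfIndex L k m) :=
    ⟨cosetOfIndex_injective hm hk (by omega), cosetOfIndex_surjective hm hk (by omega)⟩
  have h1 : jacobiE L k m τ z = ∑' i, eisensteinTerm L k m (cosetOfIndex L k m i) τ z :=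
    ((Equiv.ofBijective _ hbij).tsum_eq fun q => eisensteinTerm L k m q τ z).symm
  have hr := hs.comp_injective (Sum.inr_injective (α := Fin N → ℤ) (β := BigCellIndex N))
  have hl := hs.comp_injective (Sum.inl_injective (α := Fin N → ℤ) (β := BigCellIndex N))
  have h2 : theta ((m : ℤ) • L.gram) 0 0 τ z =
      ∑' x, eisensteinTerm L k m (cosetOfIndex L k m (Sum.inl x)) τ z :=
    tsum_congr fun x => (eisensteinTerm_translationRep k m x τ z).symm
  rw [h1, hl.tsum_sum hr, h2, add_sub_cancel_left]
  refine (hr.tsum_sigma).trans (tsum_congr fun c => ?_)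
  have hc := hr.sigma_factor c
  refine (hc.tsum_prod).trans ((tsum_fintype _).trans (Finset.sum_congr rfl fun q _ => ?_))
  refine ((hc.prod_factor q).tsum_prod).trans ?_
  rw [← tsum_mul_left]
  refine tsum_congr fun j => ?_
  rw [← tsum_mul_left]
  exact tsum_congr fun l => eisensteinTerm_bigCellRep k m ⟨c, q, (j, l)⟩ τ z

/-- At `t = τ + d/c` and `w = z - x/c` a mode acquires the factor `exp(2πi(nd - (λ, x))/c)`;
together with the root of unity `exp(πi m a(x, x)/c)` this is the summand of the exponential sum. -/
theorem hasSum_cellSum (hN : Even N) {k m : ℕ} (hm : 0 < m) (hkN : N + 2 < k)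
    (τ : ℍ) (z : Fin N → ℂ) (c : ℕ+) :
    HasSum (fun p : PositivePairs L m => translateCoeff L k m p.1.1 p.1.2 *
      fourierMode L p.1.1 p.1.2 τ z * cuspTerm L k m p.1.1 p.1.2 c) (cellSum L k m τ z c) := by
  have hc0 : ((c : ℕ) : ℂ) ≠ 0 := by exact_mod_cast c.ne_zero
  have hsum := hasSum_sum (s := Finset.univ)
    fun (q : {d : Fin c // Nat.Coprime c d} × (Fin N → Fin c)) _ =>
    (hasSum_translateTerm (L := L) hN hm (k := k) (by omega)
      (t := τ + ((q.1.1 : ℕ) : ℂ) / ((c : ℕ) : ℂ)) (by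
        have : (((q.1.1 : ℕ) : ℂ) / ((c : ℕ) : ℂ)).im = 0 := by
          rw [← Complex.ofReal_natCast, ← Complex.ofReal_natCast, ← Complex.ofReal_div,
            Complex.ofReal_im]
        rw [Complex.add_im, this, add_zero]
        exact τ.im_pos)
      (fun i => z i - ((q.2 i : ℕ) : ℂ) / ((c : ℕ) : ℂ))).mul_left
      (((c : ℕ) : ℂ) ^ (-(k : ℤ)) *
      Complex.exp (Real.pi * Complex.I / ((c : ℕ) : ℂ) * (m * invMod c q.1.1 *
        bil L.gram (fun i => ((q.2 i : ℕ) : ℂ)) (fun i => ((q.2 i : ℕ) : ℂ)))))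
  refine HasSum.congr_fun hsum fun p => ?_
  obtain ⟨⟨n, lam⟩, hp⟩ := p
  simp only
  rw [cuspTerm, Fintype.sum_prod_type, Finset.mul_sum, Finset.mul_sum]
  refine Finset.sum_congr rfl fun d _ => ?_
  rw [gaussSum, Finset.mul_sum, Finset.mul_sum]
  refine Finset.sum_congr rfl fun x _ => ?_
  set X : Fin N → ℂ := fun i => ((x i : ℕ) : ℂ) with hX
  have hw : (fun i => z i - ((x i : ℕ) : ℂ) / ((c : ℕ) : ℂ)) = z + (-((c : ℕ) : ℂ)⁻¹) • X := by
    funext i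
    simp [hX]
    ring
  have h1 : ((bil L.gram (fun i => ((x i : ℕ) : ℚ)) (fun i => ((x i : ℕ) : ℚ)) : ℚ) : ℂ) =
      bil L.gram X X := by
    rw [← bil_ratCast]
    simp [hX]
  have h2 : ((bil L.gram (lam : Fin N → ℚ) (fun i => ((x i : ℕ) : ℚ)) : ℚ) : ℂ) =
      bil L.gram (fun i => ((lam : Fin N → ℚ) i : ℂ)) X := by
    rw [← bil_ratCast]
    simp [hX]
  have hexp : ∀ a b u A B u' b' : ℂ, a * Complex.exp A * (b * (Complex.exp u * Complex.exp u')) =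
      b * (Complex.exp B * Complex.exp b') * (a * Complex.exp (A + (u - B) + (u' - b'))) := by
    intro a b u A B u' b'
    rw [Complex.exp_add, Complex.exp_add, Complex.exp_sub, Complex.exp_sub]
    field_simp
  rw [hw, bil_add_right, bil_smul_right, fourierMode, hexp]
  congr 3
  push_cast
  rw [h1, h2]
  field_simp
  ring

theorem hasSum_jacobiE_sub_theta (hN : Even N) {k m : ℕ} (hm : 0 < m) (hk : Even k)
    (hkN : N + 2 < k) (τ : ℍ) (z : Fin N → ℂ) :
    HasSum (fun p : PositivePairs L m => beta L k m p.1.1 p.1.2 * fourierMode L p.1.1 p.1.2 τ z)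
      (jacobiE L k m τ z - theta ((m : ℤ) • L.gram) 0 0 τ z) := by
  set F : PositivePairs L m → ℂ := fun p => translateCoeff L k m p.1.1 p.1.2 *
    fourierMode L p.1.1 p.1.2 τ z with hF
  have hFs : Summable F :=
    (hasSum_translateTerm (L := L) hN hm (k := k) (by omega) τ.im_pos z).summable
  -- The expansion for a single translate sum already converges absolutely, and the bound in `c` is
  -- uniform in `(n, λ)`, so a product majorant allows summing over `c` first or last.
  have hT : Summable fun q : PositivePairs L m × ℕ+ => F q.1 * cuspTerm L k m q.1.1.1 q.1.1.2 q.2 := by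
    refine Summable.of_norm_bounded
      (hFs.norm.mul_of_nonneg (summable_pnat_inv_pow_mul hkN) (fun _ => norm_nonneg _)
        fun c => by positivity) fun q => ?_
    rw [norm_mul]
    exact mul_le_mul_of_nonneg_left (norm_cuspTerm_le L _ _ _ _) (norm_nonneg _)
  have h1 : ∑' q : PositivePairs L m × ℕ+, F q.1 * cuspTerm L k m q.1.1.1 q.1.1.2 q.2 =
      jacobiE L k m τ z - theta ((m : ℤ) • L.gram) 0 0 τ z := by
    rw [jacobiE_sub_theta hN hm hk hkN, ← (Equiv.prodComm ℕ+ (PositivePairs L m)).tsum_eq]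
    refine (((Equiv.prodComm ℕ+ (PositivePairs L m)).summable_iff.mpr hT).tsum_prod).trans ?_
    exact tsum_congr fun c => (hasSum_cellSum hN hm hkN τ z c).tsum_eq
  rw [← h1]
  refine HasSum.congr_fun (hT.hasSum.prod_fiberwise fun p =>
    ((summable_cuspTerm L hkN m p.1.1 (p.1.2 : Fin N → ℚ)).mul_left (F p)).hasSum) fun p => ?_
  rw [beta_eq L hm hkN, tsum_mul_left]
  ring

end Expansion

/-! ### The Eisenstein series is a Jacobi form -/

section JacobiForm

variable {N : ℕ} {L : EvenLattice N}

/-- At a fixed point the slash operator is a multiple of an evaluation, so it commutes with infinite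
sums. -/
theorem exists_slash_eq (L : EvenLattice N) (k m : ℕ) (g : JacobiGroup N) (τ : ℍ)
    (z : Fin N → ℂ) : ∃ (C : ℂ) (τ' : ℍ) (z' : Fin N → ℂ), ∀ φ : ℍ → (Fin N → ℂ) → ℂ,
      slash L k m φ g τ z = C * φ τ' z' :=
  ⟨_, _, _, fun _ => (mul_assoc _ _ _).symm⟩

/-- Right multiplication by `g` on the coset space. -/
def cosetMulRight (L : EvenLattice N) (k m : ℕ) (g : JacobiGroup N) :
    CosetSpace L k m ≃ CosetSpace L k m where
  toFun := Quotient.map (· * g) fun a b hab => by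
    have h := QuotientGroup.rightRel_apply.mp hab
    refine QuotientGroup.rightRel_apply.mpr ?_
    rwa [mul_inv_rev, mul_assoc, mul_inv_cancel_left]
  invFun := Quotient.map (· * g⁻¹) fun a b hab => by
    have h := QuotientGroup.rightRel_apply.mp hab
    refine QuotientGroup.rightRel_apply.mpr ?_
    rwa [mul_inv_rev, mul_assoc, mul_inv_cancel_left]
  left_inv q := by
    induction q using Quotient.inductionOn with
    | h a => simp
  right_inv q := by
    induction q using Quotient.inductionOn with
    | h a => simp

theorem slash_eisensteinTerm (k m : ℕ) (g : JacobiGroup N) (q : CosetSpace L k m) :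
    slash L k m (eisensteinTerm L k m q) g = eisensteinTerm L k m (cosetMulRight L k m g q) := by
  induction q using Quotient.inductionOn with
  | h a => exact (slash_mul L k m (oneFun N) a g).symm

theorem slash_jacobiE (L : EvenLattice N) (k m : ℕ) (g : JacobiGroup N) :
    slash L k m (jacobiE L k m) g = jacobiE L k m := by
  funext τ z
  obtain ⟨C, τ', z', h⟩ := exists_slash_eq L k m g τ z
  rw [h, jacobiE, ← tsum_mul_left, jacobiE,
    ← (cosetMulRight L k m g).tsum_eq fun q => eisensteinTerm L k m q τ z]
  refine tsum_congr fun q => ?_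
  rw [← h, slash_eisensteinTerm]

/-- Transports an expansion over a subfamily to the full index set, with coefficients extended by
zero. -/
theorem hasSum_extend_mul {ι J : Type*} {P : J → Prop} {e : ι → {p // P p}}
    (he : Function.Injective e) (b : ι → ℂ) (M : {p // P p} → ℂ) {s : ℂ}
    (h : HasSum (fun i => b i * M (e i)) s) :
    HasSum (fun p => Function.extend (fun i => (e i : J)) b 0 p.1 * M p) s := by
  have he' : Function.Injective fun i => (e i : J) := Subtype.val_injective.comp he
  refine (he.hasSum_iff fun p hp => ?_).mp (h.congr_fun fun i => ?_)
  · rw [Function.extend_apply', Pi.zero_apply, zero_mul]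
    rintro ⟨i, hi⟩
    exact hp ⟨i, Subtype.ext hi⟩
  · simp only [Function.comp_apply]
    rw [he'.extend_apply]

/-- The indices `(n, λ)` with `2 n m - (λ, λ) ≥ 0`. -/
abbrev FourierIndex (L : EvenLattice N) (m : ℕ) : Type :=
  {p : ℤ × dualLattice L //
    0 ≤ 2 * (p.1 : ℚ) * m - bil L.gram (p.2 : Fin N → ℚ) (p.2 : Fin N → ℚ)}

/-- The inclusion of the pairs of positive hyperbolic norm. -/
def positiveIndex {m : ℕ} (p : PositivePairs L m) : FourierIndex L m :=
  ⟨(p.1.1, p.1.2), by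
    have := p.2.2
    push_cast
    linarith⟩

theorem positiveIndex_injective {m : ℕ} :
    Function.Injective (positiveIndex : PositivePairs L m → FourierIndex L m) := by
  intro p q h
  have h' := Prod.ext_iff.mp (congrArg Subtype.val h)
  exact Subtype.ext (Prod.ext (Nat.cast_injective (R := ℤ) h'.1) h'.2)

/-- The index `(m (x, x) / 2, m x)` of the term of the theta series attached to `x`. -/
def thetaIndex (L : EvenLattice N) (m : ℕ) (x : Fin N → ℤ) : FourierIndex L m :=
  ⟨(m * (bil L.gram x x / 2), ⟨fun i => m * (x i : ℚ), fun l => ⟨m * bil L.gram x l, by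
    have h : (fun i => (m : ℚ) * (x i : ℚ)) = (m : ℚ) • fun i => (x i : ℚ) := rfl
    rw [h, bil_smul_left, bil_intCast]
    push_cast
    rfl⟩⟩), by
    obtain ⟨s, hs⟩ := L.even x
    have h : (fun i => (m : ℚ) * (x i : ℚ)) = (m : ℚ) • fun i => (x i : ℚ) := rfl
    have h2 : bil L.gram x x / 2 = s := by omega
    simp only
    rw [h, bil_smul_left, bil_smul_right, bil_intCast, h2, hs]
    push_cast
    exact le_of_eq (by ring)⟩

theorem thetaIndex_injective {m : ℕ} (hm : 0 < m) : Function.Injective (thetaIndex L m) := by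
  intro x y h
  have h1 := congrArg (fun p : FourierIndex L m => (p.1.2 : Fin N → ℚ)) h
  have hm0 : (m : ℚ) ≠ 0 := by exact_mod_cast hm.ne'
  funext i
  exact_mod_cast mul_left_cancel₀ hm0 (congrFun h1 i)

theorem thetaTerm_eq_fourierMode (L : EvenLattice N) (m : ℕ) (x : Fin N → ℤ) (τ : ℍ)
    (z : Fin N → ℂ) : thetaTerm ((m : ℤ) • L.gram) 0 0 τ z x =
      fourierMode L (thetaIndex L m x).1.1 (thetaIndex L m x).1.2 τ z := by
  obtain ⟨s, hs⟩ := L.even x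
  have h2 : bil L.gram x x / 2 = s := by omega
  have h6 : (fun i => (((thetaIndex L m x).1.2 : Fin N → ℚ) i : ℂ)) =
      (m : ℂ) • fun i => (x i : ℂ) := by
    funext i
    simp [thetaIndex]
  have h7 : (thetaIndex L m x).1.1 = m * s := by rw [← h2]; rfl
  rw [thetaTerm_smul_gram, fourierMode, h6, h7, bil_smul_left, hs,
    ← Complex.exp_add]
  congr 1
  push_cast
  ring

theorem exists_fourier_jacobiE (hN : Even N) {k m : ℕ} (hm : 0 < m) (hk : Even k)
    (hkN : N + 2 < k) : ∃ f : ℤ → dualLattice L → ℂ, ∀ (τ : ℍ) (z : Fin N → ℂ),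
      HasSum (fun p : FourierIndex L m => f p.1.1 p.1.2 * fourierMode L p.1.1 p.1.2 τ z)
        (jacobiE L k m τ z) := by
  -- Pairs of positive norm carry the coefficient `beta`; pairs of norm zero of the form `(m(x,
  -- x)/2, mx)` carry the coefficient `1` of the theta series.
  refine ⟨fun n lam =>
    Function.extend (fun p : PositivePairs L m => (positiveIndex p).1)
      (fun p => beta L k m p.1.1 p.1.2) 0 (n, lam) +
    Function.extend (fun x => (thetaIndex L m x).1) (fun _ => 1) 0 (n, lam), fun τ z => ?_⟩
  have h1 := hasSum_extend_mul positiveIndex_injective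
    (fun p : PositivePairs L m => beta L k m p.1.1 p.1.2)
    (fun p : FourierIndex L m => fourierMode L p.1.1 p.1.2 τ z)
    (hasSum_jacobiE_sub_theta hN hm hk hkN τ z)
  have h2 := hasSum_extend_mul (thetaIndex_injective (L := L) hm) (fun _ => 1)
    (fun p : FourierIndex L m => fourierMode L p.1.1 p.1.2 τ z)
    (((summable_thetaTerm hN hm hk hkN τ z).hasSum).congr_fun fun x => by
      rw [one_mul, thetaTerm_eq_fourierMode])
  have h := h1.add h2
  rw [← theta, sub_add_cancel] at h
  exact h.congr_fun fun p => add_mul _ _ _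

theorem norm_fourierMode (n : ℤ) (v : Fin N → ℤ) (τ : ℍ) (z : Fin N → ℂ) :
    ‖fourierMode L n (dualEquiv L v : Fin N → ℚ) τ z‖ =
      Real.exp (-(2 * Real.pi * (n * τ.im + ∑ i, (v i : ℝ) * (z i).im))) := by
  rw [fourierMode, bil_dualEquiv, ← Complex.exp_add, Complex.norm_exp]
  congr 1
  have h : 2 * Real.pi * Complex.I * n * (τ : ℂ) +
      2 * Real.pi * Complex.I * ∑ i, (v i : ℂ) * z i =
      ((2 * Real.pi : ℝ) : ℂ) * (((n : ℝ) * τ + ∑ i, ((v i : ℝ) : ℂ) * z i) * Complex.I) := by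
    push_cast
    ring
  rw [h, Complex.re_ofReal_mul, Complex.mul_I_re, Complex.add_im, Complex.im_ofReal_mul,
    Complex.im_sum]
  simp only [Complex.im_ofReal_mul]
  change _ * -(n * τ.im + _) = _
  ring

/-- The point of `ℂ^N` with coordinates `± R i`. -/
def signCorner (R : ℝ) (ε : Fin N → Bool) (i : Fin N) : ℂ :=
  ((if ε i then R else -R : ℝ) : ℂ) * Complex.I

/-- The modulus is `exp(-2π(n Im τ + v · Im z))`. Over the box `|Im z_i| ≤ R` it is largest at the
corner whose signs are opposite to those of `v`, and since `n ≥ 0` it increases when `Im τ` is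
lowered to `y`. Summing over all corners removes the dependence on `v`. -/
theorem norm_fourierMode_le_sum {y R : ℝ} (hy : 0 < y) {n : ℤ} (hn : 0 ≤ n) (lam : dualLattice L)
    {τ : ℍ} {z : Fin N → ℂ} (hτ : y ≤ τ.im) (hz : ∀ i, |(z i).im| ≤ R) :
    ‖fourierMode L n lam τ z‖ ≤
      ∑ ε : Fin N → Bool, ‖fourierMode L n lam ⟨y * Complex.I, by simpa using hy⟩
        (signCorner R ε)‖ := by
  obtain ⟨v, rfl⟩ := (dualEquiv L).surjective lam
  refine le_trans ?_ (Finset.single_le_sum (fun ε _ => norm_nonneg _)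
    (Finset.mem_univ fun i => decide (v i < 0)))
  rw [norm_fourierMode, norm_fourierMode, Real.exp_le_exp]
  have hpi := Real.pi_pos
  have him : UpperHalfPlane.im ⟨y * Complex.I, by simpa using hy⟩ = y := by
    change (y * Complex.I).im = y
    simp
  rw [him]
  have h1 : (n : ℝ) * y ≤ n * τ.im := mul_le_mul_of_nonneg_left hτ (by exact_mod_cast hn)
  have h2 : ∑ i, (v i : ℝ) * (signCorner R (fun i => decide (v i < 0)) i).im ≤
      ∑ i, (v i : ℝ) * (z i).im := by
    refine Finset.sum_le_sum fun i _ => ?_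
    have hi := abs_le.mp (hz i)
    simp only [signCorner, Complex.mul_I_im, Complex.ofReal_re]
    by_cases hv : v i < 0
    · have : (v i : ℝ) ≤ 0 := by exact_mod_cast hv.le
      simp only [hv, decide_true, if_true]
      exact mul_le_mul_of_nonpos_left hi.2 this
    · have : (0 : ℝ) ≤ v i := by exact_mod_cast not_lt.mp hv
      simp only [hv, decide_false, Bool.false_eq_true, if_false]
      exact mul_le_mul_of_nonneg_left hi.1 this
  nlinarith

/-- Pointwise convergence everywhere implies locally normal convergence: near a given point the
terms are dominated by their moduli at the `2^N` corner points over `iy`, where the expansion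
converges absolutely. -/
theorem differentiableOn_of_fourier {m : ℕ} (hm : 0 < m) {φ : ℍ → (Fin N → ℂ) → ℂ}
    {f : ℤ → dualLattice L → ℂ} (hf : ∀ (τ : ℍ) (z : Fin N → ℂ),
      HasSum (fun p : FourierIndex L m => f p.1.1 p.1.2 * fourierMode L p.1.1 p.1.2 τ z) (φ τ z)) :
    DifferentiableOn ℂ (fun p : ℂ × (Fin N → ℂ) => φ (UpperHalfPlane.ofComplex p.1) p.2)
      {p | 0 < p.1.im} := by
  have hU : IsOpen {p : ℂ × (Fin N → ℂ) | 0 < p.1.im} :=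
    isOpen_lt continuous_const (by fun_prop)
  have hof : ∀ w : ℂ, 0 < w.im → ((UpperHalfPlane.ofComplex w : ℍ) : ℂ) = w := fun w hw => by
    rw [UpperHalfPlane.ofComplex_apply_of_im_pos hw]
  have key := differentiableOn_tsum_of_summable_bound
    (f := fun (p : FourierIndex L m) (q : ℂ × (Fin N → ℂ)) => f p.1.1 p.1.2 *
      fourierMode L p.1.1 p.1.2 (UpperHalfPlane.ofComplex q.1) q.2) hU (fun p => ?_) fun q hq => ?_
  · refine key.congr fun q hq => ?_
    exact (hf _ _).tsum_eq.symm
  · have h : DifferentiableOn ℂ (fun q : ℂ × (Fin N → ℂ) => f p.1.1 p.1.2 *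
        (Complex.exp (2 * Real.pi * Complex.I * p.1.1 * q.1) *
        Complex.exp (2 * Real.pi * Complex.I *
          bil L.gram (fun i => ((p.1.2 : Fin N → ℚ) i : ℂ)) q.2))) {p | 0 < p.1.im} := by
      unfold bil
      fun_prop
    refine h.congr fun q hq => ?_
    simp only [fourierMode]
    rw [hof _ hq]
  · have hq' : 0 < q.1.im := hq
    set y := q.1.im / 2 with hy
    set R := 1 + ∑ i, |(q.2 i).im| with hR
    have hy0 : 0 < y := by positivity
    let τ' : ℍ := ⟨y * Complex.I, by simpa using hy0⟩
    have hs : Summable fun p : FourierIndex L m => ∑ ε : Fin N → Bool,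
        ‖f p.1.1 p.1.2 * fourierMode L p.1.1 p.1.2 τ' (signCorner R ε)‖ :=
      summable_sum fun ε _ => (hf τ' (signCorner R ε)).summable.norm
    refine ⟨{p | y < p.1.im ∧ ∀ i, |(p.2 i).im| < R}, ?_, _, hs, fun p x hx => ?_⟩
    · refine IsOpen.mem_nhds ?_ ⟨by linarith, fun i => ?_⟩
      · refine IsOpen.and (isOpen_lt continuous_const (by fun_prop)) ?_
        simp only [ofPred_forall]
        exact isOpen_iInter_of_finite fun i => isOpen_lt (by fun_prop) continuous_const
      · have := Finset.single_le_sum (fun i _ => abs_nonneg (q.2 i).im) (Finset.mem_univ i)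
        linarith
    -- The index condition `2nm ≥ (λ, λ) ≥ 0` gives `n ≥ 0`.
    · have hn : 0 ≤ p.1.1 := by
        have h1 := p.2
        have h2 := bil_self_nonneg_rat L (p.1.2 : Fin N → ℚ)
        have hm0 : (0 : ℚ) < m := by exact_mod_cast hm
        have h3 : (0 : ℚ) ≤ p.1.1 := by
          by_contra hcon
          nlinarith
        exact_mod_cast h3
      simp only [norm_mul]
      rw [← Finset.mul_sum]
      refine mul_le_mul_of_nonneg_left (norm_fourierMode_le_sum hy0 hn _ ?_ fun i => (hx.2 i).le)
        (norm_nonneg _)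
      change y ≤ ((UpperHalfPlane.ofComplex x.1 : ℍ) : ℂ).im
      rw [hof _ (hy0.trans hx.1)]
      exact hx.1.le

theorem isJacobiForm_jacobiE (hN : Even N) {k m : ℕ} (hm : 0 < m) (hk : Even k)
    (hkN : N + 2 < k) : IsJacobiForm L k m (jacobiE L k m) := by
  obtain ⟨f, hf⟩ := exists_fourier_jacobiE (L := L) hN hm hk hkN
  exact ⟨differentiableOn_of_fourier hm hf, slash_jacobiE L k m, f, hf⟩

end JacobiForm

end JacobiEisenstein

end

theorem mainTheorem3 {N : ℕ} (hN : Even N) (L : JacobiEisenstein.EvenLattice N) (k m : ℕ)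
    (hm : 0 < m) (hk : Even k) (hkN : N + 2 < k) :
    (∀ (τ : ℍ) (z : Fin N → ℂ),
      Summable fun q : JacobiEisenstein.CosetSpace L k m =>
        JacobiEisenstein.eisensteinTerm L k m q τ z) ∧
    JacobiEisenstein.IsJacobiForm L k m (JacobiEisenstein.jacobiE L k m) ∧
    (∀ (τ : ℍ) (z : Fin N → ℂ),
      Summable (JacobiEisenstein.thetaTerm ((m : ℤ) • L.gram) 0 0 τ z)) ∧
    (∀ (n : ℕ) (lam : JacobiEisenstein.dualLattice L), 1 ≤ n →
      JacobiEisenstein.bil L.gram (lam : Fin N → ℚ) (lam : Fin N → ℚ) / 2 < n * m →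
      Summable (JacobiEisenstein.betaTerm L k m n lam)) ∧
    (∀ (τ : ℍ) (z : Fin N → ℂ),
      HasSum (fun p : {p : ℕ × JacobiEisenstein.dualLattice L // 1 ≤ p.1 ∧
          JacobiEisenstein.bil L.gram (p.2 : Fin N → ℚ) (p.2 : Fin N → ℚ) / 2 < p.1 * m} =>
        JacobiEisenstein.beta L k m p.1.1 p.1.2 *
          JacobiEisenstein.fourierMode L p.1.1 p.1.2 τ z)
        (JacobiEisenstein.jacobiE L k m τ z -
          JacobiEisenstein.theta ((m : ℤ) • L.gram) 0 0 τ z)) := by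
  exact ⟨JacobiEisenstein.summable_eisensteinTerm hN hm hk hkN,
    JacobiEisenstein.isJacobiForm_jacobiE hN hm hk hkN,
    JacobiEisenstein.summable_thetaTerm hN hm hk hkN,
    fun n lam _ _ => JacobiEisenstein.summable_betaTerm L hm hkN n lam,
    JacobiEisenstein.hasSum_jacobiE_sub_theta hN hm hk hkN⟩
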